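/- Theorem. All graphs are finite and simple. For a vertex $x$ let $N(x)$ be its set of neighbours. \emph{Good partitions.} A clique path of a graph $H$ is an ordering $(K_1,\dots,K_k)$ of all maximal cliques of $H$ (each listed once) such that, for every vertex $v$ of $H$, the maximal cliques containing $v$ are consecutive. If $X$ is a maximal clique of $H$, then $H$ is an $X$-interval graph if it has a clique path of the form $(K_1,\dots,K_k,X)$. A good partition of a graph $G$ is a pair $(X,\mathcal B)$, where $X$ is a maximal clique of $G$ and $\mathcal B$ is a partition of $V(G)\setminus X$ into non-empty blocks, such that (1) every connected component of $G-X$ is contained in a block of $\mathcal B$; (2) for every block $B\in\mathcal B$ the graph $G[X\cup B]$ is an $X$-interval graph; (3) there is an ordering $(x_1,\dots,x_t)$ of $X$ such that for every $i$ there are at least $|\mathcal B|-1$ blocks $B\in\mathcal B$ with $N(x_i)\cap B\subseteq N(x_j)$ for all $j\ge i$. \emph{Star NeS models.} An embedding tree $\mathcal T$ is a finite tree embedded in the Euclidean plane such that its nodes are distinct points, its edges are the line segments between their ends, and distinct segments meet only in common ends; $\mathcal T$ is also regarded as the set of points on its line segments, and $d_{\mathcal T}(p,q)$ is the length of the path in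 $\mathcal T$ between the points $p$ and $q$. A neighborhood subtree is a set $\{p\in\mathcal T : d_{\mathcal T}(p,c)\le w\}$ with center $c\in\mathcal T$ and rational radius $w\ge 0$. A NeS model of $G$ consists of an embedding tree $\mathcal T$ and a neighborhood subtree $T_v$ of $\mathcal T$ for every $v\in V(G)$ such that distinct vertices $u,v$ are adjacent in $G$ if and only if $T_u\cap T_v\ne\emptyset$. It is a star NeS model if $\mathcal T$ is a star. A graph $G$ admits a good partition if and only if it admits a star NeS model. Moreover, there is a polynomial-time algorithm that, given a graph $G$ and a good partition $(X,\mathcal B)$ of $G$, computes a star NeS model of $G$ with rational data. Here $G$ is given by its adjacency matrix, $X$ and the blocks of $\mathcal B$ (listed in any order) by their characteristic vectors, and the model is returned as the list of the lengths of the segments of the star together with, for every vertex $v$, a segment containing the center of $T_v$, the distance of this center from the center of the star, and the radius of $T_v$; numbers are written in binary. -/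

import Mathlib

/-! ### Clique paths, `X`-interval graphs and good partitions -/

/-- `L` lists the vertices of a clique path of `G` in their order along the path: it enumerates the
maximal cliques of `G`, and the maximal cliques containing a given vertex are consecutive in `L`,
i.e. they induce a subpath. -/
structure IsCliquePath {V : Type*} (G : SimpleGraph V) (L : List (Set V)) : Prop where
  nodup : L.Nodup
  mem_iff : ∀ K : Set V, K ∈ L ↔ Maximal G.IsClique K
  consecutive : ∀ (i j k : Fin L.length) (v : V),
    i ≤ j → j ≤ k → v ∈ L.get i → v ∈ L.get k → v ∈ L.get j

/-- `X` is a maximal clique of `G` and `G` has a clique path ending with `X`. -/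
def IsXInterval {V : Type*} (G : SimpleGraph V) (X : Set V) : Prop :=
  Maximal G.IsClique X ∧ ∃ L : List (Set V), IsCliquePath G (L ++ [X])

/-- `N(x)` is minimal in the block `B` for `Y`: `N(x) ∩ B ⊆ N(y)` for every `y ∈ Y`. -/
def MinimalInBlock {V : Type*} (G : SimpleGraph V) (x : V) (B Y : Finset V) : Prop :=
  ∀ y ∈ Y, G.neighborSet x ∩ (B : Set V) ⊆ G.neighborSet y

open Classical in
/-- `x ∈ Y` is removable from `Y` for the collection of blocks `𝓑`: `N(x)` is minimal for `Y` in at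
least `|𝓑| - 1` blocks. -/
def Removable {V : Type*} (G : SimpleGraph V) (𝓑 : Finset (Finset V)) (Y : Finset V) (x : V) :
    Prop :=
  x ∈ Y ∧ 𝓑.card ≤ (𝓑.filter fun B => MinimalInBlock G x B Y).card + 1

/-- `(X, 𝓑)` is a good partition of `G`, where `𝓑` is a partition of `V(G) \ X` into non-empty
blocks. -/
structure IsGoodPartition {V : Type*} [Fintype V] [DecidableEq V] (G : SimpleGraph V)
    (X : Finset V) (𝓑 : Finpartition Xᶜ) : Prop where
  maximal_clique : Maximal G.IsClique (X : Set V)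
  /-- Every connected component of `G - X` is contained in a block. -/
  components_le : ∀ C : (G.induce ((X : Set V)ᶜ)).ConnectedComponent,
    ∃ B ∈ 𝓑.parts, ∀ v ∈ C.supp, (v : V) ∈ B
  /-- For every block `B`, the graph `G[X ∪ B]` is an `X`-interval graph. -/
  xInterval : ∀ B ∈ 𝓑.parts,
    IsXInterval (G.induce ((X : Set V) ∪ (B : Set V))) {v | (v : V) ∈ X}
  /-- There is an ordering `l = (x₁, …, xₜ)` of `X` such that each `xᵢ` is removable from
  `{xᵢ, …, xₜ}`. -/
  elimination : ∃ l : List V, l.Nodup ∧ l.toFinset = X ∧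
    ∀ i : Fin l.length, Removable G 𝓑.parts (l.drop i).toFinset (l.get i)

/-- `G` admits a good partition. -/
def HasGoodPartition {V : Type*} [Fintype V] [DecidableEq V] (G : SimpleGraph V) : Prop :=
  ∃ (X : Finset V) (𝓑 : Finpartition Xᶜ), IsGoodPartition G X 𝓑

/-! ### Embedded trees and NeS models -/

/-- The Euclidean plane. -/
abbrev Plane : Type := EuclideanSpace ℝ (Fin 2)

/-- A tree with node set `N` embedded in the Euclidean plane: distinct nodes are placed at distinct
points, each edge is the line segment between its two ends, and two different segments can only
meet in the position of a common end. -/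
structure EmbeddedTree (N : Type*) where
  graph : SimpleGraph N
  isTree : graph.IsTree
  pos : N → Plane
  pos_injective : Function.Injective pos
  segments_inter : ∀ a b c d : N, graph.Adj a b → graph.Adj c d → s(a, b) ≠ s(c, d) →
    ∀ p ∈ segment ℝ (pos a) (pos b) ∩ segment ℝ (pos c) (pos d),
      ∃ v, v ∈ s(a, b) ∧ v ∈ s(c, d) ∧ p = pos v

namespace EmbeddedTree

variable {N : Type*} (T : EmbeddedTree N)

/-- The points `x` and `y` lie on a common line segment of `T`. -/
def OnCommonSegment (x y : Plane) : Prop :=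
  ∃ a b : N, T.graph.Adj a b ∧
    x ∈ segment ℝ (T.pos a) (T.pos b) ∧ y ∈ segment ℝ (T.pos a) (T.pos b)

/-- The set of points of the embedded tree: the union of its line segments. -/
def points : Set Plane :=
  {p | ∃ a b : N, T.graph.Adj a b ∧ p ∈ segment ℝ (T.pos a) (T.pos b)}

/-- `T.PathLength x y ℓ`: there is a polygonal path of length `ℓ` from `x` to `y` inside `T`, each
piece of which runs along a single line segment of `T`. -/
inductive PathLength : Plane → Plane → ℝ → Prop
  | single {x y : Plane} : T.OnCommonSegment x y → PathLength x y (dist x y)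
  | step {x z y : Plane} {l : ℝ} : T.OnCommonSegment x z → PathLength z y l →
      PathLength x y (dist x z + l)

/-- The distance in `T` between two of its points: the length of a shortest path inside `T`, which
is the length of the unique path of `T` between the two points. -/
noncomputable def treeDist (x y : Plane) : ℝ :=
  sInf {l | T.PathLength x y l}

/-- The neighborhood subtree with center `c` and radius `w`. -/
def neighborhoodSubtree (c : Plane) (w : ℚ≥0) : Set Plane :=
  {p | p ∈ T.points ∧ T.treeDist p c ≤ (w : ℝ)}

/-- `T` is a star: some node is adjacent to all other nodes. -/
def IsStar : Prop :=
  ∃ c : N, ∀ v : N, v ≠ c → T.graph.Adj c v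

end EmbeddedTree

/-- A NeS model of `G` whose embedded tree has node set `N`: every vertex `v` of `G` gets the
neighborhood subtree with center `center v` and radius `radius v`, and two distinct vertices are
adjacent if and only if their neighborhood subtrees intersect. -/
structure NeSModel {V : Type*} (G : SimpleGraph V) (N : Type*) where
  tree : EmbeddedTree N
  center : V → Plane
  radius : V → ℚ≥0
  center_mem : ∀ v, center v ∈ tree.points
  adj_iff : ∀ u v : V, u ≠ v →
    (G.Adj u v ↔ (tree.neighborhoodSubtree (center u) (radius u) ∩
      tree.neighborhoodSubtree (center v) (radius v)).Nonempty)

/-- `G` admits a star NeS model, that is, a NeS model whose embedded (finite) tree is a star. -/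
def HasStarNeSModel {V : Type*} (G : SimpleGraph V) : Prop :=
  ∃ (m : ℕ) (M : NeSModel G (Fin m)), M.tree.IsStar

/-- A finite description of a star NeS model of a graph with vertex set `Fin n`: the number of line
segments of the star and their lengths, and, for each vertex, a segment containing the center of its
neighborhood subtree, the distance of that center from the center of the star, and the radius. -/
structure StarDescription (n : ℕ) where
  legs : ℕ
  length : Fin legs → ℚ≥0
  leg : Fin n → Fin legs
  offset : Fin n → ℚ≥0
  radius : Fin n → ℚ≥0

/-- `D` describes the NeS model `M`, whose tree is the star with center node `0` and leaves
`1, …, D.legs`. -/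
structure StarDescription.Describes {n : ℕ} (D : StarDescription n) {G : SimpleGraph (Fin n)}
    (M : NeSModel G (Fin (D.legs + 1))) : Prop where
  adj : ∀ i : Fin D.legs, M.tree.graph.Adj 0 i.succ
  length_eq : ∀ i : Fin D.legs, dist (M.tree.pos 0) (M.tree.pos i.succ) = (D.length i : ℝ)
  center_mem : ∀ v, M.center v ∈ segment ℝ (M.tree.pos 0) (M.tree.pos (D.leg v).succ)
  offset_eq : ∀ v, dist (M.tree.pos 0) (M.center v) = (D.offset v : ℝ)
  radius_eq : ∀ v, M.radius v = D.radius v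

/-! ### A machine model with a running time

Programs of a first-order language with `while` loops, working on binary trees. Every elementary
step is charged at least the size of the data that it reads or copies, so the running time is
polynomially related to that of a Turing machine. -/

/-- The data: binary trees with a single kind of leaf. -/
inductive Data where
  | nil : Data
  | cons : Data → Data → Data

/-- The number of nodes of a tree. -/
def Data.size : Data → ℕ
  | .nil => 1
  | .cons a b => a.size + b.size + 1

/-- Programs. Each one computes a partial function from trees to trees: the identity, the constant
`nil`, the two components of a tree, pairing, composition (`comp p q` runs `q` first), branching and
iteration (`loop c p` replaces its state by the result of `p` as long as `c` does not give `nil`). -/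
inductive Prog where
  | id : Prog
  | nil : Prog
  | head : Prog
  | tail : Prog
  | pair : Prog → Prog → Prog
  | comp : Prog → Prog → Prog
  | ite : Prog → Prog → Prog → Prog
  | loop : Prog → Prog → Prog

/-- `Prog.Runs p x y t`: on input `x` the program `p` halts with output `y` after time `t`. -/
inductive Prog.Runs : Prog → Data → Data → ℕ → Prop
  | id (x : Data) : Runs .id x x x.size
  | nil (x : Data) : Runs .nil x .nil x.size
  | head_nil : Runs .head .nil .nil 1
  | head_cons (a b : Data) : Runs .head (.cons a b) a (Data.cons a b).size
  | tail_nil : Runs .tail .nil .nil 1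
  | tail_cons (a b : Data) : Runs .tail (.cons a b) b (Data.cons a b).size
  | pair {p q : Prog} {x a b : Data} {s t : ℕ} : Runs p x a s → Runs q x b t →
      Runs (.pair p q) x (.cons a b) (s + t + x.size)
  | comp {p q : Prog} {x y z : Data} {s t : ℕ} : Runs q x y s → Runs p y z t →
      Runs (.comp p q) x z (s + t + 1)
  | ite_nil {c p q : Prog} {x y : Data} {s t : ℕ} : Runs c x .nil s → Runs q x y t →
      Runs (.ite c p q) x y (s + t + x.size)
  | ite_cons {c p q : Prog} {x a b y : Data} {s t : ℕ} : Runs c x (.cons a b) s → Runs p x y t →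
      Runs (.ite c p q) x y (s + t + x.size)
  | loop_nil {c p : Prog} {x : Data} {s : ℕ} : Runs c x .nil s →
      Runs (.loop c p) x x (s + x.size)
  | loop_cons {c p : Prog} {x a b y z : Data} {s t u : ℕ} : Runs c x (.cons a b) s →
      Runs p x y t → Runs (.loop c p) y z u → Runs (.loop c p) x z (s + t + u + x.size)

theorem Data.size_pos (x : Data) : 1 ≤ x.size := by
  cases x <;> simp [Data.size]

/-- The running time bounds the size of the output. -/
theorem Prog.Runs.size_le {p : Prog} {x y : Data} {t : ℕ} (h : Prog.Runs p x y t) :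
    y.size ≤ t := by
  induction h with
  | loop_cons _ _ _ _ _ ih => omega
  | @pair _ _ x _ _ _ _ _ _ _ _ =>
    have := x.size_pos
    simp only [Data.size]
    omega
  | nil x => exact x.size_pos
  | _ => grind [Data.size, Data.size_pos]

/-- Programs are deterministic: output and running time are determined by the input. -/
theorem Prog.Runs.det {p : Prog} {x y : Data} {t : ℕ} (h : Prog.Runs p x y t) :
    ∀ {y' : Data} {t' : ℕ}, Prog.Runs p x y' t' → y' = y ∧ t' = t := by
  induction h <;> intro y' t' h' <;> cases h' <;> grind

/-! ### Encodings of inputs and outputs -/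

/-- Booleans as trees. -/
def encodeBit : Bool → Data
  | false => .nil
  | true => .cons .nil .nil

/-- Lists of trees as trees. -/
def encodeDataList : List Data → Data
  | [] => .nil
  | a :: l => .cons a (encodeDataList l)

/-- Natural numbers in binary, least significant bit first. -/
def encodeNatural (k : ℕ) : Data :=
  encodeDataList (k.bits.map encodeBit)

/-- Non-negative rationals, as the pair of numerator and denominator in binary. -/
def encodeRational (q : ℚ≥0) : Data :=
  .cons (encodeNatural q.num) (encodeNatural q.den)

/-- A graph on `Fin n`, given by its adjacency matrix. -/
noncomputable def encodeGraph {n : ℕ} (G : SimpleGraph (Fin n)) : Data :=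
  open Classical in
  encodeDataList (List.ofFn fun i =>
    encodeDataList (List.ofFn fun j => encodeBit (decide (G.Adj i j))))

/-- A set of vertices, given by its characteristic vector. -/
def encodeVertexSet {n : ℕ} (X : Finset (Fin n)) : Data :=
  encodeDataList (List.ofFn fun i => encodeBit (decide (i ∈ X)))

/-- The input: a graph, a set of vertices and a list of blocks. -/
noncomputable def encodeInput {n : ℕ} (G : SimpleGraph (Fin n)) (X : Finset (Fin n))
    (blocks : List (Finset (Fin n))) : Data :=
  .cons (encodeGraph G) (.cons (encodeVertexSet X) (encodeDataList (blocks.map encodeVertexSet)))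

/-- The output: the list of the lengths of the segments, and for each vertex the index of its
segment, the offset of its center and its radius. -/
def StarDescription.encode {n : ℕ} (D : StarDescription n) : Data :=
  .cons (encodeDataList (List.ofFn fun i => encodeRational (D.length i)))
    (encodeDataList (List.ofFn fun v =>
      .cons (encodeNatural (D.leg v))
        (.cons (encodeRational (D.offset v)) (encodeRational (D.radius v)))))

/-! From a star model to a good partition: let `a v` and `b v` be the offset of the center of `v`
minus and plus its radius. On its own leg the subtree of `v` covers the part of the interval from `a
v` to `b v` that lies on the leg; if `a v ≤ 0`, it contains the center of the star and reaches to
distance `-a v` on the other legs. The vertices with `a v ≤ 0` form a clique, which becomes maximal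
after moving suitable left ends to the center (`IsIntervalStar.exists_maximal`). This clique is `X`
and the legs give the blocks. Each leg carries an interval model in which `X` sits at the end, and
if `X` is ordered by increasing reach, a vertex can fail to be minimal only on its own leg
(`IsIntervalStar.hasGoodPartition`).

From a good partition to a star model: the clique path of each `G[X ∪ B]` orders the non-adjacent
pairs ("conflicts") from `X` outwards, and this is a transitive orientation with no edge into `X`.
For any such orientation the predecessor sets inside a block are nested, since otherwise the
interval graph `G[X ∪ B]` would contain an induced 4-cycle (`predecessors_nested`). The elimination
ordering gives heights on `X`. For `v` in a block let `c v` be the largest height of a non-neighbor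
in `X`. A clique vertex `x` with `h x > c v` is adjacent to `v`; the neighbors `v` of `x` with `h x
≤ c v` all lie in one block, which becomes the leg of `x`. The left end of `v` is a two-digit number
in base `|V| + 1`: the leading digit `c v` is compared with the reach of clique vertices from other
legs, and the number of predecessors orders the vertices of one leg. Right ends are the farthest
left ends that have to be met. `IsStarData` collects these properties, and
`IsStarData.isIntervalStar` checks the adjacencies.

For the algorithm, the given ordering of `X` is replaced by rounds that delete all removable
vertices at once, and the clique paths by a transitive orientation found by Golumbic's method:
orient an implication class, remove it, repeat. The classes of the edges leaving `X` are treated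
first, so no edge enters `X`. The method never gets stuck, because removing a class at most merges
pairs of the other classes (`IsOrientable.forces_of_removeClass`, `IsOrientable.removeClass`). All
numbers involved are polynomially bounded, so the computation can use unary arithmetic and convert
to binary at the end. -/

/-! ### Polynomial-time computable functions -/

/-- Types whose elements are represented by binary trees. -/
class DataEncoding (α : Type) where
  toData : α → Data

open DataEncoding (toData)

/-- The size of the representation of `a`. -/
def encSize {α : Type} [DataEncoding α] (a : α) : ℕ := (toData a).size

instance : DataEncoding Unit := ⟨fun _ => .nil⟩
instance : DataEncoding Bool := ⟨encodeBit⟩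
instance {α β : Type} [DataEncoding α] [DataEncoding β] : DataEncoding (α × β) :=
  ⟨fun x => .cons (toData x.1) (toData x.2)⟩
instance {α : Type} [DataEncoding α] : DataEncoding (List α) :=
  ⟨fun l => encodeDataList (l.map toData)⟩

/-- Natural numbers are represented in unary. -/
instance : DataEncoding ℕ := ⟨fun n => toData (List.replicate n ())⟩

section sizes
variable {α β : Type} [DataEncoding α] [DataEncoding β]

theorem encSize_pos (a : α) : 1 ≤ encSize a := Data.size_pos _

@[simp] theorem encSize_pair (a : α) (b : β) : encSize (a, b) = encSize a + encSize b + 1 := rfl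
@[simp] theorem encSize_nil : encSize ([] : List α) = 1 := rfl
@[simp] theorem encSize_cons (a : α) (l : List α) :
    encSize (a :: l) = encSize a + encSize l + 1 := rfl
@[simp] theorem encSize_unit (a : Unit) : encSize a = 1 := rfl

theorem encSize_bool (b : Bool) : encSize b ≤ 3 := by cases b <;> decide

@[simp] theorem encSize_nat (n : ℕ) : encSize n = 2 * n + 1 := by
  change encSize (List.replicate n ()) = _
  induction n with
  | zero => rfl
  | succ n ih => rw [List.replicate_succ, encSize_cons, ih, encSize_unit]; ring

theorem encSize_list_le (l : List α) (c : ℕ) (h : ∀ a ∈ l, encSize a ≤ c) :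
    encSize l ≤ l.length * (c + 1) + 1 := by
  induction l with
  | nil => simp
  | cons a l ih =>
    simp only [List.mem_cons, forall_eq_or_imp] at h
    have := ih h.2
    simp only [encSize_cons, List.length_cons]
    linarith [h.1]

theorem length_le_encSize (l : List α) : l.length + 1 ≤ encSize l := by
  induction l with
  | nil => simp
  | cons a l ih => simp only [encSize_cons, List.length_cons]; linarith [encSize_pos a]

theorem encSize_append (l₁ l₂ : List α) : encSize (l₁ ++ l₂) + 1 = encSize l₁ + encSize l₂ := by
  induction l₁ with
  | nil => simp; omega
  | cons a l ih => simp only [List.cons_append, encSize_cons]; omega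

end sizes

theorem natPoly_mono (q : Polynomial ℕ) {x y : ℕ} (h : x ≤ y) : q.eval x ≤ q.eval y := by
  simp only [Polynomial.eval_eq_sum_range]
  gcongr

/-- `f` is computed by a program in polynomial time. -/
@[fun_prop] def PolyTime {α β : Type} [DataEncoding α] [DataEncoding β] (f : α → β) : Prop :=
  ∃ (p : Prog) (q : Polynomial ℕ), ∀ a, ∃ t,
    Prog.Runs p (toData a) (toData (f a)) t ∧ t ≤ q.eval (encSize a)

namespace PolyTime

variable {α β γ δ κ σ : Type} [DataEncoding α] [DataEncoding β] [DataEncoding γ] [DataEncoding δ]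
  [DataEncoding κ] [DataEncoding σ]

theorem encSize_le {f : α → β} (hf : PolyTime f) :
    ∃ q : Polynomial ℕ, ∀ a, encSize (f a) ≤ q.eval (encSize a) := by
  obtain ⟨p, q, h⟩ := hf
  refine ⟨q, fun a => ?_⟩
  obtain ⟨t, h1, h2⟩ := h a
  exact h1.size_le.trans h2

@[fun_prop] theorem id' : PolyTime (fun a : α => a) :=
  ⟨.id, .X, fun a => ⟨_, .id _, by simp [encSize]⟩⟩

/-- Functions that do not change the representation. -/
theorem of_toData_eq {f : α → β} (h : ∀ a, toData (f a) = toData a) : PolyTime f :=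
  ⟨.id, .X, fun a => ⟨_, by rw [h]; exact .id _, by simp [encSize]⟩⟩

@[fun_prop] theorem comp' {f : β → γ} {g : α → β} (hf : PolyTime f) (hg : PolyTime g) :
    PolyTime (fun a => f (g a)) := by
  obtain ⟨p₁, q₁, h₁⟩ := hf
  obtain ⟨p₂, q₂, h₂⟩ := hg
  refine ⟨.comp p₁ p₂, q₂ + q₁.comp q₂ + 1, fun a => ?_⟩
  obtain ⟨t₂, r₂, b₂⟩ := h₂ a
  obtain ⟨t₁, r₁, b₁⟩ := h₁ (g a)
  refine ⟨_, .comp r₂ r₁, ?_⟩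
  -- The intermediate value is no larger than the time spent on producing it.
  have : q₁.eval (encSize (g a)) ≤ q₁.eval (q₂.eval (encSize a)) :=
    natPoly_mono _ (r₂.size_le.trans b₂)
  simp only [Polynomial.eval_add, Polynomial.eval_comp, Polynomial.eval_one]
  omega

@[fun_prop] theorem prodMk {f : α → β} {g : α → γ} (hf : PolyTime f) (hg : PolyTime g) :
    PolyTime (fun a => (f a, g a)) := by
  obtain ⟨p₁, q₁, h₁⟩ := hf
  obtain ⟨p₂, q₂, h₂⟩ := hg
  refine ⟨.pair p₁ p₂, q₁ + q₂ + .X, fun a => ?_⟩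
  obtain ⟨t₁, r₁, b₁⟩ := h₁ a
  obtain ⟨t₂, r₂, b₂⟩ := h₂ a
  refine ⟨_, .pair r₁ r₂, ?_⟩
  simp only [Polynomial.eval_add, Polynomial.eval_X]
  have : (toData a).size = encSize a := rfl
  omega

theorem exists_prog_data (d : Data) :
    ∃ (p : Prog) (q : Polynomial ℕ), ∀ x : Data, ∃ t, Prog.Runs p x d t ∧ t ≤ q.eval x.size := by
  induction d with
  | nil => exact ⟨.nil, .X, fun x => ⟨_, .nil x, by simp⟩⟩
  | cons a b iha ihb =>
    obtain ⟨p₁, q₁, h₁⟩ := iha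
    obtain ⟨p₂, q₂, h₂⟩ := ihb
    refine ⟨.pair p₁ p₂, q₁ + q₂ + .X, fun x => ?_⟩
    obtain ⟨t₁, r₁, b₁⟩ := h₁ x
    obtain ⟨t₂, r₂, b₂⟩ := h₂ x
    refine ⟨_, .pair r₁ r₂, ?_⟩
    simp only [Polynomial.eval_add, Polynomial.eval_X]
    omega

@[fun_prop] theorem const (b : β) : PolyTime (fun _ : α => b) := by
  obtain ⟨p, q, h⟩ := exists_prog_data (toData b)
  exact ⟨p, q, fun a => h _⟩

theorem fst : PolyTime (Prod.fst : α × β → α) :=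
  ⟨.head, .X, fun _ => ⟨_, .head_cons _ _, by simp [encSize, toData]⟩⟩

theorem snd : PolyTime (Prod.snd : α × β → β) :=
  ⟨.tail, .X, fun _ => ⟨_, .tail_cons _ _, by simp [encSize, toData]⟩⟩

@[fun_prop] theorem fst' {f : α → β × γ} (hf : PolyTime f) : PolyTime (fun a => (f a).1) :=
  fst.comp' hf

@[fun_prop] theorem snd' {f : α → β × γ} (hf : PolyTime f) : PolyTime (fun a => (f a).2) :=
  snd.comp' hf

-- `false` is encoded by `nil` and `true` by a `cons`, which is exactly what `ite` tests.
@[fun_prop] theorem cond {c : α → Bool} {f g : α → β} (hc : PolyTime c) (hf : PolyTime f)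
    (hg : PolyTime g) : PolyTime (fun a => bif c a then f a else g a) := by
  obtain ⟨p₀, q₀, h₀⟩ := hc
  obtain ⟨p₁, q₁, h₁⟩ := hf
  obtain ⟨p₂, q₂, h₂⟩ := hg
  refine ⟨.ite p₀ p₁ p₂, q₀ + q₁ + q₂ + .X, fun a => ?_⟩
  obtain ⟨t₀, r₀, b₀⟩ := h₀ a
  obtain ⟨t₁, r₁, b₁⟩ := h₁ a
  obtain ⟨t₂, r₂, b₂⟩ := h₂ a
  have : (toData a).size = encSize a := rfl
  cases hca : c a
  · rw [hca] at r₀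
    refine ⟨t₀ + t₂ + (toData a).size, by simpa only [hca, cond_false] using .ite_nil r₀ r₂, ?_⟩
    simp only [Polynomial.eval_add, Polynomial.eval_X]
    omega
  · rw [hca] at r₀
    refine ⟨t₀ + t₁ + (toData a).size, by simpa only [hca, cond_true] using .ite_cons r₀ r₁, ?_⟩
    simp only [Polynomial.eval_add, Polynomial.eval_X]
    omega

@[fun_prop] theorem and {f g : α → Bool} (hf : PolyTime f) (hg : PolyTime g) :
    PolyTime (fun a => f a && g a) := by
  have : (fun a => f a && g a) = fun a => bif f a then g a else false := by
    funext a; cases f a <;> rfl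
  rw [this]; fun_prop

@[fun_prop] theorem or {f g : α → Bool} (hf : PolyTime f) (hg : PolyTime g) :
    PolyTime (fun a => f a || g a) := by
  have : (fun a => f a || g a) = fun a => bif f a then true else g a := by
    funext a; cases f a <;> rfl
  rw [this]; fun_prop

@[fun_prop] theorem not {f : α → Bool} (hf : PolyTime f) : PolyTime (fun a => !f a) := by
  have : (fun a => !f a) = fun a => bif f a then false else true := by
    funext a; cases f a <;> rfl
  rw [this]; fun_prop

@[fun_prop] theorem listCons {f : α → β} {g : α → List β} (hf : PolyTime f) (hg : PolyTime g) :
    PolyTime (fun a => f a :: g a) := by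
  obtain ⟨p, q, h⟩ := hf.prodMk hg
  exact ⟨p, q, h⟩

@[fun_prop] theorem listTail {f : α → List β} (hf : PolyTime f) :
    PolyTime (fun a => (f a).tail) := by
  refine PolyTime.comp' (f := List.tail) ⟨.tail, .X, fun l => ?_⟩ hf
  cases l with
  | nil => exact ⟨_, .tail_nil, by simp⟩
  | cons b l => exact ⟨_, .tail_cons _ _, by simp [encSize, toData, encodeDataList]⟩

/-- The program `head` sends `nil` to `nil`, so this is the only default that costs nothing. -/
theorem listHeadD (d : β) (hd : toData d = .nil) {f : α → List β} (hf : PolyTime f) :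
    PolyTime (fun a => (f a).headD d) := by
  refine PolyTime.comp' (f := fun l : List β => l.headD d) ⟨.head, .X, fun l => ?_⟩ hf
  cases l with
  | nil => exact ⟨_, by change Prog.Runs _ .nil (toData d) _; rw [hd]; exact .head_nil, by simp⟩
  | cons b l => exact ⟨_, .head_cons _ _, by simp [encSize, toData, encodeDataList]⟩

@[fun_prop] theorem isEmpty {f : α → List β} (hf : PolyTime f) :
    PolyTime (fun a => (f a).isEmpty) := by
  refine PolyTime.comp' (f := fun l : List β => l.isEmpty)
    ⟨.ite .id .nil (.pair .nil .nil), 5 * .X + 5, fun l => ?_⟩ hf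
  cases l with
  | nil =>
    exact ⟨_, .ite_nil (.id _) (.pair (.nil _) (.nil _)), by simp [toData, Data.size, encodeDataList]⟩
  | cons b l =>
    refine ⟨_, .ite_cons (.id _) (.nil _), ?_⟩
    simp [encSize, toData, encodeDataList]; omega

/-- Iteration over a list, where the size of the state stays polynomial. -/
theorem foldl_of_size_le {step : κ × σ × α → σ} (hstep : PolyTime step) (Q : Polynomial ℕ)
    (hQ : ∀ k s (l : List α), encSize (l.foldl (fun s a => step (k, s, a)) s) ≤
      Q.eval (encSize (k, s, l))) :
    PolyTime (fun x : κ × σ × List α => x.2.2.foldl (fun s a => step (x.1, s, a)) x.2.1) := by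
  obtain ⟨p, q, hp⟩ := hstep
  -- The loop state is `(k, s, l)` with `l` the part of the list still to be read; one round
  -- replaces it by `(k, step (k, s, head), tail)`. The loop test is `l` itself, which is `nil`
  -- exactly when it is empty.
  set body : Prog := .pair .head (.pair
    (.comp p (.pair .head (.pair (.comp .head .tail) (.comp .head (.comp .tail .tail)))))
    (.comp .tail (.comp .tail .tail))) with hbody
  -- `N` bounds every state of the loop: `l₁` is the part already read and `l₂` the rest. The
  -- constants 30 leave room for the copying in each round.
  have key : ∀ (k : κ) (N : ℕ) (l : List α) (s : σ),
      (∀ l₁ l₂, l₁ ++ l₂ = l →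
        encSize (k, l₁.foldl (fun s a => step (k, s, a)) s, l₂) ≤ N) →
      ∃ t, Prog.Runs (.loop (.comp .tail .tail) body) (toData (k, s, l))
        (toData (k, l.foldl (fun s a => step (k, s, a)) s, ([] : List α))) t ∧
        t ≤ (l.length + 1) * (q.eval N + 30 * N + 30) := by
    intro k N l
    induction l with
    | nil =>
      intro s h
      have h0 := h [] [] rfl
      refine ⟨_, .loop_nil (.comp (.tail_cons _ _) (.tail_cons _ _)), ?_⟩
      simp only [List.foldl_nil, encSize_pair] at h0
      simp only [encSize] at h0
      simp only [Data.size, List.length_nil, zero_add, one_mul]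
      simp only [toData, List.map_nil, encodeDataList, Data.size] at h0 ⊢
      omega
    | cons a l ih =>
      intro s h
      have h0 := h [] (a :: l) rfl
      obtain ⟨t₁, r₁, b₁⟩ := hp (k, s, a)
      obtain ⟨t₂, r₂, b₂⟩ := ih (step (k, s, a)) (fun l₁ l₂ e => h (a :: l₁) l₂ (by simp [← e]))
      have hb : ∃ t, Prog.Runs body (toData (k, s, a :: l)) (toData (k, step (k, s, a), l)) t ∧
          t ≤ t₁ + 20 * (toData (k, s, a :: l)).size := by
        refine ⟨_, .pair (.head_cons _ _) (.pair (.comp (.pair (.head_cons _ _)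
          (.pair (.comp (.tail_cons _ _) (.head_cons _ _))
            (.comp (.comp (.tail_cons _ _) (.tail_cons _ _)) (.head_cons _ _)))) r₁)
          (.comp (.comp (.tail_cons _ _) (.tail_cons _ _)) (.tail_cons _ _))), ?_⟩
        simp only [toData, List.map_cons, encodeDataList, Data.size]
        omega
      obtain ⟨t₃, r₃, b₃⟩ := hb
      refine ⟨_, .loop_cons (.comp (.tail_cons _ _) (.tail_cons _ _)) r₃ r₂, ?_⟩
      have h1 : q.eval (encSize (k, s, a)) ≤ q.eval N := by
        refine natPoly_mono _ (le_trans ?_ h0)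
        simp only [List.foldl_nil, encSize_pair, encSize_cons]
        omega
      have h2 : (toData (k, s, a :: l)).size ≤ N := h0
      have h3 : (toData (s, a :: l)).size ≤ (toData (k, s, a :: l)).size := by
        simp only [toData, Data.size]; omega
      have h4 : (Data.cons (toData s) (encodeDataList ((a :: l).map toData))).size =
        (toData (s, a :: l)).size := rfl
      have h5 : (Data.cons (toData k) (toData (s, a :: l))).size =
        (toData (k, s, a :: l)).size := rfl
      simp only [List.length_cons]
      rw [add_mul _ 1, one_mul]
      have h6 : (Data.cons (toData (k, s, a :: l).1) (toData (k, s, a :: l).2)).size =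
        (toData (k, s, a :: l)).size := rfl
      have h7 : (Data.cons (toData (k, s, a :: l).2.1) (toData (k, s, a :: l).2.2)).size =
        (toData (s, a :: l)).size := rfl
      have h8 : (Data.cons (toData s) (toData (a :: l))).size = (toData (s, a :: l)).size := rfl
      omega
  refine ⟨.comp (.comp .head .tail) (.loop (.comp .tail .tail) body),
    (.X + 1) * (q.comp (Q + 3 * .X) + 30 * (Q + 3 * .X) + 30) +
      3 * (Q + 3 * .X) + 10, fun ⟨k, s, l⟩ => ?_⟩
  have hN : ∀ l₁ l₂, l₁ ++ l₂ = l →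
      encSize (k, l₁.foldl (fun s a => step (k, s, a)) s, l₂) ≤
        (Q + 3 * .X).eval (encSize (k, s, l)) := by
    intro l₁ l₂ e
    have h1 := hQ k s l₁
    have h2 := encSize_append l₁ l₂
    have h3 : Q.eval (encSize (k, s, l₁)) ≤ Q.eval (encSize (k, s, l)) := by
      refine natPoly_mono _ ?_
      rw [e] at h2
      have := encSize_pos l₂
      simp only [encSize_pair]; omega
    have := encSize_pos l₁
    rw [e] at h2
    simp only [encSize_pair, Polynomial.eval_add, Polynomial.eval_mul, Polynomial.eval_X,
      Polynomial.eval_ofNat] at h1 h3 ⊢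
    omega
  obtain ⟨t, r, b⟩ := key k _ l s hN
  have hsz : (toData (k, l.foldl (fun s a => step (k, s, a)) s, ([] : List α))).size ≤
    (Q + 3 * .X).eval (encSize (k, s, l)) := hN l [] (by simp)
  refine ⟨_, .comp r (.comp (.tail_cons _ _) (.head_cons _ _)), ?_⟩
  have h2 : l.length + 1 ≤ encSize (k, s, l) + 1 := by
    have := length_le_encSize l
    simp only [encSize_pair]; omega
  have h3 := b.trans (Nat.mul_le_mul_right _ h2)
  rw [show (toData (k, l.foldl (fun s a => step (k, s, a)) s, ([] : List α))).size =
    (toData k).size + (Data.cons (toData (l.foldl (fun s a => step (k, s, a)) s))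
      (toData ([] : List α))).size + 1 from rfl] at hsz
  simp only [Polynomial.eval_add, Polynomial.eval_mul, Polynomial.eval_X, Polynomial.eval_ofNat,
    Polynomial.eval_comp, Polynomial.eval_one] at h3 hsz ⊢
  have h4 : (toData (l.foldl (fun s a => step (k, s, a)) s, ([] : List α))).size =
    (Data.cons (toData (l.foldl (fun s a => step (k, s, a)) s)) (toData ([] : List α))).size := rfl
  simp only [Data.size] at hsz h4 ⊢
  omega

end PolyTime

/-! ### Closure under list operations and unary arithmetic -/

namespace PolyTime

variable {α β γ δ κ σ : Type} [DataEncoding α] [DataEncoding β] [DataEncoding γ] [DataEncoding δ]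
  [DataEncoding κ] [DataEncoding σ]

theorem foldl_of_size_le' {l : κ → List α} {s : κ → σ} {step : κ → σ → α → σ} (hl : PolyTime l)
    (hs : PolyTime s) (hstep : PolyTime (fun x : κ × σ × α => step x.1 x.2.1 x.2.2))
    (Q : Polynomial ℕ) (hQ : ∀ k s (l : List α), encSize (l.foldl (step k) s) ≤
      Q.eval (encSize k + encSize s + encSize l)) :
    PolyTime (fun k => (l k).foldl (step k) (s k)) := by
  have h := foldl_of_size_le hstep Q (fun k s l => (hQ k s l).trans
    (natPoly_mono _ (by simp only [encSize_pair]; omega)))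
  exact h.comp' (id'.prodMk (hs.prodMk hl))

/-- The bound on `step` does not involve the previous state, so sizes cannot compound over the
iteration. -/
theorem foldl_of_step_le {l : κ → List α} {s : κ → σ} {step : κ → σ → α → σ} (hl : PolyTime l)
    (hs : PolyTime s) (hstep : PolyTime (fun x : κ × σ × α => step x.1 x.2.1 x.2.2))
    (Q : Polynomial ℕ) (hQ : ∀ k s a, encSize (step k s a) ≤ Q.eval (encSize k)) :
    PolyTime (fun k => (l k).foldl (step k) (s k)) := by
  refine foldl_of_size_le' hl hs hstep (Q + .X) fun k s l => ?_
  have h1 : encSize (l.foldl (step k) s) ≤ Q.eval (encSize k) + encSize s := by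
    induction l generalizing s with
    | nil => simp
    | cons a l ih =>
      clear ih
      rw [List.foldl_cons]
      have h0 := hQ k s a
      suffices ∀ (l : List α) t, encSize t ≤ Q.eval (encSize k) →
          encSize (l.foldl (step k) t) ≤ Q.eval (encSize k) by
        have := this l _ h0; omega
      intro l
      induction l with
      | nil => intro t ht; simpa
      | cons b l ih => intro t _; exact ih _ (hQ k t b)
  have h2 : Q.eval (encSize k) ≤ Q.eval (encSize k + encSize s + encSize l) :=
    natPoly_mono _ (by omega)
  simp only [Polynomial.eval_add, Polynomial.eval_X]
  omega

@[fun_prop] theorem any {l : κ → List α} {p : κ → α → Bool} (hl : PolyTime l)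
    (hp : PolyTime (fun x : κ × α => p x.1 x.2)) : PolyTime (fun k => (l k).any (p k)) := by
  have : (fun k => (l k).any (p k)) = fun k => (l k).foldl (fun b a => b || p k a) false := by
    funext k
    suffices ∀ (l : List α) b, l.foldl (fun b a => b || p k a) b = (b || l.any (p k)) by
      rw [this]; simp
    intro l
    induction l with
    | nil => simp
    | cons a l ih => intro b; simp [ih, Bool.or_assoc]
  rw [this]
  refine foldl_of_step_le hl (const _) ?_ 3 fun _ _ _ => by simpa using encSize_bool _
  exact (fst' (snd' id')).or (hp.comp' ((fst' id').prodMk (snd' (snd' id'))))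

@[fun_prop] theorem all {l : κ → List α} {p : κ → α → Bool} (hl : PolyTime l)
    (hp : PolyTime (fun x : κ × α => p x.1 x.2)) : PolyTime (fun k => (l k).all (p k)) := by
  have : (fun k => (l k).all (p k)) = fun k => !(l k).any (fun a => !p k a) := by
    funext k
    simp [List.not_any_eq_all_not]
  rw [this]
  exact not (any hl (not hp))

@[fun_prop] theorem reverse {f : α → List β} (hf : PolyTime f) :
    PolyTime (fun a => (f a).reverse) := by
  have : (fun a => (f a).reverse) = fun a => (f a).foldl (fun s b => b :: s) [] := by
    funext a; simp
  rw [this]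
  refine foldl_of_size_le' hf (const _) (by fun_prop) .X fun k s l => ?_
  have h := encSize_append l.reverse s
  have h2 : ∀ l : List β, encSize l.reverse = encSize l := by
    intro l
    induction l with
    | nil => rfl
    | cons a l ih =>
      have := encSize_append l.reverse [a]
      simp only [List.reverse_cons, encSize_cons, encSize_nil] at this ⊢
      omega
  have h3 : l.foldl (fun s b => b :: s) s = l.reverse ++ s := by simp
  rw [h3, Polynomial.eval_X]
  rw [h2] at h
  omega

@[fun_prop] theorem map {l : κ → List α} {f : κ → α → β} (hl : PolyTime l)
    (hf : PolyTime (fun x : κ × α => f x.1 x.2)) : PolyTime (fun k => (l k).map (f k)) := by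
  have : (fun k => (l k).map (f k)) =
      fun k => ((l k).foldl (fun s a => f k a :: s) []).reverse := by
    funext k
    suffices ∀ (l : List α) s, l.foldl (fun s a => f k a :: s) s = (l.map (f k)).reverse ++ s by
      simp [this]
    intro l
    induction l with
    | nil => simp
    | cons a l ih => intro s; simp [ih]
  rw [this]
  obtain ⟨q, hq⟩ := hf.encSize_le
  refine reverse (foldl_of_size_le' hl (const _)
    (listCons (hf.comp' ((fst' id').prodMk (snd' (snd' id')))) (fst' (snd' id')))
    (.X + .X * (q.comp (.X + 1) + 1)) fun k s l => ?_)
  have h0 : ∀ N, ∀ (l : List α) s, encSize k + encSize l ≤ N →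
      encSize (l.foldl (fun s a => f k a :: s) s) ≤
      encSize s + l.length * (q.eval (N + 1) + 1) := by
    intro N l
    induction l with
    | nil => simp
    | cons a l ih =>
      intro s h
      simp only [encSize_cons] at h
      have h1 := ih (f k a :: s) (by omega)
      have h2 := hq (k, a)
      have h3 : q.eval (encSize (k, a)) ≤ q.eval (N + 1) :=
        natPoly_mono _ (by simp only [encSize_pair]; omega)
      simp only [List.foldl_cons, List.length_cons]
      simp only [encSize_cons] at h1
      rw [add_mul _ 1, one_mul]
      dsimp only at h2
      omega
  refine (h0 (encSize k + encSize s + encSize l) l s (by omega)).trans ?_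
  simp only [Polynomial.eval_add, Polynomial.eval_mul, Polynomial.eval_X, Polynomial.eval_one,
    Polynomial.eval_comp]
  have := length_le_encSize l
  gcongr <;> omega

@[fun_prop] theorem filter {l : κ → List α} {p : κ → α → Bool} (hl : PolyTime l)
    (hp : PolyTime (fun x : κ × α => p x.1 x.2)) : PolyTime (fun k => (l k).filter (p k)) := by
  have : (fun k => (l k).filter (p k)) =
      fun k => ((l k).foldl (fun s a => bif p k a then a :: s else s) []).reverse := by
    funext k
    suffices ∀ (l : List α) s, l.foldl (fun s a => bif p k a then a :: s else s) s =
        (l.filter (p k)).reverse ++ s by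
      simp [this]
    intro l
    induction l with
    | nil => simp
    | cons a l ih => intro s; cases h : p k a <;> simp [ih, h]
  rw [this]
  refine reverse (foldl_of_size_le' hl (const _)
    (cond (hp.comp' ((fst' id').prodMk (snd' (snd' id')))) (by fun_prop) (by fun_prop))
    .X fun k s l => ?_)
  have h0 : ∀ (l : List α) s, encSize (l.foldl (fun s a => bif p k a then a :: s else s) s) ≤
      encSize s + encSize l := by
    intro l
    induction l with
    | nil => simp
    | cons a l ih =>
      intro s
      refine (ih _).trans ?_
      change encSize (bif p k a then a :: s else s) + _ ≤ _
      cases p k a <;> simp only [cond_true, cond_false, encSize_cons] <;> omega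
  rw [Polynomial.eval_X]
  have := h0 l s
  omega

@[fun_prop] theorem append {f g : α → List β} (hf : PolyTime f) (hg : PolyTime g) :
    PolyTime (fun a => f a ++ g a) := by
  have : (fun a => f a ++ g a) = fun a => (f a).reverse.foldl (fun s b => b :: s) (g a) := by
    funext a; simp
  rw [this]
  refine foldl_of_size_le' (reverse hf) hg (by fun_prop) .X fun k s l => ?_
  have h0 : ∀ (l : List β) s, encSize (l.foldl (fun s b => b :: s) s) + 1 =
      encSize s + encSize l := by
    intro l
    induction l with
    | nil => simp
    | cons a l ih => intro s; simp only [List.foldl_cons, ih, encSize_cons]; omega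
  rw [Polynomial.eval_X]
  have := h0 l s
  omega

@[fun_prop] theorem flatMap {l : κ → List α} {f : κ → α → List β} (hl : PolyTime l)
    (hf : PolyTime (fun x : κ × α => f x.1 x.2)) :
    PolyTime (fun k => (l k).flatMap (f k)) := by
  have hj : PolyTime (fun L : List (List β) => L.foldl (fun s b => s ++ b) []) := by
    refine foldl_of_size_le' (κ := List (List β)) (step := fun _ s b => s ++ b) id' (const _)
      (by fun_prop) .X fun k s l => ?_
    have h0 : ∀ (l : List (List β)) s, encSize (l.foldl (fun s b => s ++ b) s) ≤
        encSize s + encSize l := by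
      intro l
      induction l with
      | nil => simp
      | cons a l ih =>
        intro s
        have h1 := ih (s ++ a)
        have h2 := encSize_append s a
        simp only [List.foldl_cons, encSize_cons]; omega
    rw [Polynomial.eval_X]
    have := h0 l s
    omega
  have : (fun k => (l k).flatMap (f k)) =
      fun k => ((l k).map (f k)).foldl (fun s b => s ++ b) [] := by
    funext k
    suffices ∀ (l : List α) s, (l.map (f k)).foldl (fun s b => s ++ b) s = s ++ l.flatMap (f k) by
      simp [this]
    intro l
    induction l with
    | nil => simp
    | cons a l ih => intro s; simp [ih]
  rw [this]
  exact hj.comp' (map hl hf)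

/-! Natural numbers in unary. -/

theorem replicate : PolyTime (fun n : ℕ => List.replicate n ()) := of_toData_eq fun _ => rfl

-- Once every entry is replaced by `()`, the list already is the unary representation of its length.
@[fun_prop] theorem length {f : α → List β} (hf : PolyTime f) :
    PolyTime (fun a => (f a).length) := by
  have h : PolyTime (fun l : List Unit => l.length) := of_toData_eq fun l => by
    change toData (List.replicate l.length ()) = _
    rw [← List.eq_replicate_iff.2 ⟨rfl, fun _ _ => rfl⟩]
  have := h.comp' (map hf (f := fun _ _ => ()) (by fun_prop))
  simpa using this

theorem iterate_of_size_le {n : κ → ℕ} {s : κ → σ} {step : κ → σ → σ} (hn : PolyTime n)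
    (hs : PolyTime s) (hstep : PolyTime (fun x : κ × σ => step x.1 x.2)) (Q : Polynomial ℕ)
    (hQ : ∀ k s n, encSize ((step k)^[n] s) ≤ Q.eval (encSize k + encSize s + n)) :
    PolyTime (fun k => (step k)^[n k] (s k)) := by
  have e : ∀ k (l : List Unit) s,
      l.foldl (fun s (_ : Unit) => step k s) s = (step k)^[l.length] s := by
    intro k l
    induction l with
    | nil => intro s; rfl
    | cons a l ih => intro s; rw [List.foldl_cons, ih]; rfl
  have : (fun k => (step k)^[n k] (s k)) =
      fun k => (List.replicate (n k) ()).foldl (fun s (_ : Unit) => step k s) (s k) := by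
    funext k
    rw [e, List.length_replicate]
  rw [this]
  refine foldl_of_size_le' (replicate.comp' hn) hs
    (hstep.comp' ((fst' id').prodMk (fst' (snd' id')))) Q fun k s l => ?_
  rw [e]
  refine (hQ _ _ _).trans (natPoly_mono _ ?_)
  have := length_le_encSize l
  omega

theorem iterate_of_step_le {n : κ → ℕ} {s : κ → σ} {step : κ → σ → σ} (hn : PolyTime n)
    (hs : PolyTime s) (hstep : PolyTime (fun x : κ × σ => step x.1 x.2)) (Q : Polynomial ℕ)
    (hQ : ∀ k s, encSize (step k s) ≤ Q.eval (encSize k)) :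
    PolyTime (fun k => (step k)^[n k] (s k)) := by
  refine iterate_of_size_le hn hs hstep (Q + .X) fun k s n => ?_
  simp only [Polynomial.eval_add, Polynomial.eval_X]
  cases n with
  | zero => simp only [Function.iterate_zero, id_eq]; omega
  | succ n =>
    rw [Function.iterate_succ_apply']
    refine (hQ _ _).trans ((natPoly_mono Q ?_).trans (Nat.le_add_right _ _))
    omega

@[fun_prop] theorem natSucc {f : α → ℕ} (hf : PolyTime f) : PolyTime (fun a => f a + 1) :=
  PolyTime.comp' (f := fun n : ℕ => n + 1) (by
    have h : PolyTime (fun n : ℕ => (() :: List.replicate n () : List Unit)) :=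
      listCons (const _) replicate
    have h2 := length h
    simpa using h2) hf

theorem natPred {f : α → ℕ} (hf : PolyTime f) : PolyTime (fun a => f a - 1) := by
  have := length (listTail (replicate.comp' hf))
  simpa using this

@[fun_prop] theorem natAdd {f g : α → ℕ} (hf : PolyTime f) (hg : PolyTime g) :
    PolyTime (fun a => f a + g a) := by
  have := length (append (replicate.comp' hf) (replicate.comp' hg))
  simpa using this

@[fun_prop] theorem natSub {f g : α → ℕ} (hf : PolyTime f) (hg : PolyTime g) :
    PolyTime (fun a => f a - g a) := by
  have : (fun a => f a - g a) = fun a => (fun n => n - 1)^[g a] (f a) := by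
    funext a
    induction g a with
    | zero => rfl
    | succ n ih => rw [Function.iterate_succ_apply', ← ih]; omega
  rw [this]
  refine iterate_of_size_le hg hf (natPred (snd' id')) .X fun k s n => ?_
  have : (fun n => n - 1)^[n] s ≤ s := by
    induction n with
    | zero => rfl
    | succ n ih => rw [Function.iterate_succ_apply']; omega
  simp only [Polynomial.eval_X, encSize_nat]
  omega

@[fun_prop] theorem natMul {f g : α → ℕ} (hf : PolyTime f) (hg : PolyTime g) :
    PolyTime (fun a => f a * g a) := by
  have := length (flatMap (replicate.comp' hf)
    (f := fun a _ => List.replicate (g a) ()) ((replicate.comp' hg).comp' (fst' id')))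
  simpa using this

@[fun_prop] theorem natLe {f g : α → ℕ} (hf : PolyTime f) (hg : PolyTime g) :
    PolyTime (fun a => decide (f a ≤ g a)) := by
  have := isEmpty (replicate.comp' (natSub hf hg))
  refine (iff_of_eq ?_).1 this
  congr 1
  funext a
  rw [Bool.eq_iff_iff]
  simp [Nat.sub_eq_zero_iff_le]

@[fun_prop] theorem natEq {f g : α → ℕ} (hf : PolyTime f) (hg : PolyTime g) :
    PolyTime (fun a => decide (f a = g a)) := by
  have := (natLe hf hg).and (natLe hg hf)
  refine (iff_of_eq ?_).1 this
  congr 1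
  funext a
  rw [Bool.eq_iff_iff]
  simp [le_antisymm_iff]

@[fun_prop] theorem natMax {f g : α → ℕ} (hf : PolyTime f) (hg : PolyTime g) :
    PolyTime (fun a => max (f a) (g a)) := by
  have : (fun a => max (f a) (g a)) = fun a => f a + (g a - f a) := by
    funext a; omega
  rw [this]; fun_prop

@[fun_prop] theorem foldlMax {f : α → List ℕ} (hf : PolyTime f) :
    PolyTime (fun a => (f a).foldl max 0) := by
  refine foldl_of_size_le' hf (const _) (by fun_prop) .X fun k s l => ?_
  have h0 : ∀ (l : List ℕ) s, encSize (l.foldl max s) ≤ encSize s + encSize l := by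
    intro l
    induction l with
    | nil => simp
    | cons a l ih =>
      intro s
      refine (ih _).trans ?_
      simp only [encSize_cons, encSize_nat]
      omega
  rw [Polynomial.eval_X]
  have := h0 l s
  omega

-- The next entry is the length of the list built so far, so no counter is needed.
@[fun_prop] theorem range {f : α → ℕ} (hf : PolyTime f) :
    PolyTime (fun a => List.range (f a)) := by
  have e : ∀ n, (fun s : List ℕ => s ++ [s.length])^[n] [] = List.range n := by
    intro n
    induction n with
    | zero => rfl
    | succ n ih => rw [Function.iterate_succ_apply', ih, List.range_succ, List.length_range]
  have : (fun a => List.range (f a)) =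
      fun a => (fun s : List ℕ => s ++ [s.length])^[f a] [] := by
    funext a; rw [e]
  rw [this]
  refine iterate_of_size_le hf (const _) (by fun_prop) (.X + .X * (4 * .X + 4)) fun k s n => ?_
  have h0 : ∀ n, encSize ((fun s : List ℕ => s ++ [s.length])^[n] s) ≤
      encSize s + n * (2 * (s.length + n) + 2) ∧
      ((fun s : List ℕ => s ++ [s.length])^[n] s).length = s.length + n := by
    intro n
    induction n with
    | zero => simp
    | succ n ih =>
      rw [Function.iterate_succ_apply']
      set L := (fun s : List ℕ => s ++ [s.length])^[n] s
      refine ⟨?_, by simp [ih.2]; omega⟩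
      have := encSize_append L [L.length]
      simp only [encSize_cons, encSize_nil, encSize_nat, ih.2] at this
      have h1 := ih.1
      rw [ih.2]
      nlinarith
  refine (h0 n).1.trans ?_
  have := length_le_encSize s
  simp only [Polynomial.eval_add, Polynomial.eval_mul, Polynomial.eval_X, Polynomial.eval_ofNat]
  gcongr <;> omega

theorem getD (d : β) (hd : toData d = .nil) {f : α → List β} {i : α → ℕ} (hf : PolyTime f)
    (hi : PolyTime i) : PolyTime (fun a => (f a).getD (i a) d) := by
  have : (fun a => (f a).getD (i a) d) = fun a => (List.tail^[i a] (f a)).headD d := by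
    funext a
    induction i a generalizing f with
    | zero => cases f a <;> rfl
    | succ n ih =>
      rw [Function.iterate_succ_apply, ← ih (f := fun a => (f a).tail) (listTail hf)]
      cases f a <;> simp
  rw [this]
  refine listHeadD d hd (iterate_of_size_le hi hf (by fun_prop) .X fun k s n => ?_)
  have h : encSize (List.tail^[n] s) ≤ encSize s := by
    induction n with
    | zero => rfl
    | succ n ih =>
      rw [Function.iterate_succ_apply']
      refine le_trans ?_ ih
      cases List.tail^[n] s <;> simp
      omega
  rw [Polynomial.eval_X]
  omega

@[fun_prop] theorem getD_false {f : α → List Bool} {i : α → ℕ} (hf : PolyTime f)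
    (hi : PolyTime i) : PolyTime (fun a => (f a).getD (i a) false) := getD _ rfl hf hi

@[fun_prop] theorem getD_nil {f : α → List (List β)} {i : α → ℕ} (hf : PolyTime f)
    (hi : PolyTime i) : PolyTime (fun a => (f a).getD (i a) []) := getD _ rfl hf hi

end PolyTime

/-! ### Tables -/

/-- The list of the values of `f` at `0, …, n - 1`. -/
def tabulate {β : Type} (n : ℕ) (f : ℕ → β) : List β := (List.range n).map f

/-- The matrix with `n` rows and columns and entries `f i j`. -/
def tabulateMatrix (n : ℕ) (f : ℕ → ℕ → Bool) : List (List Bool) :=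
  tabulate n fun i => tabulate n (f i)

/-- The entries of a matrix, `false` outside the matrix. -/
def matrixEntry (M : List (List Bool)) (i j : ℕ) : Bool := (M.getD i []).getD j false

theorem tabulate_getD {β : Type} (n : ℕ) (f : ℕ → β) (d : β) (i : ℕ) (hi : i < n) :
    (tabulate n f).getD i d = f i := by
  simp [tabulate, List.getD, hi]

theorem matrixEntry_tabulateMatrix (n : ℕ) (f : ℕ → ℕ → Bool) (i j : ℕ) (hi : i < n) (hj : j < n) :
    matrixEntry (tabulateMatrix n f) i j = f i j := by
  rw [matrixEntry, tabulateMatrix, tabulate_getD _ _ _ _ hi, tabulate_getD _ _ _ _ hj]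

theorem encSize_tabulate_bool (n : ℕ) (f : ℕ → Bool) : encSize (tabulate n f) ≤ n * 4 + 1 := by
  have := encSize_list_le (tabulate n f) 3 fun _ _ => encSize_bool _
  simpa [tabulate] using this

theorem encSize_tabulateMatrix (n : ℕ) (f : ℕ → ℕ → Bool) :
    encSize (tabulateMatrix n f) ≤ n * (n * 4 + 2) + 1 := by
  have := encSize_list_le (tabulateMatrix n f) (n * 4 + 1) fun r hr => by
    obtain ⟨i, -, rfl⟩ := List.mem_map.1 hr
    exact encSize_tabulate_bool _ _
  simpa [tabulateMatrix, tabulate] using this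

/-- The maximum of `f` over the elements of `l` that satisfy `p`. -/
def maxOver (l : List ℕ) (p : ℕ → Bool) (f : ℕ → ℕ) : ℕ := ((l.filter p).map f).foldl max 0

theorem le_foldl_max (l : List ℕ) (s : ℕ) :
    s ≤ l.foldl max s ∧ (∀ a ∈ l, a ≤ l.foldl max s) ∧
      (l.foldl max s = s ∨ l.foldl max s ∈ l) := by
  induction l generalizing s with
  | nil => simp
  | cons a l ih =>
    obtain ⟨h1, h2, h3⟩ := ih (max s a)
    simp only [List.foldl_cons, List.mem_cons, forall_eq_or_imp]
    refine ⟨by omega, ⟨by omega, h2⟩, ?_⟩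
    rcases h3 with h3 | h3
    · rcases max_choice s a with h | h <;> rw [h] at h3 ⊢ <;> simp [h3]
    · simp [h3]

theorem le_maxOver {l : List ℕ} {p : ℕ → Bool} {f : ℕ → ℕ} {u : ℕ} (hu : u ∈ l) (hp : p u = true) :
    f u ≤ maxOver l p f :=
  (le_foldl_max _ 0).2.1 _ (List.mem_map.2 ⟨u, List.mem_filter.2 ⟨hu, hp⟩, rfl⟩)

theorem maxOver_eq_zero_or (l : List ℕ) (p : ℕ → Bool) (f : ℕ → ℕ) :
    maxOver l p f = 0 ∨ ∃ u ∈ l, p u = true ∧ maxOver l p f = f u := by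
  refine (le_foldl_max ((l.filter p).map f) 0).2.2.imp_right fun h => ?_
  obtain ⟨u, hu, e⟩ := List.mem_map.1 h
  obtain ⟨h1, h2⟩ := List.mem_filter.1 hu
  exact ⟨u, h1, h2, e.symm⟩

/-- The first element of `l`, or `d`. -/
def firstOr (l : List ℕ) (d : ℕ) : ℕ := bif l.isEmpty then d else l.headD 0

theorem firstOr_eq (l : List ℕ) (d : ℕ) : (l = [] ∧ firstOr l d = d) ∨ firstOr l d ∈ l := by
  cases l <;> simp [firstOr]

/-! ### Tables and maxima in polynomial time -/

namespace PolyTime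

variable {α β κ : Type} [DataEncoding α] [DataEncoding β] [DataEncoding κ]

@[fun_prop] theorem tabulate {n : κ → ℕ} {f : κ → ℕ → β} (hn : PolyTime n)
    (hf : PolyTime (fun x : κ × ℕ => f x.1 x.2)) : PolyTime (fun k => tabulate (n k) (f k)) := by
  unfold _root_.tabulate; fun_prop

@[fun_prop] theorem tabulateMatrix {n : κ → ℕ} {f : κ → ℕ → ℕ → Bool} (hn : PolyTime n)
    (hf : PolyTime (fun x : (κ × ℕ) × ℕ => f x.1.1 x.1.2 x.2)) :
    PolyTime (fun k => tabulateMatrix (n k) (f k)) := by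
  exact tabulate hn (tabulate (hn.comp' (fst' id')) hf)

@[fun_prop] theorem matrixEntry {M : κ → List (List Bool)} {i j : κ → ℕ} (hM : PolyTime M)
    (hi : PolyTime i) (hj : PolyTime j) : PolyTime (fun k => matrixEntry (M k) (i k) (j k)) := by
  unfold _root_.matrixEntry; fun_prop

@[fun_prop] theorem maxOver {l : κ → List ℕ} {p : κ → ℕ → Bool} {f : κ → ℕ → ℕ} (hl : PolyTime l)
    (hp : PolyTime (fun x : κ × ℕ => p x.1 x.2)) (hf : PolyTime (fun x : κ × ℕ => f x.1 x.2)) :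
    PolyTime (fun k => maxOver (l k) (p k) (f k)) := by
  unfold _root_.maxOver; fun_prop

@[fun_prop] theorem firstOr {l : κ → List ℕ} {d : κ → ℕ} (hl : PolyTime l) (hd : PolyTime d) :
    PolyTime (fun k => firstOr (l k) (d k)) := by
  have : PolyTime (fun k => (l k).headD 0) := listHeadD 0 rfl hl
  unfold _root_.firstOr; fun_prop

/-- Every step returns a table of `n k` bits whatever the previous state was, so the states stay
small however often the step is repeated. -/
theorem iterate_tabulate {n N : κ → ℕ} {s : κ → List Bool} {p : κ → List Bool → ℕ → Bool}
    (hn : PolyTime n) (hN : PolyTime N) (hs : PolyTime s)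
    (hp : PolyTime (fun x : (κ × List Bool) × ℕ => p x.1.1 x.1.2 x.2)) :
    PolyTime (fun k => (fun Y => _root_.tabulate (n k) (p k Y))^[N k] (s k)) := by
  obtain ⟨q, hq⟩ := hn.encSize_le
  refine iterate_of_step_le hN hs (tabulate (hn.comp' (fst' id')) hp) (q * 4 + 1) fun k s => ?_
  refine (encSize_tabulate_bool _ _).trans ?_
  have := hq k
  simp only [Polynomial.eval_add, Polynomial.eval_mul, Polynomial.eval_one, Polynomial.eval_ofNat,
    encSize_nat] at this ⊢
  omega

theorem matrix_bound {n : κ → ℕ} (hn : PolyTime n) :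
    ∃ Q : Polynomial ℕ, ∀ k f, encSize (_root_.tabulateMatrix (n k) f) ≤ Q.eval (encSize k) := by
  obtain ⟨q, hq⟩ := hn.encSize_le
  refine ⟨q * (q * 4 + 2) + 1, fun k f => (encSize_tabulateMatrix _ _).trans ?_⟩
  have := hq k
  simp only [Polynomial.eval_add, Polynomial.eval_mul, Polynomial.eval_one, Polynomial.eval_ofNat,
    encSize_nat] at this ⊢
  gcongr <;> omega

theorem iterate_tabulateMatrix {n N : κ → ℕ} {s : κ → List (List Bool)}
    {p : κ → List (List Bool) → ℕ → ℕ → Bool}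
    (hn : PolyTime n) (hN : PolyTime N) (hs : PolyTime s)
    (hp : PolyTime (fun x : ((κ × List (List Bool)) × ℕ) × ℕ => p x.1.1.1 x.1.1.2 x.1.2 x.2)) :
    PolyTime (fun k => (fun Y => _root_.tabulateMatrix (n k) (p k Y))^[N k] (s k)) := by
  obtain ⟨Q, hQ⟩ := matrix_bound hn
  exact iterate_of_step_le hN hs (tabulateMatrix (hn.comp' (fst' id')) hp) Q fun k s => hQ _ _

theorem foldl_tabulateMatrix {n : κ → ℕ} {l : κ → List α} {s : κ → List (List Bool)}
    {p : κ → List (List Bool) → α → ℕ → ℕ → Bool}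
    (hn : PolyTime n) (hl : PolyTime l) (hs : PolyTime s)
    (hp : PolyTime (fun x : ((κ × List (List Bool) × α) × ℕ) × ℕ =>
      p x.1.1.1 x.1.1.2.1 x.1.1.2.2 x.1.2 x.2)) :
    PolyTime (fun k => (l k).foldl (fun Y a => _root_.tabulateMatrix (n k) (p k Y a)) (s k)) := by
  obtain ⟨Q, hQ⟩ := matrix_bound hn
  exact foldl_of_step_le hl hs (tabulateMatrix (hn.comp' (fst' id')) hp) Q fun k s a => hQ _ _

end PolyTime

/-! ### Binary numbers -/

/-- The successor of a number in binary, least significant bit first. -/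
def binarySucc : List Bool → List Bool
  | [] => [true]
  | false :: l => true :: l
  | true :: l => false :: binarySucc l

theorem bits_succ (n : ℕ) : (n + 1).bits = binarySucc n.bits := by
  induction n using Nat.strong_induction_on with
  | _ n ih =>
    rcases Nat.even_or_odd' n with ⟨k, rfl | rfl⟩
    · rcases Nat.eq_zero_or_pos k with rfl | hk
      · simp [binarySucc, Nat.one_bits]
      · rw [Nat.bit1_bits, Nat.bit0_bits _ hk.ne']; rfl
    · rw [Nat.bit1_bits, show 2 * k + 1 + 1 = 2 * (k + 1) by ring, Nat.bit0_bits _ (by omega),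
        ih k (by omega)]
      rfl

/-- The state holds the carry and the bits already written, in reverse; a carry that survives to the
end becomes a new leading bit. -/
theorem foldl_binarySucc (l acc : List Bool) (c : Bool) :
    (fun r : Bool × List Bool => (bif r.1 then true :: r.2 else r.2).reverse)
      (l.foldl (fun s b => (s.1 && b, (bif s.1 then !b else b) :: s.2)) (c, acc)) =
      acc.reverse ++ bif c then binarySucc l else l := by
  induction l generalizing acc c with
  | nil => cases c <;> simp [binarySucc]
  | cons a l ih =>
    rw [List.foldl_cons, ih]
    cases c <;> cases a <;> simp [binarySucc]

theorem PolyTime.binarySucc : PolyTime binarySucc := by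
  have e : _root_.binarySucc = fun l =>
      (fun r : Bool × List Bool => (bif r.1 then true :: r.2 else r.2).reverse)
      (l.foldl (fun s b => (s.1 && b, (bif s.1 then !b else b) :: s.2)) (true, [])) := by
    funext l; rw [foldl_binarySucc]; simp
  rw [e]
  have h0 : PolyTime (fun l : List Bool =>
      l.foldl (fun (s : Bool × List Bool) b => (s.1 && b, (bif s.1 then !b else b) :: s.2))
        (true, [])) := by
    refine foldl_of_size_le' (κ := List Bool)
      (step := fun _ s b => (s.1 && b, (bif s.1 then !b else b) :: s.2)) id' (const _)
      (by fun_prop) (4 * .X + 4) fun k s l => ?_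
    have h : ∀ (l : List Bool) s, encSize (l.foldl (fun (s : Bool × List Bool) b =>
        (s.1 && b, (bif s.1 then !b else b) :: s.2)) s) ≤ 4 + encSize s.2 + l.length * 4 := by
      intro l
      induction l with
      | nil => intro s; have := encSize_bool s.1; rw [List.foldl_nil, encSize_pair]; omega
      | cons a l ih =>
        intro s
        refine (ih _).trans ?_
        have := encSize_bool (bif s.1 then !a else a)
        simp only [encSize_cons, List.length_cons]; omega
    refine (h l s).trans ?_
    have := length_le_encSize l
    have : encSize s.2 ≤ encSize s := by rw [encSize_pair]; omega
    simp only [Polynomial.eval_add, Polynomial.eval_mul, Polynomial.eval_X, Polynomial.eval_ofNat]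
    omega
  fun_prop

-- Conversion from unary by counting up in binary: the number of steps is linear in the size of the
-- unary input, and each step adds at most one bit.
@[fun_prop] theorem PolyTime.bits {α : Type} [DataEncoding α] {f : α → ℕ} (hf : PolyTime f) :
    PolyTime (fun a => (f a).bits) := by
  have e : ∀ n, _root_.binarySucc^[n] [] = n.bits := by
    intro n
    induction n with
    | zero => simp
    | succ n ih => rw [Function.iterate_succ_apply', ih, bits_succ]
  simp only [← e]
  refine iterate_of_size_le hf (const _) (binarySucc.comp' (snd' id')) (.X * 4 + 1)
    fun k s n => ?_
  have h1 : ∀ l : List Bool, (_root_.binarySucc l).length ≤ l.length + 1 := by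
    intro l
    induction l with
    | nil => simp [_root_.binarySucc]
    | cons a l ih => cases a <;> simp [_root_.binarySucc, ih]
  have h2 : (_root_.binarySucc^[n] s).length ≤ s.length + n := by
    induction n with
    | zero => simp
    | succ n ih => rw [Function.iterate_succ_apply']; have := h1 (_root_.binarySucc^[n] s); omega
  refine (encSize_list_le _ 3 fun _ _ => encSize_bool _).trans ?_
  have := length_le_encSize s
  simp only [Polynomial.eval_add, Polynomial.eval_mul, Polynomial.eval_X, Polynomial.eval_ofNat,
    Polynomial.eval_one]
  omega

/-! ### The algorithm -/

/-- The input of the algorithm: an adjacency matrix, the characteristic vector of a clique and the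
characteristic vectors of the blocks. -/
abbrev RawInput : Type := List (List Bool) × List Bool × List (List Bool)

namespace RawInput

variable (I : RawInput)

def order : ℕ := I.1.length
def blockCount : ℕ := I.2.2.length
def vertices : List ℕ := List.range I.order
def adj (u v : ℕ) : Bool := matrixEntry I.1 u v
def inClique (u : ℕ) : Bool := I.2.1.getD u false
def inBlock (k u : ℕ) : Bool := matrixEntry I.2.2 k u

/-- The neighborhood of `x` is minimal for `Y` in block `k`. -/
def minimalInBlock (Y : List Bool) (k x : ℕ) : Bool :=
  I.vertices.all fun v => !(I.inBlock k v && I.adj x v) ||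
    I.vertices.all fun y => !Y.getD y false || I.adj y v

/-- "Minimal in all blocks but at most one", expressed through pairs of blocks so that nothing has
to be counted. -/
def removable (Y : List Bool) (x : ℕ) : Bool :=
  (List.range I.blockCount).all fun k => (List.range I.blockCount).all fun k' =>
    I.minimalInBlock Y k x || I.minimalInBlock Y k' x || decide (k = k')

/-- One round of the elimination: all removable vertices of `Y` are removed. -/
def eliminationRound (Y : List Bool) : List Bool :=
  tabulate I.order fun x => Y.getD x false && !I.removable Y x

/-- The vertices of the clique that are left after `s` rounds. -/
def remainingClique (s : ℕ) : List Bool :=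
  I.eliminationRound^[s] (tabulate I.order I.inClique)

/-- The number of rounds before which `x` is still present. -/
def height (x : ℕ) : ℕ :=
  ((List.range (I.order + 1)).filter fun s => (I.remainingClique s).getD x false).length

/-- The height of the last vertex of the clique that is not adjacent to `v`. -/
def lastNonneighbor (v : ℕ) : ℕ :=
  maxOver I.vertices (fun x => I.inClique x && !I.adj x v) I.height

/-- Distinct non-adjacent vertices in the union of the clique and a block, not both in the
clique. -/
def conflict (u v : ℕ) : Bool :=
  !decide (u = v) && !I.adj u v && (I.inClique u || I.inClique v ||
    (List.range I.blockCount).any fun k => I.inBlock k u && I.inBlock k v)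

/-- The conflicts that are not oriented by `T`. -/
def unoriented (T : List (List Bool)) (u v : ℕ) : Bool :=
  I.conflict u v && !matrixEntry T u v && !matrixEntry T v u

/-- Since no vertex conflicts with itself, the choice `c = b` keeps the unoriented pairs already in
`D`; a round therefore only adds pairs. -/
def forcingRound (T D : List (List Bool)) : List (List Bool) :=
  tabulateMatrix I.order fun a b => I.unoriented T a b &&
    ((I.vertices.any fun c => matrixEntry D a c && !I.unoriented T c b) ||
      (I.vertices.any fun c => matrixEntry D c b && !I.unoriented T a c))

/-- The implication class of `(u, v)` in the conflicts that are not oriented by `T`. -/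
def forcedBy (T : List (List Bool)) (u v : ℕ) : List (List Bool) :=
  (I.forcingRound T)^[I.order * I.order]
    (tabulateMatrix I.order fun a b => decide (a = u) && decide (b = v))

def orientStep (T : List (List Bool)) (e : ℕ × ℕ) : List (List Bool) :=
  tabulateMatrix I.order fun a b => matrixEntry T a b ||
    (I.unoriented T e.1 e.2 && matrixEntry (I.forcedBy T e.1 e.2) a b)

def pairs : List (ℕ × ℕ) := I.vertices.flatMap fun u => I.vertices.map fun v => (u, v)

/-- A transitive orientation of the conflicts. -/
def orientation : List (List Bool) :=
  -- Pairs that leave the clique are oriented first, so that every conflict at the clique is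
  -- directed outwards. The empty matrix has all entries `false`.
  (I.pairs.filter (fun e => I.inClique e.1) ++ I.pairs).foldl I.orientStep []

/-- A number in base `order + 1`: the leading digit is the height of the last non-neighbor, and the
number of predecessors is the lower digit because it is at most `order`. -/
def leftEnd (v : ℕ) : ℕ :=
  (I.order + 1) * I.lastNonneighbor v +
    (I.vertices.filter fun u => matrixEntry I.orientation u v).length

/-- The leg of a vertex of a block is its block, the leg of a vertex `x` of the clique is the block
in which its neighborhood is not determined by its height. -/
def legOf (v : ℕ) : ℕ :=
  firstOr ((List.range I.blockCount).filter fun k =>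
    bif I.inClique v then I.vertices.any fun u => I.inBlock k u && I.adj v u &&
      decide (I.height v ≤ I.lastNonneighbor u)
    else I.inBlock k v) I.blockCount

/-- The scale matches `leftEnd`: for `v` outside the clique of a good partition, `leftEnd v ≤ reach
x` holds exactly when `lastNonneighbor v < height x`. -/
def reach (v : ℕ) : ℕ := (I.order + 1) * I.height v

def rightEnd (v : ℕ) : ℕ :=
  max (bif I.inClique v then I.reach v else I.leftEnd v)
    (maxOver I.vertices (fun u => I.inBlock (I.legOf v) u && I.adj v u) I.leftEnd)

/-- An interval from `l` to `r`, stretched by 2, has the integral midpoint `l + r` and the integral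
radius `r - l`. A clique vertex has `l = -reach`. -/
def offsetOf (v : ℕ) : ℕ :=
  bif I.inClique v then I.rightEnd v - I.reach v else I.leftEnd v + I.rightEnd v

def radiusOf (v : ℕ) : ℕ :=
  bif I.inClique v then I.rightEnd v + I.reach v else I.rightEnd v - I.leftEnd v

/-- The summand 1 keeps the legs non-degenerate even if all offsets vanish. -/
def legLength : ℕ := maxOver I.vertices (fun _ => true) I.offsetOf + 1

def output : List (List Bool × List Bool) ×
    List (List Bool × (List Bool × List Bool) × (List Bool × List Bool)) :=
  ((List.range (I.blockCount + 1)).map fun _ => (I.legLength.bits, Nat.bits 1),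
    I.vertices.map fun v => ((I.legOf v).bits, ((I.offsetOf v).bits, Nat.bits 1),
      ((I.radiusOf v).bits, Nat.bits 1)))

end RawInput

/-! ### Running time of the algorithm -/

namespace PolyTime

variable {κ : Type} [DataEncoding κ] {I : κ → RawInput} {u v k s : κ → ℕ}
  {Y : κ → List Bool} {T D : κ → List (List Bool)} {e : κ → ℕ × ℕ}

@[fun_prop] theorem order (hI : PolyTime I) : PolyTime (fun a => (I a).order) := by
  unfold RawInput.order; fun_prop

@[fun_prop] theorem blockCount (hI : PolyTime I) : PolyTime (fun a => (I a).blockCount) := by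
  unfold RawInput.blockCount; fun_prop

@[fun_prop] theorem vertices (hI : PolyTime I) : PolyTime (fun a => (I a).vertices) := by
  unfold RawInput.vertices; fun_prop

@[fun_prop] theorem adj (hI : PolyTime I) (hu : PolyTime u) (hv : PolyTime v) :
    PolyTime (fun a => (I a).adj (u a) (v a)) := by
  unfold RawInput.adj; fun_prop

@[fun_prop] theorem inClique (hI : PolyTime I) (hu : PolyTime u) :
    PolyTime (fun a => (I a).inClique (u a)) := by
  unfold RawInput.inClique; fun_prop

@[fun_prop] theorem inBlock (hI : PolyTime I) (hk : PolyTime k) (hu : PolyTime u) :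
    PolyTime (fun a => (I a).inBlock (k a) (u a)) := by
  unfold RawInput.inBlock; fun_prop

@[fun_prop] theorem minimalInBlock (hI : PolyTime I) (hY : PolyTime Y) (hk : PolyTime k)
    (hu : PolyTime u) : PolyTime (fun a => (I a).minimalInBlock (Y a) (k a) (u a)) := by
  unfold RawInput.minimalInBlock; fun_prop

@[fun_prop] theorem removable (hI : PolyTime I) (hY : PolyTime Y) (hu : PolyTime u) :
    PolyTime (fun a => (I a).removable (Y a) (u a)) := by
  unfold RawInput.removable; fun_prop

@[fun_prop] theorem remainingClique (hI : PolyTime I) (hs : PolyTime s) :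
    PolyTime (fun a => (I a).remainingClique (s a)) := by
  unfold RawInput.remainingClique RawInput.eliminationRound
  exact iterate_tabulate (order hI) hs (by fun_prop) (by fun_prop)

@[fun_prop] theorem height (hI : PolyTime I) (hu : PolyTime u) :
    PolyTime (fun a => (I a).height (u a)) := by
  unfold RawInput.height; fun_prop

@[fun_prop] theorem lastNonneighbor (hI : PolyTime I) (hu : PolyTime u) :
    PolyTime (fun a => (I a).lastNonneighbor (u a)) := by
  unfold RawInput.lastNonneighbor; fun_prop

@[fun_prop] theorem conflict (hI : PolyTime I) (hu : PolyTime u) (hv : PolyTime v) :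
    PolyTime (fun a => (I a).conflict (u a) (v a)) := by
  unfold RawInput.conflict; fun_prop

@[fun_prop] theorem unoriented (hI : PolyTime I) (hT : PolyTime T) (hu : PolyTime u)
    (hv : PolyTime v) : PolyTime (fun a => (I a).unoriented (T a) (u a) (v a)) := by
  unfold RawInput.unoriented; fun_prop

@[fun_prop] theorem forcedBy (hI : PolyTime I) (hT : PolyTime T) (hu : PolyTime u)
    (hv : PolyTime v) : PolyTime (fun a => (I a).forcedBy (T a) (u a) (v a)) := by
  unfold RawInput.forcedBy RawInput.forcingRound
  exact iterate_tabulateMatrix (order hI) (by fun_prop) (by fun_prop) (by fun_prop)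

@[fun_prop] theorem pairs (hI : PolyTime I) : PolyTime (fun a => (I a).pairs) := by
  unfold RawInput.pairs; fun_prop

@[fun_prop] theorem orientation (hI : PolyTime I) : PolyTime (fun a => (I a).orientation) := by
  unfold RawInput.orientation RawInput.orientStep
  exact foldl_tabulateMatrix (order hI) (by fun_prop) (by fun_prop) (by fun_prop)

@[fun_prop] theorem leftEnd (hI : PolyTime I) (hu : PolyTime u) :
    PolyTime (fun a => (I a).leftEnd (u a)) := by
  unfold RawInput.leftEnd; fun_prop

@[fun_prop] theorem legOf (hI : PolyTime I) (hu : PolyTime u) :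
    PolyTime (fun a => (I a).legOf (u a)) := by
  unfold RawInput.legOf; fun_prop

@[fun_prop] theorem reach (hI : PolyTime I) (hu : PolyTime u) :
    PolyTime (fun a => (I a).reach (u a)) := by
  unfold RawInput.reach; fun_prop

@[fun_prop] theorem rightEnd (hI : PolyTime I) (hu : PolyTime u) :
    PolyTime (fun a => (I a).rightEnd (u a)) := by
  unfold RawInput.rightEnd; fun_prop

@[fun_prop] theorem offsetOf (hI : PolyTime I) (hu : PolyTime u) :
    PolyTime (fun a => (I a).offsetOf (u a)) := by
  unfold RawInput.offsetOf; fun_prop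

@[fun_prop] theorem radiusOf (hI : PolyTime I) (hu : PolyTime u) :
    PolyTime (fun a => (I a).radiusOf (u a)) := by
  unfold RawInput.radiusOf; fun_prop

@[fun_prop] theorem legLength (hI : PolyTime I) : PolyTime (fun a => (I a).legLength) := by
  unfold RawInput.legLength; fun_prop

theorem output : PolyTime RawInput.output := by
  unfold RawInput.output; fun_prop

end PolyTime

/-! ### Transitive orientations -/

section Orientation

variable {V : Type*} {E : V → V → Prop} {X : Set V}

/-- An orientation of `p` forces an orientation of `q` in every transitive orientation of `E`. -/
def ForcingStep (E : V → V → Prop) (p q : V × V) : Prop :=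
  E p.1 p.2 ∧ E q.1 q.2 ∧ ((p.1 = q.1 ∧ ¬E p.2 q.2) ∨ (p.2 = q.2 ∧ ¬E p.1 q.1))

/-- The implication classes of `E`. -/
def Forces (E : V → V → Prop) : V × V → V × V → Prop := Relation.ReflTransGen (ForcingStep E)

/-- `E` is symmetric and irreflexive, no implication class contains both orientations of an edge,
and no implication class contains an edge directed out of `X` and an edge directed into `X`. -/
structure IsOrientable (E : V → V → Prop) (X : Set V) : Prop where
  symm : ∀ {a b}, E a b → E b a
  irrefl : ∀ a, ¬E a a
  not_forces_swap : ∀ {a b}, E a b → ¬Forces E (a, b) (b, a)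
  not_forces_into : ∀ {x v v' x'}, x ∈ X → x' ∈ X → E x v → ¬Forces E (x, v) (v', x')

theorem Forces.refl (p : V × V) : Forces E p p := Relation.ReflTransGen.refl

theorem Forces.trans {p q r : V × V} (h₁ : Forces E p q) (h₂ : Forces E q r) : Forces E p r :=
  Relation.ReflTransGen.trans h₁ h₂

theorem Forces.edge {p q : V × V} (h : Forces E p q) (hp : E p.1 p.2) : E q.1 q.2 := by
  induction h with
  | refl => exact hp
  | tail _ h _ => exact h.2.1

/-- `T` is a transitive orientation of `E`. -/
structure IsTransOrientation (E T : V → V → Prop) : Prop where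
  le : ∀ {a b}, T a b → E a b
  total : ∀ {a b}, E a b → T a b ∨ T b a
  asymm : ∀ {a b}, T a b → ¬T b a
  trans : ∀ {a b c}, T a b → T b c → T a c

/-- The edges that are not in the implication class of `p` or its reverse. -/
def removeClass (E : V → V → Prop) (p : V × V) (a b : V) : Prop :=
  E a b ∧ ¬Forces E p (a, b) ∧ ¬Forces E p (b, a)

namespace IsOrientable

theorem step_symm (hE : IsOrientable E X) {p q : V × V} (h : ForcingStep E p q) :
    ForcingStep E q p := by
  obtain ⟨h1, h2, ⟨h3, h4⟩ | ⟨h3, h4⟩⟩ := h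
  · exact ⟨h2, h1, .inl ⟨h3.symm, fun h => h4 (hE.symm h)⟩⟩
  · exact ⟨h2, h1, .inr ⟨h3.symm, fun h => h4 (hE.symm h)⟩⟩

theorem forces_symm (hE : IsOrientable E X) {p q : V × V} (h : Forces E p q) : Forces E q p :=
  by
  induction h with
  | refl => exact .refl _
  | tail _ hs ih => exact Forces.trans (.single (hE.step_symm hs)) ih

theorem forces_swap (hE : IsOrientable E X) {a b c d : V} (h : Forces E (a, b) (c, d)) :
    Forces E (b, a) (d, c) := by
  refine Relation.ReflTransGen.lift Prod.swap (fun p q h => ?_) _ _ h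
  obtain ⟨h1, h2, h3⟩ := h
  exact ⟨hE.symm h1, hE.symm h2, h3.symm⟩

theorem forces_left {a b c : V} (h : E a b) (h' : E a c) (hn : ¬E b c) :
    Forces E (a, b) (a, c) :=
  .single ⟨h, h', .inl ⟨rfl, hn⟩⟩

theorem forces_right {a b c : V} (h : E b a) (h' : E c a) (hn : ¬E b c) :
    Forces E (b, a) (c, a) :=
  .single ⟨h, h', .inr ⟨rfl, hn⟩⟩

/-- Golumbic's triangle lemma, by induction along the forcing chain. If `a` were not joined to the
new end of an edge of the chain, an edge at `a` would force that edge or its reverse, and two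
classes assumed different would coincide. Since `a` is joined to it, each step only moves the end of
an edge at `a` along a non-edge, which again is a forcing step. -/
theorem triangle (hE : IsOrientable E X) {a b c : V} (hab : E a b) (hac : E a c)
    (h₁ : ¬Forces E (a, c) (b, c)) (h₂ : ¬Forces E (a, b) (c, b)) {q : V × V} (h : Forces E (b, c) q) :
    E a q.1 ∧ E a q.2 ∧ Forces E (a, b) (a, q.1) ∧ Forces E (a, c) (a, q.2) := by
  induction h with
  | refl => exact ⟨hab, hac, .refl _, .refl _⟩
  | @tail q r hq hs ih =>
    obtain ⟨u, v⟩ := q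
    obtain ⟨u', v'⟩ := r
    obtain ⟨h3, h4, h5, h6⟩ := ih
    have hq' : Forces E (b, c) (u', v') := hq.tail hs
    obtain ⟨hu, hu', ⟨e, hn⟩ | ⟨e, hn⟩⟩ := hs
    · simp only at e hn hu hu' h3 h4 h5 h6 ⊢
      subst e
      have hv : E a v' := by
        by_contra hv
        refine h₂ (h5.trans ((forces_right h3 (hE.symm hu') hv).trans ?_))
        exact hE.forces_swap (hE.forces_symm hq')
      exact ⟨h3, hv, h5, h6.trans (forces_left h4 hv hn)⟩
    · simp only at e hn hu hu' h3 h4 h5 h6 ⊢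
      subst e
      have hv : E a u' := by
        by_contra hv
        exact h₁ (h6.trans ((forces_right h4 hu' hv).trans (hE.forces_symm hq')))
      exact ⟨hv, h4, h5.trans (forces_left h3 hv hn), h6⟩

/-- Implication classes are transitive. -/
theorem forces_trans (hE : IsOrientable E X) {a b c : V} (hab : E a b)
    (h : Forces E (a, b) (b, c)) : E a c ∧ Forces E (a, b) (a, c) := by
  have hbc : E b c := h.edge hab
  have hac : E a c := by
    by_contra hac
    exact hE.not_forces_swap hbc ((hE.forces_symm h).trans
      (forces_right hab (hE.symm hbc) hac))
  refine ⟨hac, ?_⟩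
  -- Otherwise the triangle lemma applies to the chain from `(b, c)` back to `(a, b)` and produces
  -- the loop `E a a`.
  by_contra hn
  refine hE.irrefl a (hE.triangle hab hac (fun h' => hn ?_) (fun h' => ?_)
    (hE.forces_symm h)).1
  · exact h.trans (hE.forces_symm h')
  · exact hE.not_forces_swap hbc ((hE.forces_symm h).trans h')

theorem removeClass_symm (hE : IsOrientable E X) {p : V × V} {a b : V} (h : removeClass E p a b) :
    removeClass E p b a :=
  ⟨hE.symm h.1, h.2.2, h.2.1⟩

theorem removeClass_congr (hE : IsOrientable E X) {p : V × V} {a b c d : V}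
    (h : Forces E (a, b) (c, d)) (h' : removeClass E p a b) : removeClass E p c d :=
  ⟨h.edge h'.1, fun hn => h'.2.1 (hn.trans (hE.forces_symm h)),
    fun hn => h'.2.2 (hn.trans (hE.forces_swap (hE.forces_symm h)))⟩

/-- The edge is in the implication class of `p` or its reverse. -/
def InClass (E : V → V → Prop) (p : V × V) (a b : V) : Prop :=
  E a b ∧ (Forces E p (a, b) ∨ Forces E p (b, a))

theorem inClass_of (hE : IsOrientable E X) {p : V × V} {a b c d : V} (h : InClass E p a b)
    (h' : Forces E (a, b) (c, d)) : InClass E p c d :=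
  ⟨h'.edge h.1, h.2.imp (fun h => h.trans h') fun h => h.trans (hE.forces_swap h')⟩

theorem not_forces_of_inClass (hE : IsOrientable E X) {p : V × V} {a b c d : V}
    (h : InClass E p a b) (h' : removeClass E p c d) : ¬Forces E (a, b) (c, d) := fun hf => by
  have := (hE.inClass_of h hf).2
  exact this.elim h'.2.1 h'.2.2

theorem InClass.symm (hE : IsOrientable E X) {p : V × V} {a b : V} (h : InClass E p a b) :
    InClass E p b a := ⟨hE.symm h.1, h.2.symm⟩

theorem forces_or_of_inClass (hE : IsOrientable E X) {p : V × V} {a b c d : V}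
    (h : InClass E p a b) (h' : InClass E p c d) :
    Forces E (a, b) (c, d) ∨ Forces E (a, b) (d, c) := by
  obtain ⟨-, h⟩ := h
  obtain ⟨-, h'⟩ := h'
  rcases h with h | h <;> rcases h' with h' | h'
  · exact .inl ((hE.forces_symm h).trans h')
  · exact .inr ((hE.forces_symm h).trans h')
  · exact .inr (hE.forces_swap ((hE.forces_symm h).trans h'))
  · exact .inl (hE.forces_swap ((hE.forces_symm h).trans h'))

/-- The triangle lemma with apex `b'` and base `(a, b)`: the side `bb'` is removed while `ab` stays,
and `(a, b)` and `(a, b')` are inequivalent. Hence `b'` forms such a triangle with every edge of the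
class of `(a, b)`. -/
theorem merge_aux (hE : IsOrientable E X) {p : V × V} {a b b' s t : V}
    (hab : removeClass E p a b) (hab' : removeClass E p a b') (hbb' : InClass E p b b')
    (hne : ¬Forces E (a, b) (a, b')) (hst : Forces E (a, b) (s, t)) :
    Forces E (a, b') (s, b') ∧ InClass E p t b' := by
  have hbb := InClass.symm hE hbb'
  have := hE.triangle (a := b') (b := a) (c := b) (hE.symm hab'.1) hbb.1
    (hE.not_forces_of_inClass hbb hab) (fun h => hne (hE.forces_swap (hE.forces_symm h)))
    hst
  exact ⟨hE.forces_swap this.2.2.1, InClass.symm hE (hE.inClass_of hbb this.2.2.2)⟩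

/-- A forcing step that exists only after the removal is due to a removed third side. If the tails
agree, that side is equivalent to `(t, b')` or its reverse, and the triangle lemma at `s` carries
the new edge to the class of `(s, b')` or of `(s, t)`. If the heads agree, it yields a loop at `s`.
-/
theorem merge_step (hE : IsOrientable E X) {p : V × V} {a b b' : V}
    (hab : removeClass E p a b) (hab' : removeClass E p a b') (hbb' : InClass E p b b')
    (hne : ¬Forces E (a, b) (a, b')) {q r : V × V} (hq : Forces E (a, b) q) (hs : ForcingStep (removeClass E p) q r) :
    Forces E (a, b) r ∨ Forces E (a, b') r := by
  obtain ⟨s, t⟩ := q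
  obtain ⟨s', t'⟩ := r
  have hst : removeClass E p s t := hE.removeClass_congr hq hab
  by_cases hstep : ForcingStep E (s, t) (s', t')
  · exact .inl (hq.tail hstep)
  obtain ⟨hsb, htb⟩ := hE.merge_aux hab hab' hbb' hne hq
  have hsb' : removeClass E p s b' := hE.removeClass_congr hsb hab'
  obtain ⟨h1, h2, ⟨e, hn⟩ | ⟨e, hn⟩⟩ := hs
  all_goals simp only at e hn h1 h2
  all_goals subst e
  · have htt : InClass E p t t' := by
      refine ⟨?_, ?_⟩
      · by_contra h; exact hstep ⟨h1.1, h2.1, .inl ⟨rfl, h⟩⟩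
      · by_contra! h
        exact hstep ⟨h1.1, h2.1, .inl ⟨rfl, fun hh => hn ⟨hh, h⟩⟩⟩
    have tri := fun {q} => hE.triangle (a := s) (b := t) (c := b') (q := q) hst.1 hsb'.1
      (fun h => hE.not_forces_of_inClass htb hsb' (hE.forces_symm h))
      (fun h => hE.not_forces_of_inClass (InClass.symm hE htb) hst (hE.forces_symm h))
    rcases hE.forces_or_of_inClass htb htt with h | h
    · exact .inr (hsb.trans (tri h).2.2.2)
    · exact .inl (hq.trans (tri h).2.2.1)
  · have hss : InClass E p s s' := by
      refine ⟨?_, ?_⟩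
      · by_contra h; exact hstep ⟨h1.1, h2.1, .inr ⟨rfl, h⟩⟩
      · by_contra! h
        exact hstep ⟨h1.1, h2.1, .inr ⟨rfl, fun hh => hn ⟨hh, h⟩⟩⟩
    have tri := fun {q} => hE.triangle (a := s) (b := t) (c := b') (q := q) hst.1 hsb'.1
      (fun h => hE.not_forces_of_inClass htb hsb' (hE.forces_symm h))
      (fun h => hE.not_forces_of_inClass (InClass.symm hE htb) hst (hE.forces_symm h))
    rcases hE.forces_or_of_inClass htb hss with h | h
    · exact absurd (tri h).1 (hE.irrefl s)
    · exact absurd (tri h).2.1 (hE.irrefl s)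

/-- A class of the remaining edges is an old class or the union of two. The first new forcing step
exhibits a triangle `a b b'` with `bb'` removed, and from then on `merge_step` confines the chain to
the two classes at `a`, or to their reverses. -/
theorem forces_of_removeClass (hE : IsOrientable E X) {p p₀ q : V × V}
    (h : Forces (removeClass E p) p₀ q) : Forces E p₀ q ∨ ∃ a b b', removeClass E p a b ∧
      removeClass E p a b' ∧ InClass E p b b' ∧ ¬Forces E (a, b) (a, b') ∧
      ((Forces E (a, b) p₀ ∧ Forces E (a, b') q) ∨ (Forces E (b, a) p₀ ∧ Forces E (b', a) q)) := by
  have key : ∀ {a b b'}, removeClass E p a b → removeClass E p a b' → InClass E p b b' →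
      ¬Forces E (a, b) (a, b') → ∀ {q r : V × V}, (Forces E (a, b) q ∨ Forces E (a, b') q) →
      ForcingStep (removeClass E p) q r → Forces E (a, b) r ∨ Forces E (a, b') r := by
    intro a b b' h1 h2 h3 h4 q r hq hs
    rcases hq with hq | hq
    · exact hE.merge_step h1 h2 h3 h4 hq hs
    · exact (hE.merge_step h2 h1 (h3.symm hE) (fun h => h4 (hE.forces_symm h)) hq hs).symm
  have swapF : ∀ {p q : V × V}, Forces E p q → Forces E p.swap q.swap := fun h => hE.forces_swap h
  have swapS : ∀ {q r : V × V}, ForcingStep (removeClass E p) q r →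
      ForcingStep (removeClass E p) q.swap r.swap := fun h =>
    ⟨hE.removeClass_symm h.1, hE.removeClass_symm h.2.1, h.2.2.symm⟩
  induction h with
  | refl => exact .inl (.refl _)
  | @tail q r hq hs ih =>
    by_cases hr : Forces E p₀ r
    · exact .inl hr
    right
    rcases ih with ih | ⟨a, b, b', h1, h2, h3, h4, ⟨h5, h6⟩ | ⟨h5, h6⟩⟩
    · have hstep : ¬ForcingStep E q r := fun h => hr (ih.tail h)
      obtain ⟨a, b⟩ := q
      obtain ⟨a', b'⟩ := r
      obtain ⟨h1, h2, ⟨e, hn⟩ | ⟨e, hn⟩⟩ := hs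
      all_goals simp only at e hn h1 h2
      all_goals subst e
      · refine ⟨a, b, b', h1, h2, ⟨?_, ?_⟩, fun h => hr (ih.trans h),
          .inl ⟨hE.forces_symm ih, .refl _⟩⟩
        · by_contra h; exact hstep ⟨h1.1, h2.1, .inl ⟨rfl, h⟩⟩
        · by_contra! h
          exact hstep ⟨h1.1, h2.1, .inl ⟨rfl, fun hh => hn ⟨hh, h⟩⟩⟩
      · refine ⟨b, a, a', hE.removeClass_symm h1, hE.removeClass_symm h2, ⟨?_, ?_⟩,
          fun h => hr (ih.trans (hE.forces_swap h)), .inr ⟨hE.forces_symm ih, .refl _⟩⟩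
        · by_contra h; exact hstep ⟨h1.1, h2.1, .inr ⟨rfl, h⟩⟩
        · by_contra! h
          exact hstep ⟨h1.1, h2.1, .inr ⟨rfl, fun hh => hn ⟨hh, h⟩⟩⟩
    · rcases key h1 h2 h3 h4 (.inr h6) hs with h | h
      · exact absurd ((hE.forces_symm h5).trans h) hr
      · exact ⟨a, b, b', h1, h2, h3, h4, .inl ⟨h5, h⟩⟩
    · rcases key h1 h2 h3 h4 (.inr (swapF h6)) (swapS hs) with h | h
      · exact absurd ((hE.forces_symm h5).trans (swapF h)) hr
      · exact ⟨a, b, b', h1, h2, h3, h4, .inr ⟨h5, swapF h⟩⟩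

theorem removeClass (hE : IsOrientable E X) (p : V × V) : IsOrientable (removeClass E p) X where
  symm := hE.removeClass_symm
  irrefl a h := hE.irrefl a h.1
  not_forces_swap {s t} hst h := by
    -- If a merged class contained both orientations of an edge, `(b', a)` and `(a, b)` would be
    -- equivalent. By transitivity of classes so would be `(b', b)`, which is removed.
    have aux : ∀ {s t a b b'}, _root_.removeClass E p a b → InClass E p b b' →
        Forces E (a, b) (s, t) → Forces E (a, b') (t, s) → False := by
      intro s t a b b' h1 h3 h5 h6
      have h7 : Forces E (b', a) (a, b) := (hE.forces_swap h6).trans (hE.forces_symm h5)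
      have h8 := (hE.forces_trans ((hE.forces_symm h7).edge h1.1) h7).2
      exact hE.not_forces_of_inClass (h3.symm hE) h1 ((hE.forces_symm h8).trans h7)
    rcases hE.forces_of_removeClass h with h | ⟨a, b, b', h1, h2, h3, h4, ⟨h5, h6⟩ | ⟨h5, h6⟩⟩
    · exact hE.not_forces_swap hst.1 h
    · exact aux h1 h3 h5 h6
    · exact aux h1 h3 (hE.forces_swap h5) (hE.forces_swap h6)
  not_forces_into {x v v' x'} hx hx' hxv h := by
    rcases hE.forces_of_removeClass h with h | ⟨a, b, b', h1, h2, h3, h4, ⟨h5, h6⟩ | ⟨h5, h6⟩⟩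
    · exact hE.not_forces_into hx hx' hxv.1 h
    -- The old class of `(a, b')` contains `(x, b')`, which leaves `X`, so it cannot also contain
    -- `(v', x')`.
    · have h7 := (hE.merge_aux h1 h2 h3 h4 h5).1
      exact hE.not_forces_into hx hx' (h7.edge h2.1) ((hE.forces_symm h7).trans h6)
    · have h7 := (hE.merge_aux h2 h1 (h3.symm hE) (fun h => h4 (hE.forces_symm h))
        (hE.forces_swap h6)).1
      exact hE.not_forces_into hx' hx (h7.edge h1.1)
        ((hE.forces_symm h7).trans (hE.forces_swap h5))

/-- A transitive orientation of the remaining edges together with an implication class is a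
transitive orientation. -/
theorem isTransOrientation_union (hE : IsOrientable E X) {p : V × V} (hp : E p.1 p.2)
    {T : V → V → Prop} (hT : IsTransOrientation (_root_.removeClass E p) T) :
    IsTransOrientation E (fun a b => Forces E p (a, b) ∨ T a b) := by
  have hcl : ∀ {a b}, Forces E p (a, b) → E a b := fun h => h.edge hp
  have htr : ∀ {a b c}, Forces E p (a, b) → Forces E p (b, c) → Forces E p (a, c) := fun h1 h2 =>
    h1.trans (hE.forces_trans (hcl h1) ((hE.forces_symm h1).trans h2)).2
  have hr : ∀ {a b}, T a b → E a b ∧ ¬Forces E p (a, b) ∧ ¬Forces E p (b, a) := fun h => hT.le h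
  have has : ∀ {a b}, Forces E p (a, b) → ¬Forces E p (b, a) := fun h1 h2 =>
    hE.not_forces_swap (hcl h1) ((hE.forces_symm h1).trans h2)
  have htot : ∀ {a b}, E a b → (Forces E p (a, b) ∨ T a b) ∨ (Forces E p (b, a) ∨ T b a) := by
    intro a b h
    by_cases h1 : Forces E p (a, b)
    · exact .inl (.inl h1)
    by_cases h2 : Forces E p (b, a)
    · exact .inr (.inl h2)
    exact (hT.total ⟨h, h1, h2⟩).imp .inr .inr
  refine ⟨fun h => h.elim hcl fun h => (hr h).1, htot, ?_, ?_⟩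
  · rintro a b (h | h) (h' | h')
    · exact has h h'
    · exact (hr h').2.2 h
    · exact (hr h).2.2 h'
    · exact hT.asymm h h'
  · rintro a b c (h | h) (h' | h')
    · exact .inl (htr h h')
    -- An edge of the class followed by an edge of `T`. If `ac` were no edge, `(a, b)` would force
    -- `(c, b)`, an edge that is not in the class. The orientation `(c, a)` is excluded by the
    -- transitivity of whichever of the two parts contains it.
    · have hac : E a c := by
        by_contra hac
        exact (hr h').2.2 (h.trans (forces_right (hcl h) (hE.symm (hr h').1) hac))
      rcases htot hac with h3 | h3 | h3
      · exact h3
      · exact absurd (htr h3 h) (hr h').2.2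
      · exact absurd h (hr (hT.trans h' h3)).2.2
    · have hac : E a c := by
        by_contra hac
        exact (hr h).2.2 (h'.trans (forces_left (hcl h') (hE.symm (hr h).1)
          fun h => hac (hE.symm h)))
      rcases htot hac with h3 | h3 | h3
      · exact h3
      · exact absurd (htr h' h3) (hr h).2.2
      · exact absurd h' (hr (hT.trans h3 h)).2.2
    · exact .inr (hT.trans h h')

end IsOrientable

/-- A relation with a transitive orientation in which every edge at `X` is directed out of `X` is
orientable. -/
theorem IsTransOrientation.isOrientable {P : V → V → Prop} (hP : IsTransOrientation E P)
    (hsymm : ∀ {a b}, E a b → E b a) (hX : ∀ {v x}, x ∈ X → ¬P v x) : IsOrientable E X := by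
  have hstep : ∀ {p q : V × V}, ForcingStep E p q → P p.1 p.2 → P q.1 q.2 := by
    rintro ⟨a, b⟩ ⟨c, d⟩ ⟨h1, h2, ⟨e, h3⟩ | ⟨e, h3⟩⟩ hp
    all_goals simp only at e h1 h2 h3 hp ⊢
    all_goals subst e
    · exact (hP.total h2).resolve_right fun h => h3 (hsymm (hP.le (hP.trans h hp)))
    · exact (hP.total h2).resolve_right fun h => h3 (hP.le (hP.trans hp h))
  have hforce : ∀ {p q : V × V}, Forces E p q → P p.1 p.2 → P q.1 q.2 := fun h hp => by
    induction h with
    | refl => exact hp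
    | tail _ hs ih => exact hstep hs ih
  refine ⟨hsymm, fun a h => ?_, fun {a b} h hf => ?_, fun {x v v' x'} hx hx' h hf => ?_⟩
  · rcases hP.total h with h | h <;> exact hP.asymm h h
  · rcases hP.total h with h | h
    · exact hP.asymm h (hforce hf h)
    · have hf' : Forces E (b, a) (a, b) :=
        Relation.ReflTransGen.lift Prod.swap
          (fun p q h => ⟨hsymm h.1, hsymm h.2.1, h.2.2.symm⟩) _ _ hf
      exact hP.asymm h (hforce hf' h)
  · exact hX hx' (hforce hf ((hP.total h).resolve_right (hX hx)))

end Orientation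

/-! ### Correctness of the orientation -/

/-- An increasing chain that stops for good once it pauses has to pause within `card α` steps, as
each earlier step adds an element. -/
theorem stable_of_card {α : Type*} [Fintype α] [DecidableEq α] (S : ℕ → Finset α)
    (hmono : ∀ k, S k ⊆ S (k + 1)) (hstab : ∀ k, S k = S (k + 1) → S (k + 1) = S (k + 2))
    {N : ℕ} (hN : Fintype.card α ≤ N) : S N = S (N + 1) := by
  by_contra hne
  have hlt : ∀ k ≤ N, S k ≠ S (k + 1) := by
    intro k hk
    induction hk using Nat.decreasingInduction with
    | self => exact hne
    | of_succ k _ ih => exact fun h => ih (hstab k h)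
  have hcard : ∀ k ≤ N + 1, k ≤ (S k).card := by
    intro k
    induction k with
    | zero => simp
    | succ k ih =>
      intro hk
      have h1 := ih (by omega)
      have h2 := Finset.card_lt_card ((hmono k).ssubset_of_ne (hlt k (by omega)))
      omega
  have h1 := hcard (N + 1) le_rfl
  have h2 := Finset.card_le_univ (S (N + 1))
  omega

namespace RawInput

variable {I : RawInput} {n : ℕ}

theorem any_vertices (hn : I.order = n) {p : ℕ → Bool} :
    I.vertices.any p = true ↔ ∃ c : Fin n, p c = true := by
  simp only [vertices, List.any_eq_true, List.mem_range, hn]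
  exact ⟨fun ⟨c, h1, h2⟩ => ⟨⟨c, h1⟩, h2⟩, fun ⟨c, h⟩ => ⟨c, c.2, h⟩⟩

theorem all_vertices (hn : I.order = n) {p : ℕ → Bool} :
    I.vertices.all p = true ↔ ∀ c : Fin n, p c = true := by
  simp only [vertices, List.all_eq_true, List.mem_range, hn]
  exact ⟨fun h c => h c c.2, fun h c hc => h ⟨c, hc⟩⟩

theorem mem_vertices (hn : I.order = n) (v : Fin n) : (v : ℕ) ∈ I.vertices := by
  simp [vertices, hn]

/-- The entries of a matrix as a relation. -/
def matrixRel (n : ℕ) (T : List (List Bool)) (a b : Fin n) : Prop := matrixEntry T a b = true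

/-- The conflicts as a relation. -/
def conflictRel (I : RawInput) (n : ℕ) (a b : Fin n) : Prop := I.conflict a b = true

/-- The conflicts that are not oriented by `T` as a relation. -/
def unorientedRel (I : RawInput) (n : ℕ) (T : List (List Bool)) (a b : Fin n) : Prop :=
  I.unoriented T a b = true

theorem unorientedRel_iff {T : List (List Bool)} {a b : Fin n} : unorientedRel I n T a b ↔
    conflictRel I n a b ∧ ¬matrixRel n T a b ∧ ¬matrixRel n T b a := by
  simp [unorientedRel, unoriented, conflictRel, matrixRel, and_assoc]

theorem matrixEntry_forcingRound (hn : I.order = n) (T D : List (List Bool)) (a b : Fin n) :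
    matrixRel n (I.forcingRound T D) a b ↔ unorientedRel I n T a b ∧
      ((∃ c, matrixRel n D a c ∧ ¬unorientedRel I n T c b) ∨
        ∃ c, matrixRel n D c b ∧ ¬unorientedRel I n T a c) := by
  rw [matrixRel, forcingRound,
    matrixEntry_tabulateMatrix _ _ _ _ (by rw [hn]; exact a.2) (by rw [hn]; exact b.2)]
  simp [any_vertices hn, unorientedRel, matrixRel]

theorem matrixEntry_forcedBy (hn : I.order = n) {T : List (List Bool)} {X : Set (Fin n)}
    (hE : IsOrientable (unorientedRel I n T) X) {u v : Fin n} (huv : unorientedRel I n T u v)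
    (a b : Fin n) :
    matrixRel n (I.forcedBy T u v) a b ↔ Forces (unorientedRel I n T) (u, v) (a, b) := by
  classical
  set D : ℕ → List (List Bool) := fun k => (I.forcingRound T)^[k]
    (tabulateMatrix I.order fun a b => decide (a = u) && decide (b = v)) with hD
  have hDs : ∀ k, D (k + 1) = I.forcingRound T (D k) := fun k =>
    Function.iterate_succ_apply' _ _ _
  have hD0 : ∀ a b : Fin n, matrixRel n (D 0) a b ↔ a = u ∧ b = v := by
    intro a b
    rw [matrixRel, hD]
    simp only [Function.iterate_zero, id_eq]
    rw [matrixEntry_tabulateMatrix _ _ _ _ (by rw [hn]; exact a.2) (by rw [hn]; exact b.2)]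
    simp [Fin.ext_iff]
  have hsound : ∀ k a b, matrixRel n (D k) a b →
      Forces (unorientedRel I n T) (u, v) (a, b) := by
    intro k
    induction k with
    | zero =>
      intro a b h
      obtain ⟨rfl, rfl⟩ := (hD0 a b).1 h
      exact .refl _
    | succ k ih =>
      intro a b h
      rw [hDs, matrixEntry_forcingRound hn] at h
      obtain ⟨h0, ⟨c, h1, h2⟩ | ⟨c, h1, h2⟩⟩ := h
      · exact (ih _ _ h1).tail ⟨(ih _ _ h1).edge huv, h0, .inl ⟨rfl, h2⟩⟩
      · exact (ih _ _ h1).tail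
          ⟨(ih _ _ h1).edge huv, h0, .inr ⟨rfl, fun h => h2 (hE.symm h)⟩⟩
  have hmono : ∀ k a b, matrixRel n (D k) a b → matrixRel n (D (k + 1)) a b := by
    intro k a b h
    rw [hDs, matrixEntry_forcingRound hn]
    -- The witness `c = b` works because `E` is irreflexive.
    exact ⟨(hsound k a b h).edge huv, .inl ⟨b, h, hE.irrefl b⟩⟩
  have hstable := stable_of_card
    (fun k => Finset.univ.filter fun p : Fin n × Fin n => matrixRel n (D k) p.1 p.2)
    (fun k p hp => by
      simp only [Finset.mem_filter, Finset.mem_univ, true_and] at hp ⊢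
      exact hmono _ _ _ hp)
    (fun k h => by
      ext p
      have h' : ∀ a b, matrixRel n (D k) a b ↔ matrixRel n (D (k + 1)) a b := fun a b => by
        simpa using Finset.ext_iff.1 h (a, b)
      simp only [Finset.mem_filter, Finset.mem_univ, true_and]
      rw [hDs, hDs (k + 1), matrixEntry_forcingRound hn, matrixEntry_forcingRound hn]
      simp only [h'])
    (N := n * n) (by simp)
  have hst : ∀ a b, matrixRel n (D (n * n)) a b ↔ matrixRel n (D (n * n + 1)) a b := fun a b => by
    simpa using Finset.ext_iff.1 hstable (a, b)
  have hDN : I.forcedBy T u v = D (n * n) := by simp only [forcedBy, hD, hn]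
  rw [hDN]
  refine ⟨hsound _ _ _, fun h => ?_⟩
  have hbase : ∀ k, matrixRel n (D k) u v := by
    intro k
    induction k with
    | zero => exact (hD0 u v).2 ⟨rfl, rfl⟩
    | succ k ih => exact hmono k _ _ ih
  suffices ∀ q : Fin n × Fin n, Forces (unorientedRel I n T) (u, v) q →
      matrixRel n (D (n * n)) q.1 q.2 from this _ h
  intro q hq
  induction hq with
  | refl => exact hbase _
  | @tail q r _ hs ih =>
    obtain ⟨s, t⟩ := q
    obtain ⟨s', t'⟩ := r
    rw [hst, hDs, matrixEntry_forcingRound hn]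
    obtain ⟨-, h2, ⟨e, h3⟩ | ⟨e, h3⟩⟩ := hs
    all_goals simp only at e h2 h3 ih ⊢
    all_goals subst e
    · exact ⟨h2, .inl ⟨t, ih, h3⟩⟩
    · exact ⟨h2, .inr ⟨s, ih, fun h => h3 (hE.symm h)⟩⟩

/-- The partial orientation `T` can be extended by every transitive orientation of the conflicts
that are left. -/
structure IsPartialOrientation (I : RawInput) (X : Set (Fin n)) (T : List (List Bool)) :
    Prop where
  orientable : IsOrientable (unorientedRel I n T) X
  extend : ∀ {S : Fin n → Fin n → Prop}, IsTransOrientation (unorientedRel I n T) S →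
    IsTransOrientation (conflictRel I n) fun a b => matrixRel n T a b ∨ S a b
  not_into : ∀ {v x}, x ∈ X → ¬matrixRel n T v x

/-- Orienting a whole class is safe by `isTransOrientation_union`. The alternative `huv` protects
`X`: either the class contains an edge leaving `X`, hence none entering it, or no edge at `X` is
left to be oriented. -/
theorem IsPartialOrientation.step (hn : I.order = n) {X : Set (Fin n)} {T : List (List Bool)}
    (hT : IsPartialOrientation I X T) {u v : Fin n}
    (huv : u ∈ X ∨ ∀ x ∈ X, ∀ v, ¬unorientedRel I n T x v) :
    IsPartialOrientation I X (I.orientStep T (u, v)) ∧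
      ¬unorientedRel I n (I.orientStep T (u, v)) u v ∧
      ∀ a b, unorientedRel I n (I.orientStep T (u, v)) a b → unorientedRel I n T a b := by
  have hentry : ∀ a b : Fin n, matrixRel n (I.orientStep T (u, v)) a b ↔ matrixRel n T a b ∨
      (unorientedRel I n T u v ∧ matrixRel n (I.forcedBy T u v) a b) := by
    intro a b
    rw [matrixRel, orientStep,
      matrixEntry_tabulateMatrix _ _ _ _ (by rw [hn]; exact a.2) (by rw [hn]; exact b.2)]
    simp [matrixRel, unorientedRel]
  by_cases he : unorientedRel I n T u v
  · have hentry' : ∀ a b : Fin n, matrixRel n (I.orientStep T (u, v)) a b ↔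
        matrixRel n T a b ∨ Forces (unorientedRel I n T) (u, v) (a, b) := fun a b => by
      rw [hentry, matrixEntry_forcedBy hn hT.orientable he]
      simp [he]
    have hrel : unorientedRel I n (I.orientStep T (u, v)) =
        removeClass (unorientedRel I n T) (u, v) := by
      funext a b
      apply propext
      rw [unorientedRel_iff, hentry', hentry', removeClass, unorientedRel_iff]
      tauto
    refine ⟨⟨?_, ?_, ?_⟩, ?_, ?_⟩
    · rw [hrel]; exact hT.orientable.removeClass _
    · intro S hS
      rw [hrel] at hS
      have := hT.extend (hT.orientable.isTransOrientation_union he hS)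
      simp only [hentry', or_assoc]
      exact this
    · intro v' x' hx' h
      rcases (hentry' _ _).1 h with h | h
      · exact hT.not_into hx' h
      · rcases huv with huv | huv
        · exact hT.orientable.not_forces_into huv hx' he h
        · exact huv x' hx' v' (hT.orientable.symm (h.edge he))
    · rw [hrel]; exact fun h => h.2.1 (.refl _)
    · rw [hrel]; exact fun a b h => h.1
  · have hentry' : ∀ a b : Fin n, matrixRel n (I.orientStep T (u, v)) a b ↔
        matrixRel n T a b := fun a b => by simp [hentry, he]
    have hrel : unorientedRel I n (I.orientStep T (u, v)) = unorientedRel I n T := by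
      funext a b
      apply propext
      rw [unorientedRel_iff, unorientedRel_iff, hentry', hentry']
    refine ⟨⟨?_, ?_, ?_⟩, ?_, ?_⟩
    · rw [hrel]; exact hT.orientable
    · intro S hS
      rw [hrel] at hS
      simp only [hentry']
      exact hT.extend hS
    · intro v' x' hx' h
      exact hT.not_into hx' ((hentry' _ _).1 h)
    · rwa [hrel]
    · rw [hrel]; exact fun a b h => h

theorem IsPartialOrientation.foldl (hn : I.order = n) {X : Set (Fin n)} (l : List (ℕ × ℕ))
    (hl : ∀ e ∈ l, e.1 < n ∧ e.2 < n) {T : List (List Bool)} (hT : IsPartialOrientation I X T)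
    (hX : (∀ e ∈ l, ∀ h : e.1 < n, (⟨e.1, h⟩ : Fin n) ∈ X) ∨
      ∀ x ∈ X, ∀ v, ¬unorientedRel I n T x v) :
    IsPartialOrientation I X (l.foldl I.orientStep T) ∧
      (∀ u v : Fin n, ((u : ℕ), (v : ℕ)) ∈ l →
        ¬unorientedRel I n (l.foldl I.orientStep T) u v) ∧
      ∀ a b, unorientedRel I n (l.foldl I.orientStep T) a b → unorientedRel I n T a b := by
  induction l generalizing T with
  | nil => exact ⟨hT, by simp, fun _ _ h => h⟩
  | cons e l ih =>
    simp only [List.mem_cons, forall_eq_or_imp] at hl hX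
    obtain ⟨h1, h2, h3⟩ := hT.step hn (u := ⟨e.1, hl.1.1⟩) (v := ⟨e.2, hl.1.2⟩)
      (hX.imp_left fun h => h.1 hl.1.1)
    obtain ⟨h4, h5, h6⟩ := ih hl.2 h1
      (hX.imp (fun h => h.2) fun h x hx v h' => h x hx v (h3 _ _ h'))
    refine ⟨h4, ?_, fun a b h => h3 _ _ (h6 _ _ h)⟩
    intro u v huv
    rcases List.mem_cons.1 huv with rfl | huv
    · exact fun h => h2 (h6 _ _ h)
    · exact h5 u v huv

theorem isTransOrientation_orientation (hn : I.order = n) {X : Set (Fin n)}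
    (hX : ∀ u : Fin n, u ∈ X ↔ I.inClique u = true) {P : Fin n → Fin n → Prop}
    (hP : IsTransOrientation (conflictRel I n) P)
    (hsymm : ∀ {a b}, conflictRel I n a b → conflictRel I n b a)
    (hPX : ∀ {v x}, x ∈ X → ¬P v x) :
    IsTransOrientation (conflictRel I n) (matrixRel n I.orientation) ∧
      ∀ {v x}, x ∈ X → ¬matrixRel n I.orientation v x := by
  have hnil : ∀ a b : Fin n, ¬matrixRel n [] a b := by simp [matrixRel, matrixEntry]
  have hrel : unorientedRel I n [] = conflictRel I n := by
    funext a b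
    apply propext
    simp [unorientedRel_iff, hnil]
  have h0 : IsPartialOrientation I X [] :=
    ⟨by rw [hrel]; exact hP.isOrientable hsymm hPX, fun hS => by
      rw [hrel] at hS; simpa [hnil] using hS, fun _ => hnil _ _⟩
  have hpairs : ∀ e : ℕ × ℕ, e ∈ I.pairs ↔ e.1 < n ∧ e.2 < n := by
    rintro ⟨a, b⟩
    simp [pairs, vertices, hn]
  obtain ⟨h1, h2, h3⟩ := h0.foldl hn (I.pairs.filter fun e => I.inClique e.1)
    (fun e he => (hpairs e).1 (List.mem_filter.1 he).1)
    (.inl fun e he h => (hX _).2 (List.mem_filter.1 he).2)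
  -- After the first pass no unoriented conflict meets `X`, which allows arbitrary pairs in the
  -- second pass.
  obtain ⟨h4, h5, h6⟩ := h1.foldl hn I.pairs (fun e he => (hpairs e).1 he)
    (.inr fun x hx v => h2 x v (List.mem_filter.2 ⟨(hpairs _).2 ⟨x.2, v.2⟩, (hX x).1 hx⟩))
  rw [← List.foldl_append] at h4 h5
  refine ⟨?_, fun hx => h4.not_into hx⟩
  -- No conflict is left, so the empty relation is a transitive orientation of the rest.
  have := h4.extend (S := fun _ _ => False)
    ⟨False.elim, fun {a b} h => absurd h (h5 a b ((hpairs _).2 ⟨a.2, b.2⟩)), fun h => h.elim, fun h => h.elim⟩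
  simp only [or_false] at this
  exact this

end RawInput

/-! ### The geometry of stars -/

namespace EmbeddedTree

variable {N : Type*} (T : EmbeddedTree N) {c : N}

/-- The length of the segment from `c` to `i`. -/
noncomputable def legLength (c i : N) : ℝ := dist (T.pos c) (T.pos i)

/-- The point of the ray from `c` through `i` at distance `s` from `c`. -/
noncomputable def legPoint (c i : N) (s : ℝ) : Plane :=
  AffineMap.lineMap (T.pos c) (T.pos i) (s / T.legLength c i)

/-- The distance in a star between two points, given by their legs and their distances from the
center of the star. -/
noncomputable def starDist [DecidableEq N] (i j : N) (s t : ℝ) : ℝ :=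
  if i = j then |s - t| else s + t

theorem legLength_pos {i : N} (hi : i ≠ c) : 0 < T.legLength c i :=
  dist_pos.2 fun h => hi (T.pos_injective h).symm

theorem legPoint_mem {i : N} (hi : i ≠ c) {s : ℝ} (hs : 0 ≤ s) (hs' : s ≤ T.legLength c i) :
    T.legPoint c i s ∈ segment ℝ (T.pos c) (T.pos i) := by
  rw [segment_eq_image_lineMap]
  exact ⟨_, ⟨by have := T.legLength_pos hi; positivity,
    (div_le_one (T.legLength_pos hi)).2 hs'⟩, rfl⟩

theorem exists_legPoint {i : N} (hi : i ≠ c) {x : Plane}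
    (hx : x ∈ segment ℝ (T.pos c) (T.pos i)) :
    ∃ s, 0 ≤ s ∧ s ≤ T.legLength c i ∧ x = T.legPoint c i s := by
  rw [segment_eq_image_lineMap] at hx
  obtain ⟨t, ⟨h0, h1⟩, rfl⟩ := hx
  have := T.legLength_pos hi
  exact ⟨t * T.legLength c i, by positivity, by nlinarith, by
    rw [legPoint, mul_div_cancel_right₀ _ this.ne']⟩

theorem dist_legPoint {i : N} (hi : i ≠ c) (s t : ℝ) :
    dist (T.legPoint c i s) (T.legPoint c i t) = |s - t| := by
  have := T.legLength_pos hi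
  rw [legPoint, legPoint, dist_lineMap_lineMap, Real.dist_eq, ← sub_div, abs_div,
    abs_of_pos this, ← legLength, div_mul_cancel₀ _ this.ne']

@[simp] theorem legPoint_zero (i : N) : T.legPoint c i 0 = T.pos c := by
  simp [legPoint]

/-- An edge avoiding `c` would close a triangle with `c`, giving two paths between its ends in a
tree. -/
theorem adj_center (hc : ∀ v, v ≠ c → T.graph.Adj c v) {a b : N} (h : T.graph.Adj a b) :
    a = c ∨ b = c := by
  by_contra! hn
  have h1 := hc a hn.1
  have h2 := hc b hn.2
  have := ((SimpleGraph.isAcyclic_iff_subsingleton_path.1 T.isTree.isAcyclic) _ _).elim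
    (SimpleGraph.Path.singleton h)
    ⟨.cons h1.symm (.cons h2 .nil), by
      simp [SimpleGraph.Walk.cons_isPath_iff, hn.1, hn.2.symm, h.ne]⟩
  have h3 := congrArg (fun p => p.1.length) this
  simp [SimpleGraph.Path.singleton] at h3

theorem legPoint_inj (hc : ∀ v, v ≠ c → T.graph.Adj c v) {i j : N} (hi : i ≠ c) (hj : j ≠ c)
    {s t : ℝ} (hs : 0 ≤ s) (hs' : s ≤ T.legLength c i) (ht : 0 ≤ t) (ht' : t ≤ T.legLength c j)
    (h : T.legPoint c i s = T.legPoint c j t) : s = t ∧ (i = j ∨ s = 0) := by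
  by_cases hij : i = j
  · subst hij
    have := T.dist_legPoint hi s t
    rw [h, dist_self] at this
    exact ⟨by linarith [abs_eq_zero.1 this.symm], .inl rfl⟩
  · obtain ⟨v, hv, hv', hp⟩ := T.segments_inter c i c j (hc i hi) (hc j hj)
      (by simp [hij, hi])
      (T.legPoint c i s) ⟨T.legPoint_mem hi hs hs', h ▸ T.legPoint_mem hj ht ht'⟩
    have hvc : v = c := by
      rcases Sym2.mem_iff.1 hv with rfl | rfl
      · rfl
      · rcases Sym2.mem_iff.1 hv' with rfl | rfl
        · rfl
        · exact absurd rfl hij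
    subst hvc
    have h1 := T.dist_legPoint hi s 0
    have h2 := T.dist_legPoint hj t 0
    rw [legPoint_zero, hp, dist_self, sub_zero, abs_of_nonneg hs] at h1
    rw [← h, legPoint_zero, hp, dist_self, sub_zero, abs_of_nonneg ht] at h2
    exact ⟨by linarith, .inr h1.symm⟩

theorem OnCommonSegment.exists_leg (hc : ∀ v, v ≠ c → T.graph.Adj c v) {x y : Plane}
    (h : T.OnCommonSegment x y) : ∃ k, k ≠ c ∧ (∃ s, 0 ≤ s ∧ s ≤ T.legLength c k ∧
      x = T.legPoint c k s) ∧ ∃ t, 0 ≤ t ∧ t ≤ T.legLength c k ∧ y = T.legPoint c k t := by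
  obtain ⟨a, b, hab, hx, hy⟩ := h
  rcases T.adj_center hc hab with rfl | rfl
  · exact ⟨b, hab.ne', T.exists_legPoint hab.ne' hx, T.exists_legPoint hab.ne' hy⟩
  · rw [segment_symm] at hx hy
    exact ⟨a, hab.ne, T.exists_legPoint hab.ne hx, T.exists_legPoint hab.ne hy⟩

theorem exists_leg_of_mem_points (hc : ∀ v, v ≠ c → T.graph.Adj c v) {x : Plane}
    (h : x ∈ T.points) : ∃ k, k ≠ c ∧ ∃ s, 0 ≤ s ∧ s ≤ T.legLength c k ∧
      x = T.legPoint c k s := by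
  obtain ⟨a, b, hab, hx⟩ := h
  obtain ⟨k, h1, h2, -⟩ := OnCommonSegment.exists_leg T hc ⟨a, b, hab, hx, hx⟩
  exact ⟨k, h1, h2⟩

/-- Every piece of a polygonal path stays on one leg, where its length is the difference of the
distances from the center; the triangle inequality for `starDist` adds up the pieces. -/
theorem starDist_le_of_pathLength [DecidableEq N] (hc : ∀ v, v ≠ c → T.graph.Adj c v)
    {x y : Plane} {l : ℝ} (h : T.PathLength x y l) {i j : N} (hi : i ≠ c) (hj : j ≠ c) {s t : ℝ}
    (hs : 0 ≤ s) (hs' : s ≤ T.legLength c i) (ht : 0 ≤ t) (ht' : t ≤ T.legLength c j)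
    (hx : x = T.legPoint c i s) (hy : y = T.legPoint c j t) : starDist i j s t ≤ l := by
  induction h generalizing i s with
  | @single x y h =>
    obtain ⟨k, hk, ⟨s', h1, h2, rfl⟩, ⟨t', h3, h4, rfl⟩⟩ := OnCommonSegment.exists_leg T hc h
    obtain ⟨rfl, h5⟩ := T.legPoint_inj hc hk hi h1 h2 hs hs' hx
    obtain ⟨rfl, h6⟩ := T.legPoint_inj hc hk hj h3 h4 ht ht' hy
    rw [T.dist_legPoint hk, starDist]
    split_ifs with hij
    · exact le_rfl
    · rcases h5 with rfl | rfl
      · rcases h6 with rfl | rfl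
        · exact absurd rfl hij
        · rw [sub_zero, add_zero]; exact le_abs_self _
      · rw [zero_sub, abs_neg, zero_add]; exact le_abs_self _
  | @step x z y l h _ ih =>
    obtain ⟨k, hk, ⟨s', h1, h2, rfl⟩, ⟨z', h3, h4, rfl⟩⟩ := OnCommonSegment.exists_leg T hc h
    obtain ⟨rfl, h5⟩ := T.legPoint_inj hc hk hi h1 h2 hs hs' hx
    have h6 := ih hk h3 h4 rfl hy
    rw [T.dist_legPoint hk]
    -- A point has two leg labels only if it is the center, and there the label does not affect the
    -- distance.
    have h7 : starDist i j s' t ≤ starDist k j s' t := by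
      rcases h5 with rfl | rfl
      · exact le_rfl
      · rw [starDist, starDist, zero_sub, abs_neg, abs_of_nonneg ht]; simp
    have h8 : starDist k j s' t ≤ |s' - z'| + starDist k j z' t := by
      rw [starDist, starDist]
      split_ifs
      · exact abs_sub_le _ _ _
      · linarith [le_abs_self (s' - z')]
    linarith

theorem treeDist_legPoint [DecidableEq N] (hc : ∀ v, v ≠ c → T.graph.Adj c v) {i j : N}
    (hi : i ≠ c) (hj : j ≠ c) {s t : ℝ}
    (hs : 0 ≤ s) (hs' : s ≤ T.legLength c i) (ht : 0 ≤ t) (ht' : t ≤ T.legLength c j) :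
    T.treeDist (T.legPoint c i s) (T.legPoint c j t) = starDist i j s t := by
  have hmem : T.PathLength (T.legPoint c i s) (T.legPoint c j t) (starDist i j s t) := by
    by_cases hij : i = j
    · subst hij
      rw [starDist, if_pos rfl, ← T.dist_legPoint hi]
      exact .single ⟨c, i, hc i hi, T.legPoint_mem hi hs hs', T.legPoint_mem hi ht ht'⟩
    · have h1 := T.dist_legPoint hi s 0
      have h2 := T.dist_legPoint hj 0 t
      rw [sub_zero, abs_of_nonneg hs] at h1
      rw [zero_sub, abs_neg, abs_of_nonneg ht, legPoint_zero, ← T.legPoint_zero i] at h2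
      have e : s + t = dist (T.legPoint c i s) (T.legPoint c i 0) +
        dist (T.legPoint c i 0) (T.legPoint c j t) := by rw [h1, h2]
      rw [starDist, if_neg hij, e]
      refine .step ⟨c, i, hc i hi, T.legPoint_mem hi hs hs',
        T.legPoint_mem hi le_rfl (T.legLength_pos hi).le⟩ (.single ⟨c, j, hc j hj, ?_,
        T.legPoint_mem hj ht ht'⟩)
      rw [legPoint_zero]
      exact left_mem_segment _ _ _
  refine (IsLeast.csInf_eq ⟨hmem, fun l hl => ?_⟩)
  exact T.starDist_le_of_pathLength hc hl hi hj hs hs' ht ht' rfl rfl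

theorem neighborhoodSubtree_inter_nonempty_iff [DecidableEq N]
    (hc : ∀ v, v ≠ c → T.graph.Adj c v) {i j : N}
    (hi : i ≠ c) (hj : j ≠ c) {s t : ℝ} (hs : 0 ≤ s) (hs' : s ≤ T.legLength c i) (ht : 0 ≤ t)
    (ht' : t ≤ T.legLength c j) (w w' : ℚ≥0) :
    (T.neighborhoodSubtree (T.legPoint c i s) w ∩
      T.neighborhoodSubtree (T.legPoint c j t) w').Nonempty ↔
      starDist i j s t ≤ (w : ℝ) + (w' : ℝ) := by
  have hw : (0 : ℝ) ≤ w := by positivity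
  have hw' : (0 : ℝ) ≤ w' := by positivity
  constructor
  · rintro ⟨x, ⟨hx, h1⟩, ⟨-, h2⟩⟩
    obtain ⟨k, hk, r, hr, hr', rfl⟩ := T.exists_leg_of_mem_points hc hx
    rw [T.treeDist_legPoint hc hk hi hr hr' hs hs'] at h1
    rw [T.treeDist_legPoint hc hk hj hr hr' ht ht'] at h2
    refine le_trans ?_ (add_le_add h1 h2)
    simp only [starDist]
    split_ifs with a b d d
    all_goals first
      | (subst_vars; first | exact absurd rfl ‹_› | skip)
    all_goals rcases abs_cases (s - t) with ⟨e1, _⟩ | ⟨e1, _⟩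
    all_goals rcases abs_cases (r - s) with ⟨e2, _⟩ | ⟨e2, _⟩
    all_goals rcases abs_cases (r - t) with ⟨e3, _⟩ | ⟨e3, _⟩
    all_goals linarith
  · intro h
    have build : ∀ k, k ≠ c → ∀ r, 0 ≤ r → r ≤ T.legLength c k → starDist k i r s ≤ w →
        starDist k j r t ≤ w' → (T.neighborhoodSubtree (T.legPoint c i s) w ∩
          T.neighborhoodSubtree (T.legPoint c j t) w').Nonempty := by
      intro k hk r hr hr' h1 h2
      have hp : T.legPoint c k r ∈ T.points := ⟨c, k, hc k hk, T.legPoint_mem hk hr hr'⟩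
      refine ⟨T.legPoint c k r, ⟨hp, ?_⟩, ⟨hp, ?_⟩⟩
      · rwa [T.treeDist_legPoint hc hk hi hr hr' hs hs']
      · rwa [T.treeDist_legPoint hc hk hj hr hr' ht ht']
    -- The common point is taken on the path from the first center to the second, at distance `w`
    -- from the first, or at the second center if that is nearer. On different legs it lies beyond
    -- the center of the star or before it according to whether `s ≤ w`.
    by_cases hij : i = j
    · subst hij
      rw [starDist, if_pos rfl, abs_le] at h
      rcases le_total s t with hst | hst
      · refine build i hi (min t (s + w)) (by positivity) ((min_le_left _ _).trans ht') ?_ ?_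
        all_goals
          rw [starDist, if_pos rfl, abs_le]
          rcases min_cases t (s + w) with ⟨e, _⟩ | ⟨e, _⟩ <;> rw [e] <;> constructor <;> linarith
      · refine build i hi (max t (s - w)) (ht.trans (le_max_left _ _))
          (max_le ht' (by linarith)) ?_ ?_
        all_goals
          rw [starDist, if_pos rfl, abs_le]
          rcases max_cases t (s - w) with ⟨e, _⟩ | ⟨e, _⟩ <;> rw [e] <;> constructor <;> linarith
    · rw [starDist, if_neg hij] at h
      rcases le_total s w with hsw | hsw
      · refine build j hj (min t (w - s)) (le_min ht (by linarith))
          ((min_le_left _ _).trans ht') ?_ ?_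
        · rw [starDist, if_neg (Ne.symm hij)]
          linarith [min_le_right t (w - s)]
        · rw [starDist, if_pos rfl, abs_le]
          rcases min_cases t (w - s) with ⟨e, _⟩ | ⟨e, _⟩ <;> rw [e] <;> constructor <;> linarith
      · refine build i hi (s - w) (by linarith) (by linarith) ?_ ?_
        · rw [starDist, if_pos rfl, abs_le]; constructor <;> linarith
        · rw [starDist, if_neg hij]; linarith

end EmbeddedTree

/-- The legs, offsets and radii describe `G`: vertices are adjacent if and only if the distance of
their centers is at most the sum of their radii. -/
def RepresentsOnStar {V I : Type*} (G : SimpleGraph V) (leg : V → I) (offset radius : V → ℝ) :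
    Prop :=
  open Classical in
  ∀ u v, u ≠ v → (G.Adj u v ↔
    EmbeddedTree.starDist (leg u) (leg v) (offset u) (offset v) ≤ radius u + radius v)

theorem NeSModel.representsOnStar {V N : Type*} {G : SimpleGraph V} (M : NeSModel G N)
    (hM : M.tree.IsStar) : ∃ (leg : V → N) (offset radius : V → ℝ),
      (∀ v, 0 ≤ offset v) ∧ (∀ v, 0 ≤ radius v) ∧ RepresentsOnStar G leg offset radius := by
  classical
  obtain ⟨c, hc⟩ := hM
  choose leg h1 s h2 h3 h4 using
    fun v => M.tree.exists_leg_of_mem_points hc (M.center_mem v)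
  refine ⟨leg, s, fun v => M.radius v, h2, fun v => by positivity, fun u v huv => ?_⟩
  rw [M.adj_iff u v huv, h4 u, h4 v, M.tree.neighborhoodSubtree_inter_nonempty_iff hc (h1 u) (h1 v)
    (h2 u) (h3 u) (h2 v) (h3 v)]

/-- A vector in the direction of the `i`-th leg. -/
def legDirection (i : ℕ) : Plane := !₂[1, (i : ℝ)]

theorem legDirection_ne_zero (i : ℕ) : legDirection i ≠ 0 := fun h => by
  simpa [legDirection] using congrArg (fun p : Plane => p 0) h

theorem smul_legDirection_inj {i j : ℕ} {s t : ℝ}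
    (h : s • legDirection i = t • legDirection j) : s = t ∧ (i = j ∨ s = 0) := by
  have h0 := congrArg (fun p : Plane => p 0) h
  have h1 := congrArg (fun p : Plane => p 1) h
  simp only [legDirection, PiLp.smul_apply, smul_eq_mul] at h0 h1
  simp at h0 h1
  subst h0
  refine ⟨rfl, ?_⟩
  rcases mul_eq_mul_left_iff.1 h1 with h1 | h1
  · exact .inl (by exact_mod_cast h1)
  · exact .inr h1

/-- The star with center `0` and legs of the given lengths. -/
noncomputable def embeddedStar {m : ℕ} (length : Fin m → ℚ≥0) (hpos : ∀ i, 0 < length i) :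
    EmbeddedTree (Fin (m + 1)) where
  graph := SimpleGraph.starGraph 0
  isTree := SimpleGraph.isTree_starGraph 0
  pos := Fin.cons 0 fun i => ((length i : ℝ) / ‖legDirection i‖) • legDirection i
  pos_injective := by
    have h0 : ∀ i : Fin m, (length i : ℝ) / ‖legDirection i‖ ≠ 0 := fun i => by
      have := hpos i
      have := norm_pos_iff.2 (legDirection_ne_zero i)
      positivity
    rw [Fin.cons_injective_iff]
    refine ⟨?_, fun i j h => ?_⟩
    · rintro ⟨i, h⟩
      rcases smul_eq_zero.1 h with h | h
      · exact h0 i h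
      · exact legDirection_ne_zero _ h
    · exact Fin.ext ((smul_legDirection_inj h).2.resolve_right (h0 i))
  segments_inter := by
    have key : ∀ i j : Fin m, i ≠ j → ∀ p, p ∈ segment ℝ (0 : Plane)
        (((length i : ℝ) / ‖legDirection i‖) • legDirection i) →
        p ∈ segment ℝ (0 : Plane) (((length j : ℝ) / ‖legDirection j‖) • legDirection j) →
        p = 0 := by
      intro i j hij p hi hj
      rw [segment_eq_image_lineMap] at hi hj
      obtain ⟨s, -, rfl⟩ := hi
      obtain ⟨t, -, h⟩ := hj
      simp only [AffineMap.lineMap_apply, vsub_eq_sub, sub_zero, vadd_eq_add, add_zero,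
        smul_smul] at h ⊢
      have := (smul_legDirection_inj h.symm).2.resolve_left fun h => hij (Fin.ext h)
      rw [this, zero_smul]
    have hform : ∀ a b : Fin (m + 1), (SimpleGraph.starGraph (0 : Fin (m + 1))).Adj a b →
        ∃ i : Fin m, s(a, b) = s(0, i.succ) := by
      intro a b h
      rw [SimpleGraph.starGraph_adj] at h
      obtain ⟨hne, rfl | rfl⟩ := h
      · obtain ⟨i, rfl⟩ := Fin.exists_succ_eq.2 hne.symm
        exact ⟨i, rfl⟩
      · obtain ⟨i, rfl⟩ := Fin.exists_succ_eq.2 hne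
        exact ⟨i, Sym2.eq_swap⟩
    have hseg : ∀ {a b a' b' : Fin (m + 1)} (f : Fin (m + 1) → Plane), s(a, b) = s(a', b') →
        segment ℝ (f a) (f b) = segment ℝ (f a') (f b') := by
      intro a b a' b' f h
      rcases Sym2.eq_iff.1 h with ⟨rfl, rfl⟩ | ⟨rfl, rfl⟩
      · rfl
      · exact segment_symm _ _ _
    intro a b c d hab hcd hne p hp
    obtain ⟨i, hi⟩ := hform a b hab
    obtain ⟨j, hj⟩ := hform c d hcd
    refine ⟨0, by simp [hi], by simp [hj], ?_⟩
    rw [hseg _ hi, hseg _ hj] at hp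
    simp only [Fin.cons_zero, Fin.cons_succ] at hp ⊢
    exact key i j (fun h => hne (by rw [hi, hj, h])) p hp.1 hp.2

theorem exists_neSModel {V : Type*} {G : SimpleGraph V} {m : ℕ} (length : Fin m → ℚ≥0)
    (hpos : ∀ i, 0 < length i) (leg : V → Fin m) (offset radius : V → ℚ≥0)
    (hle : ∀ v, offset v ≤ length (leg v))
    (h : RepresentsOnStar G leg (fun v => (offset v : ℝ)) fun v => (radius v : ℝ)) :
    ∃ M : NeSModel G (Fin (m + 1)), M.tree.IsStar ∧
      (∀ i : Fin m, M.tree.graph.Adj 0 i.succ) ∧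
      (∀ i : Fin m, dist (M.tree.pos 0) (M.tree.pos i.succ) = (length i : ℝ)) ∧
      (∀ v, M.center v ∈ segment ℝ (M.tree.pos 0) (M.tree.pos (leg v).succ)) ∧
      (∀ v, dist (M.tree.pos 0) (M.center v) = (offset v : ℝ)) ∧
      ∀ v, M.radius v = radius v := by
  classical
  set T := embeddedStar length hpos with hT
  have hc : ∀ v, v ≠ 0 → T.graph.Adj 0 v := fun v hv => SimpleGraph.starGraph_center_adj hv.symm
  have hlen : ∀ i : Fin m, T.legLength 0 i.succ = length i := by
    intro i
    have h0 := norm_pos_iff.2 (legDirection_ne_zero i)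
    rw [EmbeddedTree.legLength, hT, embeddedStar]
    simp only [Fin.cons_zero, Fin.cons_succ]
    rw [dist_zero_left, norm_smul, norm_div, norm_norm, div_mul_cancel₀ _ h0.ne']
    simp
  have hne : ∀ i : Fin m, i.succ ≠ 0 := Fin.succ_ne_zero
  have hle' : ∀ v, (offset v : ℝ) ≤ T.legLength 0 (leg v).succ := fun v => by
    rw [hlen]; exact_mod_cast hle v
  have h0 : ∀ v, (0 : ℝ) ≤ offset v := fun v => by positivity
  have hmem : ∀ v, T.legPoint 0 (leg v).succ (offset v) ∈
      segment ℝ (T.pos 0) (T.pos (leg v).succ) := fun v => T.legPoint_mem (hne _) (h0 v) (hle' v)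
  refine ⟨⟨T, fun v => T.legPoint 0 (leg v).succ (offset v), radius,
    fun v => ⟨0, _, hc _ (hne _), hmem v⟩, fun u v huv => ?_⟩, ⟨0, hc⟩, fun i => hc _ (hne i), hlen,
    hmem, fun v => ?_, fun v => rfl⟩
  · rw [T.neighborhoodSubtree_inter_nonempty_iff hc (hne _) (hne _) (h0 u) (hle' u) (h0 v) (hle' v),
      h u v huv]
    simp only [EmbeddedTree.starDist, Fin.succ_inj]
  · have := T.dist_legPoint (hne (leg v)) 0 (offset v)
    rwa [EmbeddedTree.legPoint_zero, zero_sub, abs_neg, abs_of_nonneg (h0 v)] at this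

/-! ### From star models to good partitions -/

theorem maximal_isClique_iff {V : Type*} {G : SimpleGraph V} {X : Set V} :
    Maximal G.IsClique X ↔ G.IsClique X ∧ ∀ v ∉ X, ∃ x ∈ X, ¬G.Adj x v := by
  refine ⟨fun h => ⟨h.prop, fun v hv => ?_⟩, fun h => ⟨h.1, fun Y hY hXY v hv => ?_⟩⟩
  · by_contra! hn
    refine hv (h.le_of_ge (y := insert v X) ?_ (Set.subset_insert _ _) (Set.mem_insert _ _))
    exact h.prop.insert fun b hb _ => (hn b hb).symm
  · by_contra hvX
    obtain ⟨x, hx, hn⟩ := h.2 v hvX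
    exact hn (hY (hXY hx) hv fun e => hvX (e ▸ hx))

theorem isXInterval_of_intervals {W : Type*} [Finite W] {H : SimpleGraph W} {l r : W → ℝ}
    (hlr : ∀ w, l w ≤ r w) (h0 : ∀ w, 0 ≤ l w)
    (hadj : ∀ u v, u ≠ v → (H.Adj u v ↔ l u ≤ r v ∧ l v ≤ r u))
    (hX : Maximal H.IsClique {w | l w = 0}) : IsXInterval H {w | l w = 0} := by
  classical
  refine ⟨hX, ?_⟩
  set X : Set W := {w | l w = 0} with hXdef
  set cliqueAt : ℝ → Set W := fun q => {w | l w ≤ q ∧ q ≤ r w} with hcl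
  have hcl0 : cliqueAt 0 = X := by
    ext w
    simp only [hcl, hXdef, Set.mem_ofPred_eq]
    exact ⟨fun h => le_antisymm h.1 (h0 w), fun h => ⟨h.le, (h0 w).trans (hlr w)⟩⟩
  have hcq : ∀ q, H.IsClique (cliqueAt q) := fun q u hu v hv huv =>
    (hadj u v huv).2 ⟨hu.1.trans hv.2, hv.1.trans hu.2⟩
  have hex : ∀ K : Set W, ∃ q, Maximal H.IsClique K → K ≠ X → 0 < q ∧ K = cliqueAt q := by
    intro K
    by_cases hK : Maximal H.IsClique K ∧ K ≠ X
    swap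
    · exact ⟨0, fun h h' => absurd ⟨h, h'⟩ hK⟩
    obtain ⟨hK, hne⟩ := hK
    have hnX : ¬K ⊆ X := fun h => hne (hK.eq_of_subset hX.prop h)
    obtain ⟨k, hk, hkX⟩ := Set.not_subset.1 hnX
    -- The largest left end in `K` lies in all intervals of `K`; it is positive because `K` is not
    -- contained in `X`.
    obtain ⟨m, hm, hmax⟩ := Set.exists_max_image K l K.toFinite ⟨k, hk⟩
    refine ⟨l m, fun _ _ => ⟨?_, ?_⟩⟩
    · have h1 : 0 < l k := lt_of_le_of_ne (h0 k) (Ne.symm hkX)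
      exact h1.trans_le (hmax k hk)
    · refine hK.eq_of_subset (hcq _) fun w hw => ⟨hmax w hw, ?_⟩
      by_cases hwm : w = m
      · exact hwm ▸ hlr w
      · exact ((hadj w m hwm).1 (hK.prop hw hm hwm)).2
  choose q hq using hex
  set S : Finset ℝ := ((Set.toFinite {K : Set W | Maximal H.IsClique K ∧ K ≠ X}).toFinset).image q
    with hS
  have hmemS : ∀ x, x ∈ S ↔ ∃ K, (Maximal H.IsClique K ∧ K ≠ X) ∧ q K = x := by
    intro x; simp [hS]
  have hSinj : ∀ K, Maximal H.IsClique K → K ≠ X → cliqueAt (q K) = K := fun K h1 h2 =>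
    (hq K h1 h2).2.symm
  set Q : List ℝ := S.sort (· ≥ ·) ++ [0] with hQ
  have hQs : Q.Pairwise (· ≥ ·) := by
    rw [hQ, List.pairwise_append]
    refine ⟨Finset.pairwise_sort _ _, List.pairwise_singleton _ _, ?_⟩
    intro a ha b hb
    rw [Finset.mem_sort, hmemS] at ha
    obtain ⟨K, hK, rfl⟩ := ha
    rw [List.mem_singleton.1 hb]
    exact (hq K hK.1 hK.2).1.le
  refine ⟨(S.sort (· ≥ ·)).map cliqueAt, ?_⟩
  have hL : (S.sort (· ≥ ·)).map cliqueAt ++ [X] = Q.map cliqueAt := by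
    rw [hQ, List.map_append, List.map_singleton, hcl0]
  refine ⟨?_, fun K => ?_, ?_⟩
  · rw [List.nodup_append]
    refine ⟨(List.nodup_map_iff_inj_on (Finset.sort_nodup _ _)).2 ?_, List.nodup_singleton _, ?_⟩
    · intro a ha b hb hab
      rw [Finset.mem_sort, hmemS] at ha hb
      obtain ⟨K, hK, rfl⟩ := ha
      obtain ⟨K', hK', rfl⟩ := hb
      rw [hSinj K hK.1 hK.2, hSinj K' hK'.1 hK'.2] at hab
      rw [hab]
    · intro a ha b hb
      rw [List.mem_singleton.1 hb]
      obtain ⟨x, hx, rfl⟩ := List.mem_map.1 ha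
      rw [Finset.mem_sort, hmemS] at hx
      obtain ⟨K, hK, rfl⟩ := hx
      rw [hSinj K hK.1 hK.2]
      exact hK.2
  · simp only [List.mem_append, List.mem_map, Finset.mem_sort, hmemS, List.mem_singleton]
    constructor
    · rintro (⟨x, ⟨K', hK', rfl⟩, rfl⟩ | rfl)
      · rw [hSinj K' hK'.1 hK'.2]; exact hK'.1
      · exact hX
    · intro hK
      by_cases hKX : K = X
      · exact .inr hKX
      · exact .inl ⟨_, ⟨K, ⟨hK, hKX⟩, rfl⟩, hSinj K hK hKX⟩
  · rw [hL]
    intro i j k v hij hjk hi hk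
    simp only [List.get_eq_getElem, List.getElem_map] at hi hk ⊢
    have hm : ∀ {a b : ℕ} (ha : a < Q.length) (hb : b < Q.length), a ≤ b → Q[b] ≤ Q[a] := by
      intro a b ha hb hab
      rcases hab.eq_or_lt with rfl | hab
      · exact le_rfl
      · exact List.pairwise_iff_getElem.1 hQs a b ha hb hab
    have hlen : ∀ a : Fin (Q.map cliqueAt).length, (a : ℕ) < Q.length := fun a =>
      by simpa using a.2
    exact ⟨hk.1.trans (hm (hlen j) (hlen k) hjk), (hm (hlen i) (hlen j) hij).trans hi.2⟩

/-- Vertices are represented by subtrees of a star: the subtree of `v` has its center on the leg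
`leg v`, on which it covers the points between `a v` and `b v`, and it reaches to distance `-a v` on
the other legs. -/
structure IsIntervalStar {V I : Type*} (G : SimpleGraph V) (leg : V → I) (a b : V → ℝ) : Prop where
  le : ∀ v, a v ≤ b v
  neg_le : ∀ v, -a v ≤ b v
  adj_same : ∀ {u v}, u ≠ v → leg u = leg v → (G.Adj u v ↔ a u ≤ b v ∧ a v ≤ b u)
  adj_ne : ∀ {u v}, u ≠ v → leg u ≠ leg v → (G.Adj u v ↔ a u + a v ≤ 0)

/-- The condition that the distance of two centers is at most the sum of the radii, sorted by
whether the legs agree. -/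
theorem RepresentsOnStar.isIntervalStar {V I : Type*} {G : SimpleGraph V} {leg : V → I}
    {o w : V → ℝ} (h : RepresentsOnStar G leg o w) (ho : ∀ v, 0 ≤ o v) (hw : ∀ v, 0 ≤ w v) :
    IsIntervalStar G leg (fun v => o v - w v) fun v => o v + w v where
  le v := by linarith [hw v]
  neg_le v := by linarith [ho v]
  adj_same {u v} huv hl := by
    classical
    rw [h u v huv, EmbeddedTree.starDist, if_pos hl, abs_le]
    constructor <;> rintro ⟨h1, h2⟩ <;> constructor <;> linarith
  adj_ne {u v} huv hl := by
    classical
    rw [h u v huv, EmbeddedTree.starDist, if_neg hl]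
    constructor <;> intro h1 <;> linarith

namespace IsIntervalStar

variable {V I : Type*} {G : SimpleGraph V} {leg : V → I} {a b : V → ℝ}

theorem nonneg (h : IsIntervalStar G leg a b) (v : V) : 0 ≤ b v := by
  linarith [h.le v, h.neg_le v]

theorem isClique (h : IsIntervalStar G leg a b) : G.IsClique {v | a v ≤ 0} := by
  intro u hu v hv huv
  simp only [Set.mem_ofPred_eq] at hu hv
  by_cases hl : leg u = leg v
  · exact (h.adj_same huv hl).2 ⟨hu.trans (h.nonneg v), hv.trans (h.nonneg u)⟩
  · exact (h.adj_ne huv hl).2 (by linarith)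

/-- Stretching `v` to the center could create an adjacency only with some `u` on its leg with `b u <
a v`. A clique vertex is adjacent to `v`, so it ends no earlier than `a v`. If `u` misses the
center, every clique vertex meets `u` on its way to `v`, so `u` competes with `v` and the minimality
of `b v` gives `b v ≤ b u`. -/
theorem update [DecidableEq V] (h : IsIntervalStar G leg a b) {v : V} (hv : 0 < a v)
    (hadj : ∀ u, a u ≤ 0 → G.Adj u v)
    (hmin : ∀ u, 0 < a u → (∀ w, a w ≤ 0 → G.Adj w u) → b v ≤ b u) :
    IsIntervalStar G leg (Function.update a v 0) b := by
  have hsame : ∀ {u}, u ≠ v → leg u = leg v → (G.Adj u v ↔ a u ≤ b v ∧ 0 ≤ b u) := by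
    intro u huv hl
    rw [h.adj_same huv hl]
    refine ⟨fun h' => ⟨h'.1, h.nonneg u⟩, fun h' => ⟨h'.1, ?_⟩⟩
    by_contra! hlt
    rcases le_or_gt (a u) 0 with hu | hu
    · exact absurd ((h.adj_same huv hl).1 (hadj u hu)).2 (not_le.2 hlt)
    · have := hmin u hu fun w hw => by
        have hwu : w ≠ u := fun e => by subst e; linarith
        have hwv : w ≠ v := fun e => by subst e; linarith
        by_cases hlw : leg w = leg v
        · have h1 := (h.adj_same hwv hlw).1 (hadj w hw)
          exact (h.adj_same hwu (hlw.trans hl.symm)).2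
            ⟨hw.trans (h.nonneg u), by linarith [h.le u]⟩
        · have h1 := (h.adj_ne hwv hlw).1 (hadj w hw)
          exact (h.adj_ne hwu (by rwa [hl])).2 (by linarith [h.le u])
      linarith [h.le v]
  have hne : ∀ {u}, u ≠ v → leg u ≠ leg v → (G.Adj u v ↔ a u + 0 ≤ 0) := by
    intro u huv hl
    refine ⟨fun h' => ?_, fun h' => hadj u (by linarith)⟩
    linarith [(h.adj_ne huv hl).1 h']
  refine ⟨fun u => ?_, fun u => ?_, fun {u w} huw hl => ?_, fun {u w} huw hl => ?_⟩
  · rcases eq_or_ne u v with rfl | hu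
    · simpa using h.nonneg u
    · simpa [hu] using h.le u
  · rcases eq_or_ne u v with rfl | hu
    · simpa using h.nonneg u
    · simpa [hu] using h.neg_le u
  · rcases eq_or_ne u v with rfl | hu
    · rw [G.adj_comm, hsame huw.symm hl.symm]
      simp [huw.symm, and_comm]
    · rcases eq_or_ne w v with rfl | hw
      · rw [hsame huw hl]; simp [hu]
      · rw [h.adj_same huw hl]; simp [hu, hw]
  · rcases eq_or_ne u v with rfl | hu
    · rw [G.adj_comm, hne huw.symm hl.symm]
      simp [huw.symm]
    · rcases eq_or_ne w v with rfl | hw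
      · rw [hne huw hl]; simp [hu]
      · rw [h.adj_ne huw hl]; simp [hu, hw]

/-- If the central clique is not maximal, some vertex outside is adjacent to all of it. The one with
the smallest right end is pulled in, and fewer vertices miss the center. -/
theorem exists_maximal [Fintype V] [DecidableEq V] (h : IsIntervalStar G leg a b) :
    ∃ a', IsIntervalStar G leg a' b ∧ Maximal G.IsClique {v | a' v ≤ 0} := by
  classical
  generalize hN : (Finset.univ.filter fun v => 0 < a v).card = N
  induction N using Nat.strong_induction_on generalizing a with
  | _ N ih =>
    by_cases hmax : Maximal G.IsClique {v | a v ≤ 0}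
    · exact ⟨a, h, hmax⟩
    rw [maximal_isClique_iff] at hmax
    have hex : ∃ v, 0 < a v ∧ ∀ u, a u ≤ 0 → G.Adj u v := by
      by_contra! hn
      refine hmax ⟨h.isClique, fun v hv => ?_⟩
      obtain ⟨u, hu, hn⟩ := hn v (not_le.1 hv)
      exact ⟨u, hu, hn⟩
    obtain ⟨v, ⟨hv, hadj⟩, hmin⟩ := Set.exists_min_image
      {v | 0 < a v ∧ ∀ u, a u ≤ 0 → G.Adj u v} b (Set.toFinite _) hex
    refine ih _ ?_ (h.update hv hadj fun u hu hu' => hmin u ⟨hu, hu'⟩) rfl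
    rw [← hN]
    refine Finset.card_lt_card ⟨fun u hu => ?_, fun hs => ?_⟩
    · simp only [Finset.mem_filter, Finset.mem_univ, true_and] at hu ⊢
      rcases eq_or_ne u v with rfl | huv
      · simp at hu
      · simpa [huv] using hu
    · have := hs (Finset.mem_filter.2 ⟨Finset.mem_univ v, hv⟩)
      simp at this

/-- The intervals are the traces on leg `i`, cut off at the center. A clique vertex centered on
another leg covers this leg up to `-a v`. -/
theorem isXInterval_induce [Finite V] (h : IsIntervalStar G leg a b)
    (hmax : Maximal G.IsClique {v | a v ≤ 0}) (i : I) {S : Set V}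
    (hS : ∀ v ∈ S, a v ≤ 0 ∨ leg v = i) (hXS : ∀ v, a v ≤ 0 → v ∈ S) :
    IsXInterval (G.induce S) {v | a v ≤ 0} := by
  classical
  have hset : {v : S | a v ≤ 0} = {v : S | max (a v) 0 = 0} := by
    ext v; simp
  rw [hset]
  refine isXInterval_of_intervals (l := fun v : S => max (a v) 0)
    (r := fun v : S => if a v ≤ 0 ∧ leg v ≠ i then -a v else b v) ?_ (fun _ => le_max_right _ _)
    ?_ ?_
  · intro v
    have := h.nonneg v
    have := h.le v
    split_ifs with h1
    · exact max_le (by linarith [h1.1]) (by linarith [h1.1])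
    · exact max_le (by linarith) (by linarith)
  · have key : ∀ u v : S, u ≠ v → 0 < a v → (G.Adj u v ↔ max (a u) 0 ≤ b v ∧
        a v ≤ if a u ≤ 0 ∧ leg u ≠ i then -a u else b u) := by
      intro u v huv hv
      have huv' : (u : V) ≠ v := fun e => huv (Subtype.ext e)
      have hlv : leg v = i := (hS v v.2).resolve_left (not_le.2 hv)
      have h1 := h.nonneg v
      rcases le_or_gt (a u) 0 with hu | hu
      · rw [max_eq_right hu]
        by_cases hl : leg u = i
        · rw [if_neg (by simp [hl]), h.adj_same huv' (hl.trans hlv.symm)]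
          exact and_congr_left' ⟨fun _ => h1, fun _ => hu.trans h1⟩
        · rw [if_pos ⟨hu, hl⟩, h.adj_ne huv' (by rwa [hlv])]
          exact ⟨fun h' => ⟨h1, by linarith⟩, fun h' => by linarith [h'.2]⟩
      · have hlu : leg u = i := (hS u u.2).resolve_left (not_le.2 hu)
        rw [max_eq_left hu.le, if_neg fun h' => absurd h'.1 (not_le.2 hu),
          h.adj_same huv' (hlu.trans hlv.symm)]
    intro u v huv
    rw [SimpleGraph.induce_adj]
    rcases le_or_gt (a v) 0 with hv | hv
    · rcases le_or_gt (a u) 0 with hu | hu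
      · have hr : ∀ w : S, a w ≤ 0 → 0 ≤ if a w ≤ 0 ∧ leg w ≠ i then -a w else b w := by
          intro w hw
          split_ifs
          · linarith
          · exact h.nonneg w
        rw [max_eq_right hu, max_eq_right hv]
        exact ⟨fun _ => ⟨hr v hv, hr u hu⟩,
          fun _ => h.isClique hu hv fun e => huv (Subtype.ext e)⟩
      · have := key v u huv.symm hu
        rw [G.adj_comm, this, max_eq_left hu.le, if_neg (c := a u ≤ 0 ∧ leg u ≠ i)
          (fun h' => absurd h'.1 (not_le.2 hu)),
          and_comm]
    · rw [key u v huv hv, max_eq_left hv.le, if_neg (c := a v ≤ 0 ∧ leg v ≠ i)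
        (fun h' => absurd h'.1 (not_le.2 hv))]
  · rw [← hset]
    rw [maximal_isClique_iff] at hmax ⊢
    refine ⟨fun u hu v hv huv => hmax.1 hu hv fun e => huv (Subtype.ext e), fun v hv => ?_⟩
    obtain ⟨x, hx, hn⟩ := hmax.2 v hv
    exact ⟨⟨x, hXS x hx⟩, hx, hn⟩

/-- Subtrees missing the center on different legs are disjoint, so components of `G - X` stay on one
leg. On a leg other than its own, a clique vertex sees precisely the block vertices up to its reach
`-a`. Ordering `X` by decreasing `a` therefore makes these neighborhoods grow. -/
theorem hasGoodPartition [Fintype V] [DecidableEq V] (h : IsIntervalStar G leg a b) :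
    HasGoodPartition G := by
  classical
  obtain ⟨a, h, hmax⟩ := h.exists_maximal
  set X : Finset V := Finset.univ.filter fun v => a v ≤ 0 with hX
  have hmX : ∀ v, v ∈ X ↔ a v ≤ 0 := fun v => by simp [hX]
  have hXs : (X : Set V) = {v | a v ≤ 0} := by ext v; simp [hmX]
  set 𝓑 : Finpartition Xᶜ := Finpartition.ofSetSetoid (Setoid.comap leg ⊥) Xᶜ with h𝓑
  have hparts : ∀ B, B ∈ 𝓑.parts ↔ ∃ w, 0 < a w ∧ B = Xᶜ.filter fun v => leg w = leg v := by
    intro B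
    rw [h𝓑, Finpartition.ofSetSetoid_parts, Finset.mem_image]
    simp only [Finset.mem_compl, hmX, not_le]
    refine exists_congr fun w => and_congr_right fun _ => eq_comm.trans (Eq.congr_right ?_)
    ext v
    simp
  have hpos : ∀ {B v}, B ∈ 𝓑.parts → v ∈ B → 0 < a v := by
    intro B v hB hv
    obtain ⟨w, -, rfl⟩ := (hparts B).1 hB
    have := (Finset.mem_filter.1 hv).1
    simpa [hmX] using this
  have hsame : ∀ {B B' v v'}, B ∈ 𝓑.parts → B' ∈ 𝓑.parts → v ∈ B → v' ∈ B' → leg v = leg v' →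
      B = B' := by
    intro B B' v v' hB hB' hv hv' hl
    obtain ⟨w, -, rfl⟩ := (hparts B).1 hB
    obtain ⟨w', -, rfl⟩ := (hparts B').1 hB'
    rw [(Finset.mem_filter.1 hv).2, (Finset.mem_filter.1 hv').2, hl]
  refine ⟨X, 𝓑, hXs ▸ hmax, fun C => ?_, fun B hB => ?_, ?_⟩
  · obtain ⟨v, rfl⟩ := C.exists_rep
    have hcomp : ∀ w : ((X : Set V)ᶜ : Set V), 0 < a w := fun w =>
      not_le.1 fun h' => w.2 ((hmX _).2 h')
    refine ⟨_, (hparts _).2 ⟨v, hcomp v, rfl⟩, fun w hw => ?_⟩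
    rw [Finset.mem_filter, Finset.mem_compl, hmX, not_le]
    refine ⟨hcomp w, ?_⟩
    obtain ⟨p⟩ := SimpleGraph.ConnectedComponent.exact hw
    clear hw
    induction p with
    | nil => rfl
    | @cons u x y hux _ ih =>
      rw [ih]
      by_contra hl
      have h1 := (h.adj_ne (fun e => hux.ne (Subtype.ext e)) (Ne.symm hl)).1 hux
      linarith [hcomp u, hcomp x]
  · obtain ⟨w, -, rfl⟩ := (hparts B).1 hB
    have := h.isXInterval_induce hmax (leg w)
      (S := (X : Set V) ∪ (Xᶜ.filter fun v => leg w = leg v : Finset V)) (fun v hv => ?_)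
      fun v hv => .inl ((hmX v).2 hv)
    · simpa only [hmX] using this
    · rcases hv with hv | hv
      · exact .inl ((hmX v).1 hv)
      · exact .inr (Finset.mem_filter.1 hv).2.symm
  · set l := X.toList.insertionSort fun x y => a y ≤ a x with hl
    have : Std.Total fun x y : V => a y ≤ a x := ⟨fun x y => le_total (a y) (a x)⟩
    have : IsTrans V fun x y : V => a y ≤ a x := ⟨fun x y z h1 h2 => h2.trans h1⟩
    have hsorted : l.Pairwise fun x y => a y ≤ a x := List.pairwise_insertionSort _ _
    have hmem : ∀ x, x ∈ l ↔ x ∈ X := fun x => by simp [hl, List.mem_insertionSort]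
    refine ⟨l, (List.perm_insertionSort _ _).nodup_iff.2 X.nodup_toList, ?_, fun i => ⟨?_, ?_⟩⟩
    · ext x; simp [hmem]
    · rw [List.mem_toFinset, List.drop_eq_getElem_cons i.2]
      exact List.mem_cons_self
    · have hx : a (l.get i) ≤ 0 := (hmX _).1 ((hmem _).1 (List.get_mem l i))
      have hle : ∀ y ∈ (l.drop i).toFinset, a y ≤ a (l.get i) ∧ a y ≤ 0 := by
        intro y hy
        rw [List.mem_toFinset] at hy
        refine ⟨?_, (hmX _).1 ((hmem _).1 (List.mem_of_mem_drop hy))⟩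
        rw [List.drop_eq_getElem_cons i.2] at hy
        rcases List.mem_cons.1 hy with rfl | hy'
        · exact le_rfl
        · have h2 := hsorted.sublist (List.drop_sublist i l)
          rw [List.drop_eq_getElem_cons i.2, List.pairwise_cons] at h2
          exact h2.1 y hy'
      have hnot : ∀ B ∈ 𝓑.parts, ¬MinimalInBlock G (l.get i) B (l.drop i).toFinset →
          ∃ v ∈ B, leg (l.get i) = leg v := by
        intro B hB hn
        simp only [MinimalInBlock, not_forall] at hn
        obtain ⟨y, hy, hn⟩ := hn
        obtain ⟨v, ⟨hv, hvB⟩, hny⟩ := Set.not_subset.1 hn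
        refine ⟨v, hvB, ?_⟩
        by_contra hlv
        have hv0 := hpos hB hvB
        have h1 := (h.adj_ne hv.ne hlv).1 hv
        have h2 := hle y hy
        have hyv : y ≠ v := fun e => by subst e; linarith
        refine hny ?_
        -- The later vertex `y` reaches at least as far as `x`; on its own leg this remains true
        -- because `-a y ≤ b y`.
        by_cases hl2 : leg y = leg v
        · exact (h.adj_same hyv hl2).2
            ⟨h2.2.trans (h.nonneg v), by linarith [h.neg_le y]⟩
        · exact (h.adj_ne hyv hl2).2 (by linarith)
      rw [← Finset.card_filter_add_card_filter_not
        (fun B => MinimalInBlock G (l.get i) B (l.drop i).toFinset)]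
      refine Nat.add_le_add_left (Finset.card_le_one.2 fun B hB B' hB' => ?_) _
      rw [Finset.mem_filter] at hB hB'
      obtain ⟨v, hv, e⟩ := hnot B hB.1 hB.2
      obtain ⟨v', hv', e'⟩ := hnot B' hB'.1 hB'.2
      exact hsame hB.1 hB'.1 hv hv' (e.symm.trans e')

end IsIntervalStar

/-! ### From good partitions to star models -/

/-- A vertex becomes the range of indices of its cliques. An edge lies in some maximal clique;
conversely, overlapping ranges share the index `max (lo u) (lo v)`. Counting from the end of the
path puts `X` at 0. -/
theorem IsXInterval.exists_intervals {W : Type*} [Finite W] {H : SimpleGraph W} {X : Set W}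
    (h : IsXInterval H X) : ∃ l r : W → ℕ, (∀ w, l w ≤ r w) ∧
      (∀ u v, u ≠ v → (H.Adj u v ↔ l u ≤ r v ∧ l v ≤ r u)) ∧ ∀ x ∈ X, l x = 0 := by
  obtain ⟨-, L, hL⟩ := h
  set Q := L ++ [X] with hQ
  have hcover : ∀ A : Set W, H.IsClique A → ∃ i : Fin Q.length, A ⊆ Q.get i := by
    intro A hA
    obtain ⟨K, hK, hKm⟩ := Set.Finite.exists_le_maximal (Set.toFinite {A | H.IsClique A}) hA
    obtain ⟨i, hi⟩ := List.get_of_mem ((hL.mem_iff K).2 hKm)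
    exact ⟨i, hi ▸ hK⟩
  have hcl : ∀ i : Fin Q.length, H.IsClique (Q.get i) := fun i =>
    ((hL.mem_iff _).1 (List.get_mem Q i)).prop
  have hne : ∀ w, ({i : Fin Q.length | w ∈ Q.get i} : Set _).Nonempty := fun w => by
    obtain ⟨i, hi⟩ := hcover {w} (by simp)
    exact ⟨i, hi rfl⟩
  choose lo hlo hlo' using fun w => Set.exists_min_image _ id (Set.toFinite _) (hne w)
  choose hi hhi hhi' using fun w => Set.exists_max_image _ id (Set.toFinite _) (hne w)
  simp only [Set.mem_ofPred_eq, id_eq] at hlo hlo' hhi hhi'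
  have hlen : Q.length = L.length + 1 := by simp [hQ]
  refine ⟨fun w => L.length - hi w, fun w => L.length - lo w, fun w => ?_, fun u v huv => ?_,
    fun x hx => ?_⟩
  · have := hlo' w _ (hhi w)
    exact Nat.sub_le_sub_left this _
  · have h1 := (hi u).2
    have h2 := (hi v).2
    have h3 : H.Adj u v ↔ lo u ≤ hi v ∧ lo v ≤ hi u := by
      constructor
      · intro hadj
        obtain ⟨i, hi⟩ := hcover {u, v} (by
          rw [SimpleGraph.isClique_pair]; exact fun _ => hadj)
        have hu := hi (Set.mem_insert _ _)
        have hv := hi (Set.mem_insert_of_mem _ rfl)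
        exact ⟨(hlo' u i hu).trans (hhi' v i hv), (hlo' v i hv).trans (hhi' u i hu)⟩
      · rintro ⟨h4, h5⟩
        have hu : u ∈ Q.get (max (lo u) (lo v)) := hL.consecutive (lo u) _ (hi u) u
          (le_max_left _ _) (max_le (hlo' u _ (hhi u)) h5) (hlo u) (hhi u)
        have hv : v ∈ Q.get (max (lo u) (lo v)) := hL.consecutive (lo v) _ (hi v) v
          (le_max_right _ _) (max_le h4 (hlo' v _ (hhi v))) (hlo v) (hhi v)
        exact hcl _ hu hv huv
    rw [h3, Fin.le_def, Fin.le_def]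
    dsimp only
    have h6 := (lo u).2
    have h7 := (lo v).2
    omega
  · have : x ∈ Q.get ⟨L.length, by omega⟩ := by simpa [hQ] using hx
    have := hhi' x _ this
    exact Nat.sub_eq_zero_of_le this

/-! ### Orienting the conflicts of a good partition -/

section GoodPartition

variable {V : Type*} [Fintype V] [DecidableEq V] {G : SimpleGraph V} {X : Finset V}
  {𝓑 : Finpartition Xᶜ}

/-- Distinct non-adjacent vertices in the union of the clique and a block, not both in the
clique. -/
def BlockConflict (G : SimpleGraph V) (X : Finset V) (𝓑 : Finpartition Xᶜ) (u v : V) : Prop :=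
  u ≠ v ∧ ¬G.Adj u v ∧ (u ∈ X ∨ v ∈ X ∨ ∃ B ∈ 𝓑.parts, u ∈ B ∧ v ∈ B)

theorem BlockConflict.symm {u v : V} (h : BlockConflict G X 𝓑 u v) : BlockConflict G X 𝓑 v u := by
  obtain ⟨h1, h2, h3⟩ := h
  refine ⟨h1.symm, fun h => h2 h.symm, ?_⟩
  rcases h3 with h3 | h3 | ⟨B, hB, h3, h4⟩
  · exact .inr (.inl h3)
  · exact .inl h3
  · exact .inr (.inr ⟨B, hB, h4, h3⟩)

theorem Finpartition.notMem_of_mem_compl_part {B : Finset V} (hB : B ∈ 𝓑.parts) {v : V}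
    (hv : v ∈ B) : v ∉ X :=
  Finset.mem_compl.1 (𝓑.le hB hv)

theorem Finpartition.exists_part_of_notMem (𝓑 : Finpartition Xᶜ) {v : V} (hv : v ∉ X) :
    ∃ B ∈ 𝓑.parts, v ∈ B :=
  𝓑.exists_mem (Finset.mem_compl.2 hv)

namespace IsGoodPartition

variable (hG : IsGoodPartition G X 𝓑)
include hG

theorem adj_of_mem {x y : V} (hx : x ∈ X) (hy : y ∈ X) (h : x ≠ y) : G.Adj x y :=
  hG.maximal_clique.prop hx hy h

theorem exists_not_adj {v : V} (hv : v ∉ X) : ∃ x ∈ X, ¬G.Adj x v :=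
  (maximal_isClique_iff.1 hG.maximal_clique).2 v hv

theorem exists_part_of_adj {u v : V} (hu : u ∉ X) (hv : v ∉ X) (h : G.Adj u v) :
    ∃ B ∈ 𝓑.parts, u ∈ B ∧ v ∈ B := by
  obtain ⟨B, hB, hC⟩ := hG.components_le
    ((G.induce ((X : Set V)ᶜ)).connectedComponentMk ⟨u, hu⟩)
  refine ⟨B, hB, hC ⟨u, hu⟩ rfl, hC ⟨v, hv⟩ ?_⟩
  rw [SimpleGraph.ConnectedComponent.mem_supp_iff, SimpleGraph.ConnectedComponent.eq]
  exact (SimpleGraph.Adj.reachable (by exact h : (G.induce ((X : Set V)ᶜ)).Adj ⟨u, hu⟩ ⟨v, hv⟩)).symm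

theorem exists_intervals {B : Finset V} (hB : B ∈ 𝓑.parts) : ∃ l r : V → ℕ,
    (∀ w, l w ≤ r w) ∧ (∀ u v, u ∈ X ∨ u ∈ B → v ∈ X ∨ v ∈ B → u ≠ v →
      (G.Adj u v ↔ l u ≤ r v ∧ l v ≤ r u)) ∧ ∀ x ∈ X, l x = 0 := by
  classical
  obtain ⟨l, r, h1, h2, h3⟩ := (hG.xInterval B hB).exists_intervals
  refine ⟨fun v => if h : v ∈ (X : Set V) ∪ (B : Set V) then l ⟨v, h⟩ else 0,
    fun v => if h : v ∈ (X : Set V) ∪ (B : Set V) then r ⟨v, h⟩ else 0, fun w => ?_,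
    fun u v hu hv huv => ?_, fun x hx => ?_⟩
  · dsimp only
    split_ifs
    · exact h1 _
    · exact le_rfl
  · have hu' : u ∈ (X : Set V) ∪ (B : Set V) := hu
    have hv' : v ∈ (X : Set V) ∪ (B : Set V) := hv
    dsimp only
    rw [dif_pos hu', dif_pos hu', dif_pos hv', dif_pos hv',
      ← h2 ⟨u, hu'⟩ ⟨v, hv'⟩ (fun e => huv (congrArg Subtype.val e)), SimpleGraph.induce_adj]
  · have hx' : x ∈ (X : Set V) ∪ (B : Set V) := .inl hx
    dsimp only
    rw [dif_pos hx']
    exact h3 _ hx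

/-- The orientation is precedence in the interval model of the block. Vertices of `X` have left end
0 and are never heads, so the head of an edge determines its block, and edges that can be composed
come from the same model. -/
theorem exists_isTransOrientation : ∃ P : V → V → Prop,
    IsTransOrientation (BlockConflict G X 𝓑) P ∧ ∀ {v x}, x ∈ X → ¬P v x := by
  have hex : ∀ B, ∃ l r : V → ℕ, B ∈ 𝓑.parts → (∀ w, l w ≤ r w) ∧
      (∀ u v, u ∈ X ∨ u ∈ B → v ∈ X ∨ v ∈ B → u ≠ v →
      (G.Adj u v ↔ l u ≤ r v ∧ l v ≤ r u)) ∧ ∀ x ∈ X, l x = 0 := by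
    intro B
    by_cases hB : B ∈ 𝓑.parts
    · obtain ⟨l, r, h⟩ := hG.exists_intervals hB
      exact ⟨l, r, fun _ => h⟩
    · exact ⟨fun _ => 0, fun _ => 0, fun h => absurd h hB⟩
  choose l r hlr using hex
  have hhead : ∀ {B u v}, B ∈ 𝓑.parts → (v ∈ X ∨ v ∈ B) → r B u < l B v → v ∈ B := by
    intro B u v hB hv hlt
    refine hv.resolve_left fun hx => ?_
    rw [(hlr B hB).2.2 v hx] at hlt
    omega
  refine ⟨fun u v => BlockConflict G X 𝓑 u v ∧ ∃ B ∈ 𝓑.parts, (u ∈ X ∨ u ∈ B) ∧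
    (v ∈ X ∨ v ∈ B) ∧ r B u < l B v, ⟨fun h => h.1, ?_, ?_, ?_⟩, ?_⟩
  · intro u v h
    have hB : ∃ B ∈ 𝓑.parts, (u ∈ X ∨ u ∈ B) ∧ (v ∈ X ∨ v ∈ B) := by
      by_cases hu : u ∈ X
      · by_cases hv : v ∈ X
        · exact absurd (hG.adj_of_mem hu hv h.1) h.2.1
        · obtain ⟨B, hB, hvB⟩ := 𝓑.exists_part_of_notMem hv
          exact ⟨B, hB, .inl hu, .inr hvB⟩
      · by_cases hv : v ∈ X
        · obtain ⟨B, hB, huB⟩ := 𝓑.exists_part_of_notMem hu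
          exact ⟨B, hB, .inr huB, .inl hv⟩
        · obtain ⟨B, hB, h1, h2⟩ := (h.2.2.resolve_left hu).resolve_left hv
          exact ⟨B, hB, .inr h1, .inr h2⟩
    obtain ⟨B, hB, hu, hv⟩ := hB
    have h1 := ((hlr B hB).2.1 u v hu hv h.1).not.1 h.2.1
    by_cases h2 : r B u < l B v
    · exact .inl ⟨h, B, hB, hu, hv, h2⟩
    · exact .inr ⟨h.symm, B, hB, hv, hu, by omega⟩
  · rintro u v ⟨-, B, hB, hu, hv, h1⟩ ⟨-, B', hB', hv', hu', h2⟩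
    have hvB := hhead hB hv h1
    have huB := hhead hB' hu' h2
    have huB2 : u ∈ B := hu.resolve_left (Finpartition.notMem_of_mem_compl_part hB' huB)
    obtain rfl := 𝓑.eq_of_mem_parts hB hB' huB2 huB
    have := (hlr B hB).1 u
    have := (hlr B hB).1 v
    omega
  · rintro u v w ⟨h0, B, hB, hu, hv, h1⟩ ⟨-, B', hB', hv', hw, h2⟩
    have hvB := hhead hB hv h1
    have hwB := hhead hB' hw h2
    have hvB2 : v ∈ B' := hv'.resolve_left (Finpartition.notMem_of_mem_compl_part hB hvB)
    obtain rfl := 𝓑.eq_of_mem_parts hB hB' hvB hvB2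
    have h3 := (hlr B hB).1 u
    have h4 := (hlr B hB).1 v
    have h5 := (hlr B hB).1 w
    have huw : u ≠ w := by rintro rfl; omega
    refine ⟨⟨huw, ?_, ?_⟩, B, hB, hu, hw, by omega⟩
    · rw [(hlr B hB).2.1 u w hu hw huw]; omega
    · rcases hu with hu | hu
      · exact .inl hu
      · exact .inr (.inr ⟨B, hB, hu, hwB⟩)
  · rintro v x hx ⟨-, B, hB, -, hx', h⟩
    exact Finpartition.notMem_of_mem_compl_part hB (hhead hB hx' h) hx

/-- Sets of predecessors in a block are nested. -/
theorem predecessors_nested {T : V → V → Prop}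
    (hT : IsTransOrientation (BlockConflict G X 𝓑) T) {B : Finset V} (hB : B ∈ 𝓑.parts) {u v : V}
    (hu : u ∈ B) (hv : v ∈ B) : (∀ p, T p u → T p v) ∨ ∀ p, T p v → T p u := by
  by_contra! hn
  obtain ⟨⟨p, hpu, hpv⟩, q, hqv, hqu⟩ := hn
  have hmem : ∀ {p u}, u ∈ B → T p u → p ∈ X ∨ p ∈ B := by
    intro p u hu h
    rcases (hT.le h).2.2 with h | h | ⟨B', hB', h1, h2⟩
    · exact .inl h
    · exact absurd h (Finpartition.notMem_of_mem_compl_part hB hu)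
    · obtain rfl := 𝓑.eq_of_mem_parts hB hB' hu h2
      exact .inr h1
  have hp := hmem hu hpu
  have hq := hmem hv hqv
  have huX := Finpartition.notMem_of_mem_compl_part hB hu
  have hvX := Finpartition.notMem_of_mem_compl_part hB hv
  have adj : ∀ {a b : V}, a ≠ b → (a ∈ X ∨ a ∈ B) → (b ∈ X ∨ b ∈ B) → ¬T a b → ¬T b a →
      G.Adj a b := by
    intro a b hab ha hb h1 h2
    by_contra hn
    have : BlockConflict G X 𝓑 a b := ⟨hab, hn, by
      rcases ha with ha | ha
      · exact .inl ha
      · rcases hb with hb | hb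
        · exact .inr (.inl hb)
        · exact .inr (.inr ⟨B, hB, ha, hb⟩)⟩
    exact (hT.total this).elim h1 h2
  have hTvu : ¬T v u := fun h => hqu (hT.trans hqv h)
  have hTuv : ¬T u v := fun h => hpv (hT.trans hpu h)
  have hpv' : p ≠ v := by rintro rfl; exact hTvu hpu
  have hqu' : q ≠ u := by rintro rfl; exact hTuv hqv
  have hpq : p ≠ q := by rintro rfl; exact hpv hqv
  have huv : u ≠ v := by rintro rfl; exact hpv hpu
  -- The cycle `p v u q` is induced: its sides are adjacent, since an orientation of any of them
  -- would contradict transitivity, and `pu`, `qv` are conflicts. Four intervals cannot realize it.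
  have a1 := adj hpv' hp (.inr hv) hpv fun h => hqu (hT.trans (hT.trans hqv h) hpu)
  have a2 := adj hqu' hq (.inr hu) hqu fun h => hpv (hT.trans (hT.trans hpu h) hqv)
  have a3 := adj hpq hp hq (fun h => hpv (hT.trans h hqv)) fun h => hqu (hT.trans h hpu)
  have a4 := adj huv (.inr hu) (.inr hv) hTuv hTvu
  have n1 := (hT.le hpu).2.1
  have n2 := (hT.le hqv).2.1
  obtain ⟨l, r, h1, h2, -⟩ := hG.exists_intervals hB
  rw [h2 p v hp (.inr hv) hpv'] at a1
  rw [h2 q u hq (.inr hu) hqu'] at a2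
  rw [h2 p q hp hq hpq] at a3
  rw [h2 u v (.inr hu) (.inr hv) huv] at a4
  rw [h2 p u hp (.inr hu) (hT.le hpu).1] at n1
  rw [h2 q v hq (.inr hv) (hT.le hqv).1] at n2
  have := h1 p
  have := h1 q
  have := h1 u
  have := h1 v
  omega

end IsGoodPartition

end GoodPartition

/-! ### The numbers that define a star model -/

section GoodPartition

variable {V : Type*} [Fintype V] [DecidableEq V] {G : SimpleGraph V} {X : Finset V}
  {𝓑 : Finpartition Xᶜ}

/-- A vertex `x` of the clique has at most one block in which its neighborhood is not contained in
the neighborhoods of all vertices of the clique of at least the same height. -/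
def IsEliminationHeight (G : SimpleGraph V) (X : Finset V) (𝓑 : Finpartition Xᶜ) (h : V → ℕ) :
    Prop :=
  ∀ x ∈ X, ∀ B ∈ 𝓑.parts, ∀ B' ∈ 𝓑.parts, ∀ v ∈ B, ∀ v' ∈ B', ∀ y ∈ X, ∀ y' ∈ X,
    h x ≤ h y → h x ≤ h y' → G.Adj x v → ¬G.Adj y v → G.Adj x v' → ¬G.Adj y' v' → B = B'

omit [Fintype V] [DecidableEq V] in
open Classical in
theorem Removable.eq_of_not_minimal {𝓒 : Finset (Finset V)} {Y : Finset V} {x : V}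
    (h : Removable G 𝓒 Y x) {B B' : Finset V} (hB : B ∈ 𝓒) (hB' : B' ∈ 𝓒)
    (hn : ¬MinimalInBlock G x B Y) (hn' : ¬MinimalInBlock G x B' Y) : B = B' := by
  have h1 := h.2
  rw [← Finset.card_filter_add_card_filter_not (s := 𝓒) (fun B => MinimalInBlock G x B Y)] at h1
  have h2 : (𝓒.filter fun B => ¬MinimalInBlock G x B Y).card ≤ 1 := by omega
  exact Finset.card_le_one.1 h2 B (Finset.mem_filter.2 ⟨hB, hn⟩) B'
    (Finset.mem_filter.2 ⟨hB', hn'⟩)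

omit [Fintype V] [DecidableEq V] in
theorem not_minimalInBlock {x y v : V} {B Y : Finset V} (hy : y ∈ Y) (hv : v ∈ B)
    (h : G.Adj x v) (h' : ¬G.Adj y v) : ¬MinimalInBlock G x B Y :=
  fun hm => h' (hm y hy ⟨h, hv⟩)

/-- The position in the ordering is such a height: the clique vertices at least as high as `x` are
those in the suffix starting at `x`. -/
theorem IsGoodPartition.exists_isEliminationHeight (hG : IsGoodPartition G X 𝓑) :
    ∃ h : V → ℕ, IsEliminationHeight G X 𝓑 h := by
  obtain ⟨l, hnd, hl, hrem⟩ := hG.elimination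
  refine ⟨l.idxOf, fun x hx B hB B' hB' v hv v' hv' y hy y' hy' h1 h2 a n a' n' => ?_⟩
  have hmem : ∀ {z}, z ∈ X → z ∈ l := fun hz => by rw [← List.mem_toFinset, hl]; exact hz
  have hdrop : ∀ {z}, z ∈ X → l.idxOf x ≤ l.idxOf z → z ∈ (l.drop (l.idxOf x)).toFinset := by
    intro z hz hle
    rw [List.mem_toFinset, List.mem_iff_getElem]
    have hlt := List.idxOf_lt_length_iff.2 (hmem hz)
    refine ⟨l.idxOf z - l.idxOf x, by rw [List.length_drop]; omega, ?_⟩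
    rw [List.getElem_drop]
    simp only [Nat.add_sub_cancel' hle, List.getElem_idxOf]
  have h3 := hrem ⟨l.idxOf x, List.idxOf_lt_length_iff.2 (hmem hx)⟩
  simp only [List.get_eq_getElem, List.getElem_idxOf] at h3
  exact h3.eq_of_not_minimal hB hB' (not_minimalInBlock (hdrop hy h1) hv a n)
    (not_minimalInBlock (hdrop hy' h2) hv' a' n')

open Classical in
/-- The numbers from which a star model is built: `T` orients the conflicts, `c v` is the greatest
height of a vertex of the clique that is not adjacent to `v`, `a v` is the left end of the interval
of a vertex `v` of a block, and `b v` is the right end of the interval of `v` on its leg. -/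
structure IsStarData {I : Type*} (G : SimpleGraph V) (X : Finset V) (𝓑 : Finpartition Xᶜ)
    (T : V → V → Prop) (h c : V → ℕ) (leg : V → I) (a b : V → ℕ) : Prop where
  orientation : IsTransOrientation (BlockConflict G X 𝓑) T
  not_into : ∀ {v x}, x ∈ X → ¬T v x
  le_c : ∀ {x v}, x ∈ X → v ∉ X → ¬G.Adj x v → h x ≤ c v
  c_eq : ∀ {v}, v ∉ X → ∃ x ∈ X, ¬G.Adj x v ∧ c v = h x
  leg_block : ∀ {u v}, u ∉ X → v ∉ X → (leg u = leg v ↔ ∃ B ∈ 𝓑.parts, u ∈ B ∧ v ∈ B)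
  leg_clique : ∀ {x v}, x ∈ X → v ∉ X → G.Adj x v → h x ≤ c v → leg x = leg v
  a_eq : ∀ {v}, v ∉ X → a v = (Fintype.card V + 1) * c v + (Finset.univ.filter (T · v)).card
  a_le_b : ∀ {v}, v ∉ X → a v ≤ b v
  h_le_b : ∀ {x}, x ∈ X → (Fintype.card V + 1) * h x ≤ b x
  le_b : ∀ {v u}, u ∉ X → leg u = leg v → G.Adj v u → a u ≤ b v
  b_eq : ∀ v, (∃ u ∉ X, leg u = leg v ∧ G.Adj v u ∧ b v = a u) ∨ (v ∉ X ∧ b v = a v) ∨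
    (v ∈ X ∧ b v = (Fintype.card V + 1) * h v)

namespace IsStarData

variable {I : Type*} {T : V → V → Prop} {h c : V → ℕ} {leg : V → I} {a b : V → ℕ}

theorem conflict_clique (hD : IsStarData G X 𝓑 T h c leg a b) {x v : V}
    (hx : x ∈ X) (hv : v ∉ X) (hn : ¬G.Adj x v) : T x v :=
  (hD.orientation.total ⟨by rintro rfl; exact hv hx, hn, .inl hx⟩).resolve_right (hD.not_into hx)

/-- Non-neighbors of `u` in the clique are predecessors of `u`, hence of `v`, hence non-neighbors of
`v`. -/
theorem c_le_of_subset (hD : IsStarData G X 𝓑 T h c leg a b) {u v : V}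
    (hu : u ∉ X) (hv : v ∉ X) (hs : ∀ p, T p u → T p v) : c u ≤ c v := by
  obtain ⟨x, hx, hn, e⟩ := hD.c_eq hu
  rw [e]
  exact hD.le_c hx hv (hD.orientation.le (hs x (hD.conflict_clique hx hu hn))).2.1

/-- The leading digit does not decrease and the number of predecessors grows strictly. -/
theorem a_lt_of_subset (hD : IsStarData G X 𝓑 T h c leg a b) {u v p : V}
    (hu : u ∉ X) (hv : v ∉ X) (hs : ∀ p, T p u → T p v) (hp : T p v) (hp' : ¬T p u) :
    a u < a v := by
  classical
  rw [hD.a_eq hu, hD.a_eq hv]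
  have := Nat.mul_le_mul_left (Fintype.card V + 1) (hD.c_le_of_subset hu hv hs)
  have := Finset.card_lt_card (s := Finset.univ.filter (T · u)) (t := Finset.univ.filter (T · v))
    ⟨fun q hq => by simpa using hs q (by simpa using hq), fun hss => hp' (by
      simpa using hss (show p ∈ Finset.univ.filter (T · v) by simpa using hp))⟩
  convert add_lt_add_of_le_of_lt ‹_› ‹_›

/-- The lower digit is between 1 and `card V`; it is positive because maximality of `X` provides a
non-neighbor in `X`, which is a predecessor. -/
theorem a_bounds (hG : IsGoodPartition G X 𝓑) (hD : IsStarData G X 𝓑 T h c leg a b) {v : V}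
    (hv : v ∉ X) : (Fintype.card V + 1) * c v < a v ∧ a v < (Fintype.card V + 1) * (c v + 1) := by
  classical
  rw [hD.a_eq hv]
  obtain ⟨x, hx, hn⟩ := hG.exists_not_adj hv
  have h1 : 0 < (Finset.univ.filter (T · v)).card :=
    Finset.card_pos.2 ⟨x, by simpa using hD.conflict_clique hx hv hn⟩
  have h2 := Finset.card_le_univ (Finset.univ.filter (T · v))
  rw [mul_add]
  omega

theorem a_le_iff (hG : IsGoodPartition G X 𝓑) (hD : IsStarData G X 𝓑 T h c leg a b) {v : V}
    (hv : v ∉ X) (k : ℕ) : a v ≤ (Fintype.card V + 1) * k ↔ c v < k := by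
  obtain ⟨h1, h2⟩ := hD.a_bounds hG hv
  constructor
  · intro h3
    exact lt_of_mul_lt_mul_left (h1.trans_le h3) (Nat.zero_le _)
  · intro h3
    exact h2.le.trans (Nat.mul_le_mul_left _ h3)

/-- Suppose `x` is not adjacent to `v`. If `b x` is the left end of a neighbor `u` on the leg,
nestedness makes the predecessors of `u` a proper subset of those of `v`, as `x` precedes only `v`;
thus `v` starts later. If `b x` is the reach of `x`, then `h x ≤ c v` keeps `v` out of it. -/
theorem adj_clique_same (hG : IsGoodPartition G X 𝓑) (hD : IsStarData G X 𝓑 T h c leg a b) {x v : V}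
    (hx : x ∈ X) (hv : v ∉ X) (hl : leg x = leg v) : G.Adj x v ↔ a v ≤ b x := by
  refine ⟨fun hadj => hD.le_b hv hl.symm hadj, fun hle => ?_⟩
  by_contra hn
  rcases hD.b_eq x with ⟨u, hu, hlu, hxu, e⟩ | ⟨hx', -⟩ | ⟨-, e⟩
  · obtain ⟨B, hB, huB, hvB⟩ := (hD.leg_block hu hv).1 (hlu.trans hl)
    have hT := hD.conflict_clique hx hv hn
    have hTu : ¬T x u := fun h => (hD.orientation.le h).2.1 hxu
    rcases hG.predecessors_nested hD.orientation hB huB hvB with hs | hs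
    · have := hD.a_lt_of_subset hu hv hs hT hTu
      omega
    · exact hTu (hs x hT)
  · exact hx' hx
  · rw [e, hD.a_le_iff hG hv] at hle
    exact absurd (hD.le_c hx hv hn) (not_le.2 hle)

/-- From another leg only the height counts: neighbors of `x` with `h x ≤ c v` are confined to the
leg of `x` by `leg_clique`. -/
theorem adj_clique_ne (hG : IsGoodPartition G X 𝓑) (hD : IsStarData G X 𝓑 T h c leg a b) {x v : V}
    (hx : x ∈ X) (hv : v ∉ X) (hl : leg x ≠ leg v) :
    G.Adj x v ↔ a v ≤ (Fintype.card V + 1) * h x := by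
  rw [hD.a_le_iff hG hv]
  refine ⟨fun hadj => ?_, fun hlt => ?_⟩
  · by_contra! hle
    exact hl (hD.leg_clique hx hv hadj hle)
  · by_contra hn
    exact absurd (hD.le_c hx hv hn) (not_le.2 hlt)

/-- `b u` is the left end of some `w` on the leg, possibly `u` itself, that `u` does not precede.
Since `u` precedes `v`, nestedness gives `a w < a v`. -/
theorem b_lt_of_orientation (hG : IsGoodPartition G X 𝓑) (hD : IsStarData G X 𝓑 T h c leg a b)
    {u v : V} (hu : u ∉ X) (hv : v ∉ X) (hl : leg u = leg v) (hT : T u v) : b u < a v := by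
  have key : ∀ w ∉ X, leg w = leg u → ¬T u w → a w < a v := by
    intro w hw hlw hTw
    obtain ⟨B, hB, hwB, hvB⟩ := (hD.leg_block hw hv).1 (hlw.trans hl)
    rcases hG.predecessors_nested hD.orientation hB hwB hvB with hs | hs
    · exact hD.a_lt_of_subset hw hv hs hT hTw
    · exact absurd (hs u hT) hTw
  rcases hD.b_eq u with ⟨w, hw, hlw, huw, e⟩ | ⟨-, e⟩ | ⟨hu', -⟩
  · rw [e]
    exact key w hw hlw fun h => (hD.orientation.le h).2.1 huw
  · rw [e]
    exact key u hu rfl fun h => (hD.orientation.le h).1 rfl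
  · exact absurd hu' hu

theorem adj_block_same (hG : IsGoodPartition G X 𝓑) (hD : IsStarData G X 𝓑 T h c leg a b) {u v : V}
    (hu : u ∉ X) (hv : v ∉ X) (huv : u ≠ v) (hl : leg u = leg v) :
    G.Adj u v ↔ a u ≤ b v ∧ a v ≤ b u := by
  refine ⟨fun hadj => ⟨hD.le_b hu hl hadj.symm, hD.le_b hv hl.symm hadj⟩, fun ⟨h1, h2⟩ => ?_⟩
  by_contra hn
  rcases hD.orientation.total ⟨huv, hn, .inr (.inr ((hD.leg_block hu hv).1 hl))⟩ with hT | hT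
  · exact absurd (hD.b_lt_of_orientation hG hu hv hl hT) (not_lt.2 h2)
  · exact absurd (hD.b_lt_of_orientation hG hv hu hl.symm hT) (not_lt.2 h1)

theorem isIntervalStar (hG : IsGoodPartition G X 𝓑) (hD : IsStarData G X 𝓑 T h c leg a b) :
    IsIntervalStar G leg
      (fun v => if v ∈ X then -(((Fintype.card V + 1) * h v : ℕ) : ℝ) else (a v : ℝ))
      fun v => (b v : ℝ) := by
  have hb : ∀ v, (0 : ℝ) ≤ b v := fun v => by positivity
  have hneg : ∀ x, -(((Fintype.card V + 1) * h x : ℕ) : ℝ) ≤ 0 := fun x =>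
    neg_nonpos.2 (by positivity)
  have ha : ∀ {v}, v ∉ X → (0 : ℝ) < a v := fun hv => by
    exact_mod_cast (Nat.zero_le _).trans_lt (hD.a_bounds hG hv).1
  have hsame : ∀ {x v}, x ∈ X → v ∉ X → leg x = leg v →
      (G.Adj x v ↔ -(((Fintype.card V + 1) * h x : ℕ) : ℝ) ≤ b v ∧ (a v : ℝ) ≤ b x) := by
    intro x v hx hv hl
    rw [hD.adj_clique_same hG hx hv hl, and_iff_right ((hneg x).trans (hb v))]
    exact_mod_cast Iff.rfl
  have hne : ∀ {x v}, x ∈ X → v ∉ X → leg x ≠ leg v →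
      (G.Adj x v ↔ -(((Fintype.card V + 1) * h x : ℕ) : ℝ) + (a v : ℝ) ≤ 0) := by
    intro x v hx hv hl
    rw [hD.adj_clique_ne hG hx hv hl, neg_add_eq_sub, sub_nonpos]
    exact_mod_cast Iff.rfl
  refine ⟨fun v => ?_, fun v => ?_, fun {u v} huv hl => ?_, fun {u v} huv hl => ?_⟩
  · split_ifs with hv
    · exact (hneg v).trans (hb v)
    · exact_mod_cast hD.a_le_b hv
  · split_ifs with hv
    · rw [neg_neg]; exact_mod_cast hD.h_le_b hv
    · linarith [ha hv, hb v]
  · split_ifs with hu hv hv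
    · exact iff_of_true (hG.adj_of_mem hu hv huv)
        ⟨(hneg u).trans (hb v), (hneg v).trans (hb u)⟩
    · exact hsame hu hv hl
    · rw [G.adj_comm, and_comm]; exact hsame hv hu hl.symm
    · rw [hD.adj_block_same hG hu hv huv hl]
      exact_mod_cast Iff.rfl
  · split_ifs with hu hv hv
    · exact iff_of_true (hG.adj_of_mem hu hv huv) (by linarith [hneg u, hneg v])
    · exact hne hu hv hl
    · rw [G.adj_comm, add_comm]; exact hne hv hu hl.symm
    · refine iff_of_false (fun hadj => hl ?_) (by linarith [ha hu, ha hv])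
      exact (hD.leg_block hu hv).2 (hG.exists_part_of_adj hu hv hadj)

end IsStarData

end GoodPartition

/-- The factor 2 avoids halves: integral `a` and `b` give the integral center `a + b` and radius `b
- a`. -/
theorem IsIntervalStar.representsOnStar {V I : Type*} {G : SimpleGraph V} {leg : V → I}
    {a b o w : V → ℝ} (h : IsIntervalStar G leg a b) (ha : ∀ v, o v - w v = 2 * a v)
    (hb : ∀ v, o v + w v = 2 * b v) : RepresentsOnStar G leg o w := by
  classical
  intro u v huv
  have := ha u
  have := ha v
  have := hb u
  have := hb v
  unfold EmbeddedTree.starDist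
  split_ifs with hl
  · rw [h.adj_same huv hl, abs_le]
    constructor <;> rintro ⟨h1, h2⟩ <;> constructor <;> linarith
  · rw [h.adj_ne huv hl]
    constructor <;> intro h1 <;> linarith

theorem IsStarData.representsOnStar {V I : Type*} [Fintype V] [DecidableEq V] {G : SimpleGraph V}
    {X : Finset V} {𝓑 : Finpartition Xᶜ} {T : V → V → Prop} {h c : V → ℕ} {leg : V → I}
    {a b o w : V → ℕ} (hG : IsGoodPartition G X 𝓑) (hD : IsStarData G X 𝓑 T h c leg a b)
    (hX : ∀ v ∈ X, o v = b v - (Fintype.card V + 1) * h v ∧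
      w v = b v + (Fintype.card V + 1) * h v)
    (hB : ∀ v ∉ X, o v = a v + b v ∧ w v = b v - a v) :
    RepresentsOnStar G leg (fun v => ((o v : ℚ≥0) : ℝ)) fun v => ((w v : ℚ≥0) : ℝ) := by
  have key : ∀ v, (v ∈ X ∧ o v + (Fintype.card V + 1) * h v = b v ∧
      w v = b v + (Fintype.card V + 1) * h v) ∨ (v ∉ X ∧ o v = a v + b v ∧ w v + a v = b v) := by
    intro v
    by_cases hv : v ∈ X
    · rw [(hX v hv).1, (hX v hv).2, Nat.sub_add_cancel (hD.h_le_b hv)]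
      exact .inl ⟨hv, rfl, rfl⟩
    · rw [(hB v hv).1, (hB v hv).2, Nat.sub_add_cancel (hD.a_le_b hv)]
      exact .inr ⟨hv, rfl, rfl⟩
  simp only [NNRat.cast_natCast]
  refine (hD.isIntervalStar hG).representsOnStar (fun v => ?_) fun v => ?_
  all_goals
    obtain ⟨hv, h1, h2⟩ | ⟨hv, h1, h2⟩ := key v
    all_goals
      have h1' := congrArg (Nat.cast : ℕ → ℝ) h1
      have h2' := congrArg (Nat.cast : ℕ → ℝ) h2
      try simp only [hv, if_true, if_false]
      push_cast at h1' h2' ⊢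
      linarith

theorem RepresentsOnStar.comp_leg {V I J : Type*} {G : SimpleGraph V} {leg : V → I}
    {o w : V → ℝ} (h : RepresentsOnStar G leg o w) {f : I → J} (hf : Function.Injective f) :
    RepresentsOnStar G (fun v => f (leg v)) o w := by
  classical
  intro u v huv
  rw [h u v huv]
  simp only [EmbeddedTree.starDist, hf.eq_iff]

theorem exists_max_of_finite {V : Type*} [Finite V] (p : V → Prop) (f : V → ℕ) (d : ℕ) :
    ∃ b, d ≤ b ∧ (∀ u, p u → f u ≤ b) ∧ ((∃ u, p u ∧ b = f u) ∨ b = d) := by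
  by_cases h : ∃ u, p u ∧ d ≤ f u
  · obtain ⟨u, hu, hmax⟩ := Set.exists_max_image {u | p u ∧ d ≤ f u} f (Set.toFinite _) h
    refine ⟨f u, hu.2, fun v hv => ?_, .inl ⟨u, hu.1, rfl⟩⟩
    by_cases hd : d ≤ f v
    · exact hmax v ⟨hv, hd⟩
    · exact (not_le.1 hd).le.trans hu.2
  · push Not at h
    exact ⟨d, le_rfl, fun u hu => (h u hu).le, .inr rfl⟩

theorem HasGoodPartition.hasStarNeSModel {V : Type*} [Fintype V] [DecidableEq V]
    {G : SimpleGraph V} (hG : HasGoodPartition G) : HasStarNeSModel G := by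
  classical
  obtain ⟨X, 𝓑, hG⟩ := hG
  obtain ⟨T, hT, hTX⟩ := hG.exists_isTransOrientation
  obtain ⟨h, hh⟩ := hG.exists_isEliminationHeight
  choose c _ hc hc' using fun v => exists_max_of_finite (fun x => x ∈ X ∧ ¬G.Adj x v) h 0
  have hceq : ∀ {v}, v ∉ X → ∃ x ∈ X, ¬G.Adj x v ∧ c v = h x := by
    intro v hv
    rcases hc' v with ⟨x, hx, e⟩ | e
    · exact ⟨x, hx.1, hx.2, e⟩
    · obtain ⟨x, hx, hn⟩ := hG.exists_not_adj hv
      exact ⟨x, hx, hn, le_antisymm (by omega) (hc v x ⟨hx, hn⟩)⟩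
  -- Legs are labeled by vertex sets. A clique vertex gets the only block in which height does not
  -- decide its adjacencies, or the dummy leg `∅` if there is none.
  have hleg : ∀ v, ∃ L : Finset V, (v ∉ X → L ∈ 𝓑.parts ∧ v ∈ L) ∧
      (v ∈ X → ∀ B ∈ 𝓑.parts, ∀ u ∈ B, G.Adj v u → h v ≤ c u → L = B) := by
    intro v
    by_cases hv : v ∈ X
    · by_cases hex : ∃ B ∈ 𝓑.parts, ∃ u ∈ B, G.Adj v u ∧ h v ≤ c u
      · obtain ⟨B, hB, u, hu, hvu, hle⟩ := hex
        refine ⟨B, fun hn => absurd hv hn, fun _ B' hB' u' hu' hvu' hle' => ?_⟩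
        obtain ⟨y, hy, hyu, e⟩ := hceq (Finpartition.notMem_of_mem_compl_part hB hu)
        obtain ⟨y', hy', hyu', e'⟩ := hceq (Finpartition.notMem_of_mem_compl_part hB' hu')
        exact hh v hv B hB B' hB' u hu u' hu' y hy y' hy' (e ▸ hle) (e' ▸ hle') hvu hyu hvu' hyu'
      · exact ⟨∅, fun hn => absurd hv hn, fun _ B hB u hu hvu hle =>
          absurd ⟨B, hB, u, hu, hvu, hle⟩ hex⟩
    · obtain ⟨B, hB, hvB⟩ := 𝓑.exists_part_of_notMem hv
      exact ⟨B, fun _ => ⟨hB, hvB⟩, fun hv' => absurd hv' hv⟩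
  choose leg hleg hlegX using hleg
  set a : V → ℕ := fun v =>
    (Fintype.card V + 1) * c v + (Finset.univ.filter (T · v)).card with ha
  -- The default value of the maximum enforces `a v ≤ b v` in blocks, and in the clique that the own
  -- leg is covered at least up to the reach.
  choose b hb hb' hb'' using fun v => exists_max_of_finite
    (fun u => u ∉ X ∧ leg u = leg v ∧ G.Adj v u) a
    (if v ∈ X then (Fintype.card V + 1) * h v else a v)
  have hD : IsStarData G X 𝓑 T h c leg a b := by
    refine ⟨hT, hTX, fun {x v} hx _ hn => hc v x ⟨hx, hn⟩, hceq, fun {u v} hu hv => ?_,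
      fun {x v} hx hv hxv hle => hlegX x hx _ (hleg v hv).1 v (hleg v hv).2 hxv hle,
      fun _ => rfl, fun {v} hv => ?_, fun {x} hx => ?_, fun {v u} hu hl hadj => hb' v u ⟨hu, hl, hadj⟩,
      fun v => ?_⟩
    · constructor
      · intro e
        exact ⟨leg u, (hleg u hu).1, (hleg u hu).2, e ▸ (hleg v hv).2⟩
      · rintro ⟨B, hB, hu', hv'⟩
        rw [𝓑.eq_of_mem_parts (hleg u hu).1 hB (hleg u hu).2 hu',
          𝓑.eq_of_mem_parts (hleg v hv).1 hB (hleg v hv).2 hv']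
    · simpa [hv] using hb v
    · simpa [hx] using hb x
    · rcases hb'' v with ⟨u, hu, e⟩ | e
      · exact .inl ⟨u, hu.1, hu.2.1, hu.2.2, e⟩
      · by_cases hv : v ∈ X
        · exact .inr (.inr ⟨hv, by simpa [hv] using e⟩)
        · exact .inr (.inl ⟨hv, by simpa [hv] using e⟩)
  set o : V → ℕ := fun v =>
    if v ∈ X then b v - (Fintype.card V + 1) * h v else a v + b v with ho
  set w : V → ℕ := fun v =>
    if v ∈ X then b v + (Fintype.card V + 1) * h v else b v - a v with hw
  have hrep := hD.representsOnStar (o := o) (w := w) hG (fun v hv => by simp [ho, hw, hv])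
    (fun v hv => by simp [ho, hw, hv])
  obtain ⟨L, -, hL, -⟩ := exists_max_of_finite (fun _ => True) o 0
  obtain ⟨M, hM, -⟩ := exists_neSModel (fun _ => ((L + 1 : ℕ) : ℚ≥0))
    (fun _ => by positivity) (fun v => Fintype.equivFin (Finset V) (leg v)) (fun v => (o v : ℚ≥0))
    (fun v => (w v : ℚ≥0)) (fun v => by exact_mod_cast (hL v trivial).trans (Nat.le_succ L))
    (hrep.comp_leg (Equiv.injective _))
  exact ⟨_, M, hM⟩

theorem hasGoodPartition_iff_hasStarNeSModel {V : Type*} [Fintype V] [DecidableEq V]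
    (G : SimpleGraph V) : HasGoodPartition G ↔ HasStarNeSModel G := by
  refine ⟨fun h => h.hasStarNeSModel, ?_⟩
  rintro ⟨m, M, hM⟩
  obtain ⟨leg, o, w, ho, hw, h⟩ := M.representsOnStar hM
  exact (h.isIntervalStar ho hw).hasGoodPartition

/-! ### Correctness of the algorithm -/

theorem length_filter_range_lt (k N : ℕ) :
    ((List.range N).filter fun s => decide (s < k)).length = min N k := by
  induction N with
  | zero => simp
  | succ N ih =>
    rw [List.range_succ, List.filter_append, List.length_append, ih]
    by_cases h : N < k <;> simp [h] <;> omega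

theorem lt_length_filter_iff {p : ℕ → Bool} {N : ℕ} (hp : ∀ s, p (s + 1) = true → p s = true)
    (hN : p N = false) (s : ℕ) :
    s < ((List.range (N + 1)).filter p).length ↔ p s = true := by
  have hex : ∃ s, p s = false := ⟨N, hN⟩
  classical
  have hk : ∀ s, p s = decide (s < Nat.find hex) := by
    intro s
    by_cases hs : s < Nat.find hex
    · simpa [hs] using Nat.find_min hex hs
    · have : ∀ d, p (Nat.find hex + d) = false := by
        intro d
        induction d with
        | zero => exact Nat.find_spec hex
        | succ d ih =>
          by_contra h
          rw [hp (Nat.find hex + d) (Bool.eq_true_of_not_eq_false h)] at ih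
          exact absurd ih (by simp)
      have h := this (s - Nat.find hex)
      rw [Nat.add_sub_cancel' (not_lt.1 hs)] at h
      simp [h, hs]
  have hle : Nat.find hex ≤ N := Nat.find_min' hex hN
  rw [show p = fun s => decide (s < Nat.find hex) from funext hk, length_filter_range_lt]
  simp only [decide_eq_true_eq]
  omega

theorem length_filter_range_eq_card {n : ℕ} (p : ℕ → Bool) (q : Fin n → Prop) [DecidablePred q]
    (h : ∀ u : Fin n, p u = true ↔ q u) :
    ((List.range n).filter p).length = (Finset.univ.filter q).card := by
  rw [← List.map_coe_finRange_eq_range, List.filter_map, List.length_map,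
    show (p ∘ (Fin.val : Fin n → ℕ)) = fun u => decide (q u) from by
      funext u; rw [Bool.eq_iff_iff]; simp [h]]
  rfl

section

variable {n : ℕ} {G : SimpleGraph (Fin n)} {X : Finset (Fin n)} {𝓑 : Finpartition Xᶜ}
  {blocks : List (Finset (Fin n))}

open Classical in
/-- The input of the algorithm. -/
noncomputable def rawInput (G : SimpleGraph (Fin n)) (X : Finset (Fin n))
    (blocks : List (Finset (Fin n))) : RawInput :=
  (List.ofFn fun i => List.ofFn fun j => decide (G.Adj i j), List.ofFn fun i => decide (i ∈ X),
    blocks.map fun B => List.ofFn fun i => decide (i ∈ B))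

theorem toData_rawInput : toData (rawInput G X blocks) = encodeInput G X blocks := by
  classical
  have hb : ∀ f : Fin n → Bool, toData (List.ofFn f) =
      encodeDataList (List.ofFn fun i => encodeBit (f i)) := by
    intro f
    change encodeDataList ((List.ofFn f).map toData) = _
    rw [List.map_ofFn]
    rfl
  change Data.cons (encodeDataList ((List.ofFn _).map toData)) (Data.cons (toData (List.ofFn _))
    (encodeDataList ((blocks.map _).map toData))) = _
  rw [List.map_ofFn, hb, List.map_map]
  simp only [encodeInput, encodeGraph, Function.comp_def, hb]
  rfl

namespace RawInput

theorem order_rawInput : (rawInput G X blocks).order = n := by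
  simp [order, rawInput]

theorem blockCount_rawInput : (rawInput G X blocks).blockCount = blocks.length := by
  simp [blockCount, rawInput]

theorem getD_ofFn {β : Type*} (f : Fin n → β) (d : β) (u : Fin n) :
    (List.ofFn f).getD u d = f u := by
  simp [List.getD]

theorem adj_rawInput {u v : Fin n} : (rawInput G X blocks).adj u v = true ↔ G.Adj u v := by
  simp only [adj, matrixEntry, rawInput]
  rw [getD_ofFn, getD_ofFn]
  simp

theorem inClique_rawInput {u : Fin n} : (rawInput G X blocks).inClique u = true ↔ u ∈ X := by
  simp only [inClique, rawInput]
  rw [getD_ofFn]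
  simp

theorem inBlock_rawInput {k : ℕ} {u : Fin n} : (rawInput G X blocks).inBlock k u = true ↔
    ∃ hk : k < blocks.length, u ∈ blocks[k] := by
  simp only [inBlock, matrixEntry, rawInput]
  by_cases hk : k < blocks.length
  · rw [show (blocks.map fun B => List.ofFn fun i => decide (i ∈ B)).getD k [] =
      List.ofFn fun i => decide (i ∈ blocks[k]) by simp [List.getD, hk], getD_ofFn]
    simp [hk]
  · rw [show (blocks.map fun B => List.ofFn fun i => decide (i ∈ B)).getD k [] = [] from
      List.getD_eq_default _ _ (by simpa using hk)]
    simp [hk]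

section

variable (hB : blocks.toFinset = 𝓑.parts)
include hB

theorem mem_blocks {B : Finset (Fin n)} : B ∈ blocks ↔ B ∈ 𝓑.parts := by
  rw [← hB, List.mem_toFinset]

theorem exists_part_iff {p : Finset (Fin n) → Prop} :
    (∃ B ∈ 𝓑.parts, p B) ↔ ∃ k, ∃ hk : k < blocks.length, p blocks[k] := by
  constructor
  · rintro ⟨B, hB', h⟩
    obtain ⟨k, hk, rfl⟩ := List.mem_iff_getElem.1 ((mem_blocks hB).2 hB')
    exact ⟨k, hk, h⟩
  · rintro ⟨k, hk, h⟩
    exact ⟨_, (mem_blocks hB).1 (List.getElem_mem hk), h⟩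

theorem conflictRel_rawInput : conflictRel (rawInput G X blocks) n = BlockConflict G X 𝓑 := by
  funext u v
  apply propext
  rw [BlockConflict, exists_part_iff hB]
  simp only [conflictRel, conflict, Bool.and_eq_true, Bool.or_eq_true, Bool.not_eq_true',
    decide_eq_true_eq, List.any_eq_true, List.mem_range, inClique_rawInput,
    inBlock_rawInput, blockCount_rawInput, ← Bool.not_eq_true, adj_rawInput, Fin.val_inj, ne_eq,
    and_assoc, or_assoc]
  refine and_congr_right fun _ => and_congr_right fun _ => or_congr_right (or_congr_right
    (exists_congr fun k => ?_))
  constructor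
  · rintro ⟨hk, ⟨_, h1⟩, _, h2⟩
    exact ⟨hk, h1, h2⟩
  · rintro ⟨hk, h1, h2⟩
    exact ⟨hk, ⟨hk, h1⟩, hk, h2⟩

/-- A vertex of the clique that is left after `s` rounds. -/
def IsRemaining (G : SimpleGraph (Fin n)) (X : Finset (Fin n)) (blocks : List (Finset (Fin n)))
    (s : ℕ) (x : Fin n) : Prop :=
  ((rawInput G X blocks).remainingClique s).getD x false = true

omit hB in
theorem isRemaining_zero {x : Fin n} : IsRemaining G X blocks 0 x ↔ x ∈ X := by
  rw [IsRemaining, remainingClique, Function.iterate_zero, id_eq,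
    tabulate_getD _ _ _ _ (by rw [order_rawInput]; exact x.2), inClique_rawInput]

omit hB in
theorem minimalInBlock_rawInput {s k : ℕ} {x : Fin n} (hk : k < blocks.length) {Y : Finset (Fin n)}
    (hY : ∀ y, y ∈ Y ↔ IsRemaining G X blocks s y) :
    (rawInput G X blocks).minimalInBlock ((rawInput G X blocks).remainingClique s) k x = true ↔
      MinimalInBlock G x blocks[k] Y := by
  rw [minimalInBlock, all_vertices order_rawInput]
  simp only [Bool.or_eq_true, Bool.not_eq_true', ← Bool.not_eq_true, Bool.and_eq_true,
    all_vertices order_rawInput, inBlock_rawInput, adj_rawInput]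
  simp only [MinimalInBlock, hY, IsRemaining]
  constructor
  · rintro h y hy v ⟨hv1, hv2⟩
    rcases h v with h | h
    · exact absurd ⟨⟨hk, hv2⟩, hv1⟩ h
    · exact (h y).resolve_left fun h => h hy
  · intro h v
    by_cases hv : (∃ hk : k < blocks.length, v ∈ blocks[k]) ∧ G.Adj x v
    · right
      intro y
      by_cases hy : ((rawInput G X blocks).remainingClique s).getD y false = true
      · exact .inr (h y hy ⟨hv.2, hv.1.2⟩)
      · exact .inl hy
    · exact .inl hv

open Classical in
theorem removable_rawInput (hnd : blocks.Nodup) {s : ℕ} {x : Fin n} {Y : Finset (Fin n)}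
    (hY : ∀ y, y ∈ Y ↔ IsRemaining G X blocks s y) :
    (rawInput G X blocks).removable ((rawInput G X blocks).remainingClique s) x = true ↔
      ∀ B ∈ 𝓑.parts, ∀ B' ∈ 𝓑.parts, ¬MinimalInBlock G x B Y → ¬MinimalInBlock G x B' Y →
        B = B' := by
  rw [removable]
  simp only [List.all_eq_true, List.mem_range, blockCount_rawInput, Bool.or_eq_true,
    decide_eq_true_eq]
  constructor
  · intro h B hB1 B' hB2 hn hn'
    obtain ⟨k, hk, rfl⟩ := List.mem_iff_getElem.1 ((mem_blocks hB).2 hB1)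
    obtain ⟨k', hk', rfl⟩ := List.mem_iff_getElem.1 ((mem_blocks hB).2 hB2)
    have := h k hk k' hk'
    rw [minimalInBlock_rawInput hk hY, minimalInBlock_rawInput hk' hY] at this
    have e : k = k' := (this.resolve_left (not_or.2 ⟨hn, hn'⟩))
    subst e
    rfl
  · intro h k hk k' hk'
    rw [minimalInBlock_rawInput hk hY, minimalInBlock_rawInput hk' hY]
    by_contra! hn
    refine hn.2 ((hnd.getElem_inj_iff (hi := hk) (hj := hk')).1 ?_)
    exact h _ ((mem_blocks hB).1 (List.getElem_mem hk)) _ ((mem_blocks hB).1 (List.getElem_mem hk'))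
      hn.1.1 hn.1.2

omit hB in
theorem isRemaining_succ {s : ℕ} {x : Fin n} : IsRemaining G X blocks (s + 1) x ↔
    IsRemaining G X blocks s x ∧
      ¬(rawInput G X blocks).removable ((rawInput G X blocks).remainingClique s) x = true := by
  rw [IsRemaining, remainingClique, Function.iterate_succ_apply', ← remainingClique,
    eliminationRound, tabulate_getD _ _ _ _ (by rw [order_rawInput]; exact x.2)]
  simp [IsRemaining]

theorem not_isRemaining_order (hG : IsGoodPartition G X 𝓑) (hnd : blocks.Nodup) (x : Fin n) :
    ¬IsRemaining G X blocks n x := by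
  classical
  set Y : ℕ → Finset (Fin n) := fun s => Finset.univ.filter (IsRemaining G X blocks s) with hY
  have hmY : ∀ s y, y ∈ Y s ↔ IsRemaining G X blocks s y := fun s y => by simp [hY]
  have hYX : ∀ s, Y s ⊆ X := by
    intro s
    induction s with
    | zero => intro y hy; exact isRemaining_zero.1 ((hmY _ _).1 hy)
    | succ s ih => intro y hy; exact ih ((hmY _ _).2 (isRemaining_succ.1 ((hmY _ _).1 hy)).1)
  obtain ⟨l, hlnd, hlX, hrem⟩ := hG.elimination
  have hstep : ∀ s, (Y s).Nonempty → (Y (s + 1)).card < (Y s).card := by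
    intro s hne
    have hex : ∃ i : ℕ, ∃ hi : i < l.length, l[i] ∈ Y s := by
      obtain ⟨y, hy⟩ := hne
      have hyl : y ∈ l := by rw [← List.mem_toFinset, hlX]; exact hYX s hy
      obtain ⟨i, hi, rfl⟩ := List.mem_iff_getElem.1 hyl
      exact ⟨i, hi, hy⟩
    obtain ⟨hi, hmem⟩ := Nat.find_spec hex
    have hsub : Y s ⊆ (l.drop (Nat.find hex)).toFinset := by
      intro y hy
      have hyl : y ∈ l := by rw [← List.mem_toFinset, hlX]; exact hYX s hy
      obtain ⟨j, hj, rfl⟩ := List.mem_iff_getElem.1 hyl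
      have hle : Nat.find hex ≤ j := Nat.find_min' hex ⟨hj, hy⟩
      rw [List.mem_toFinset, List.mem_iff_getElem]
      refine ⟨j - Nat.find hex, by rw [List.length_drop]; omega, ?_⟩
      rw [List.getElem_drop]
      simp only [Nat.add_sub_cancel' hle]
    have hr := hrem ⟨Nat.find hex, hi⟩
    simp only [List.get_eq_getElem] at hr
    refine Finset.card_lt_card ⟨fun y hy => (hmY _ _).2 (isRemaining_succ.1 ((hmY _ _).1 hy)).1,
      fun hss => ?_⟩
    refine (isRemaining_succ.1 ((hmY _ _).1 (hss hmem))).2 ?_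
    rw [removable_rawInput hB hnd (hmY s)]
    intro B hB1 B' hB2 hn hn'
    exact hr.eq_of_not_minimal hB1 hB2 (fun h => hn fun y hy => h y (hsub hy))
      (fun h => hn' fun y hy => h y (hsub hy))
  have hcard : ∀ s, Y s = ∅ ∨ (Y s).card + s ≤ n := by
    intro s
    induction s with
    | zero =>
      right
      simpa using Finset.card_le_univ (Y 0)
    | succ s ih =>
      rcases (Y (s + 1)).eq_empty_or_nonempty with he | he
      · exact .inl he
      · right
        have hne : (Y s).Nonempty := he.mono
          fun y hy => (hmY _ _).2 (isRemaining_succ.1 ((hmY _ _).1 hy)).1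
        have := hstep s hne
        have := ih.resolve_left hne.ne_empty
        omega
  have hempty : Y n = ∅ := by
    rcases hcard n with h | h
    · exact h
    · exact Finset.card_eq_zero.1 (by omega)
  rw [← hmY, hempty]
  simp

theorem lt_height_iff (hG : IsGoodPartition G X 𝓑) (hnd : blocks.Nodup) (x : Fin n) (s : ℕ) :
    s < (rawInput G X blocks).height x ↔ IsRemaining G X blocks s x := by
  rw [height, order_rawInput, lt_length_filter_iff
    (p := fun s => ((rawInput G X blocks).remainingClique s).getD x false)
    (fun s h => (isRemaining_succ (G := G) (X := X) (blocks := blocks) (x := x).1 h).1)]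
  · rfl
  · simpa [IsRemaining] using not_isRemaining_order hB hG hnd x

theorem isEliminationHeight_rawInput (hG : IsGoodPartition G X 𝓑) (hnd : blocks.Nodup) :
    IsEliminationHeight G X 𝓑 fun x : Fin n => (rawInput G X blocks).height x := by
  classical
  intro x hx B hB1 B' hB2 v hv v' hv' y hy y' hy' h1 h2 a1 a2 a3 a4
  have hpos : 0 < (rawInput G X blocks).height x :=
    (lt_height_iff hB hG hnd x 0).2 (isRemaining_zero.2 hx)
  set s := (rawInput G X blocks).height x - 1 with hs
  have hlast : IsRemaining G X blocks s x := (lt_height_iff hB hG hnd x s).1 (by omega)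
  have hnext : ¬IsRemaining G X blocks (s + 1) x := fun h => by
    have := (lt_height_iff hB hG hnd x (s + 1)).2 h
    omega
  have hrem : (rawInput G X blocks).removable ((rawInput G X blocks).remainingClique s) x = true := by
    by_contra hn
    exact hnext (isRemaining_succ.2 ⟨hlast, hn⟩)
  rw [removable_rawInput hB hnd (Y := Finset.univ.filter (IsRemaining G X blocks s))
    (fun y => by simp)] at hrem
  have hmem : ∀ {y : Fin n}, (rawInput G X blocks).height x ≤ (rawInput G X blocks).height y →
      y ∈ Finset.univ.filter (IsRemaining G X blocks s) := fun h => by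
    simpa using (lt_height_iff hB hG hnd _ s).1 (by omega)
  exact hrem B hB1 B' hB2 (not_minimalInBlock (hmem h1) hv a1 a2)
    (not_minimalInBlock (hmem h2) hv' a3 a4)

omit hB in
theorem le_lastNonneighbor {x v : Fin n} (hx : x ∈ X) (hn : ¬G.Adj x v) :
    (rawInput G X blocks).height x ≤ (rawInput G X blocks).lastNonneighbor v :=
  le_maxOver (mem_vertices order_rawInput x) (by
    simpa [inClique_rawInput, hx, ← Bool.not_eq_true, adj_rawInput] using hn)

omit hB in
theorem exists_of_mem_vertices {u : ℕ} (hu : u ∈ (rawInput G X blocks).vertices) :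
    ∃ w : Fin n, u = w := by
  rw [vertices, List.mem_range, order_rawInput] at hu
  exact ⟨⟨u, hu⟩, rfl⟩

omit hB in
theorem exists_lastNonneighbor_eq (hG : IsGoodPartition G X 𝓑) {v : Fin n} (hv : v ∉ X) :
    ∃ x ∈ X, ¬G.Adj x v ∧
      (rawInput G X blocks).lastNonneighbor v = (rawInput G X blocks).height x := by
  rcases maxOver_eq_zero_or (rawInput G X blocks).vertices
    (fun x => (rawInput G X blocks).inClique x && !(rawInput G X blocks).adj x v)
    (rawInput G X blocks).height with h | ⟨u, hu, hp, h⟩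
  · obtain ⟨x, hx, hn⟩ := hG.exists_not_adj hv
    refine ⟨x, hx, hn, le_antisymm ?_ (le_lastNonneighbor hx hn)⟩
    rw [lastNonneighbor, h]
    exact Nat.zero_le _
  · obtain ⟨x, rfl⟩ := exists_of_mem_vertices hu
    simp only [Bool.and_eq_true, Bool.not_eq_true', ← Bool.not_eq_true, inClique_rawInput,
      adj_rawInput] at hp
    exact ⟨x, hp.1, hp.2, h⟩

theorem index_unique (hnd : blocks.Nodup) {k k' : ℕ} {u : Fin n}
    (h : (rawInput G X blocks).inBlock k u = true)
    (h' : (rawInput G X blocks).inBlock k' u = true) : k = k' := by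
  obtain ⟨hk, h⟩ := inBlock_rawInput.1 h
  obtain ⟨hk', h'⟩ := inBlock_rawInput.1 h'
  exact (hnd.getElem_inj_iff).1 (𝓑.eq_of_mem_parts ((mem_blocks hB).1 (List.getElem_mem hk))
    ((mem_blocks hB).1 (List.getElem_mem hk')) h h')

theorem inBlock_legOf {v : Fin n} (hv : v ∉ X) :
    (rawInput G X blocks).inBlock ((rawInput G X blocks).legOf v) v = true := by
  have hc : (rawInput G X blocks).inClique v = false := by
    rw [← Bool.not_eq_true, inClique_rawInput]; exact hv
  rcases firstOr_eq ((List.range (rawInput G X blocks).blockCount).filter fun k =>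
    bif (rawInput G X blocks).inClique v then (rawInput G X blocks).vertices.any fun u =>
      (rawInput G X blocks).inBlock k u && (rawInput G X blocks).adj v u &&
      decide ((rawInput G X blocks).height v ≤ (rawInput G X blocks).lastNonneighbor u)
    else (rawInput G X blocks).inBlock k v) (rawInput G X blocks).blockCount with h | h
  · obtain ⟨B, hB1, hvB⟩ := 𝓑.exists_part_of_notMem hv
    obtain ⟨k, hk, rfl⟩ := List.mem_iff_getElem.1 ((mem_blocks hB).2 hB1)
    have := List.filter_eq_nil_iff.1 h.1 k (by rw [List.mem_range, blockCount_rawInput]; exact hk)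
    rw [hc, cond_false, inBlock_rawInput] at this
    exact absurd ⟨hk, hvB⟩ this
  · change (rawInput G X blocks).legOf v ∈ _ at h
    generalize (rawInput G X blocks).legOf v = k at h ⊢
    simpa only [hc, cond_false] using (List.mem_filter.1 h).2

omit hB in
theorem legOf_le (v : Fin n) : (rawInput G X blocks).legOf v ≤ blocks.length := by
  rw [legOf]
  rcases firstOr_eq ((List.range (rawInput G X blocks).blockCount).filter fun k =>
    bif (rawInput G X blocks).inClique v then (rawInput G X blocks).vertices.any fun u =>
      (rawInput G X blocks).inBlock k u && (rawInput G X blocks).adj v u &&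
      decide ((rawInput G X blocks).height v ≤ (rawInput G X blocks).lastNonneighbor u)
    else (rawInput G X blocks).inBlock k v) (rawInput G X blocks).blockCount with h | h
  · rw [h.2, blockCount_rawInput]
  · have := List.mem_range.1 (List.mem_filter.1 h).1
    exact (lt_of_lt_of_eq this blockCount_rawInput).le

theorem legOf_eq_iff (hnd : blocks.Nodup) {v : Fin n} (hv : v ∉ X) {k : ℕ} :
    (rawInput G X blocks).legOf v = k ↔ (rawInput G X blocks).inBlock k v = true :=
  ⟨fun h => h ▸ inBlock_legOf hB hv, fun h => index_unique hB hnd (inBlock_legOf hB hv) h⟩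

theorem legOf_clique (hG : IsGoodPartition G X 𝓑) (hnd : blocks.Nodup) {x v : Fin n} (hx : x ∈ X)
    (hv : v ∉ X) (hxv : G.Adj x v)
    (hle : (rawInput G X blocks).height x ≤ (rawInput G X blocks).lastNonneighbor v) :
    (rawInput G X blocks).legOf x = (rawInput G X blocks).legOf v := by
  have hc : (rawInput G X blocks).inClique x = true := inClique_rawInput.2 hx
  have hany : ∀ k, ((rawInput G X blocks).vertices.any fun u =>
      (rawInput G X blocks).inBlock k u && (rawInput G X blocks).adj x u &&
      decide ((rawInput G X blocks).height x ≤ (rawInput G X blocks).lastNonneighbor u)) = true ↔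
      ∃ u : Fin n, (rawInput G X blocks).inBlock k u = true ∧ G.Adj x u ∧
        (rawInput G X blocks).height x ≤ (rawInput G X blocks).lastNonneighbor u := by
    intro k
    rw [any_vertices order_rawInput]
    simp only [Bool.and_eq_true, adj_rawInput, decide_eq_true_eq, and_assoc]
  have hvB := inBlock_legOf (G := G) hB hv
  have hvk := hvB
  rw [inBlock_rawInput] at hvB
  obtain ⟨hk, hvB⟩ := hvB
  rcases firstOr_eq ((List.range (rawInput G X blocks).blockCount).filter fun k =>
    bif (rawInput G X blocks).inClique x then (rawInput G X blocks).vertices.any fun u =>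
      (rawInput G X blocks).inBlock k u && (rawInput G X blocks).adj x u &&
      decide ((rawInput G X blocks).height x ≤ (rawInput G X blocks).lastNonneighbor u)
    else (rawInput G X blocks).inBlock k x) (rawInput G X blocks).blockCount with h | h
  · have := List.filter_eq_nil_iff.1 h.1 _ (List.mem_range.2 (blockCount_rawInput.symm ▸ hk))
    rw [hc, cond_true, hany] at this
    exact absurd ⟨v, hvk, hxv, hle⟩ this
  · change (rawInput G X blocks).legOf x ∈ _ at h
    generalize (rawInput G X blocks).legOf x = k at h ⊢
    have := (List.mem_filter.1 h).2
    rw [hc, cond_true, hany] at this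
    obtain ⟨u, hu, hxu, hle'⟩ := this
    obtain ⟨hk', huB⟩ := inBlock_rawInput.1 hu
    have hB1 := (mem_blocks hB).1 (List.getElem_mem hk)
    have hB2 := (mem_blocks hB).1 (List.getElem_mem hk')
    obtain ⟨y, hy, hyv, e⟩ := exists_lastNonneighbor_eq hG hv
    obtain ⟨y', hy', hyu, e'⟩ := exists_lastNonneighbor_eq hG
      (Finpartition.notMem_of_mem_compl_part hB2 huB)
    have := isEliminationHeight_rawInput hB hG hnd x hx _ hB2 _ hB1 u huB v hvB y' hy' y hy
      (hle'.trans_eq e') (hle.trans_eq e) hxu hyu hxv hyv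
    exact (hnd.getElem_inj_iff).1 this

theorem isStarData_rawInput (hG : IsGoodPartition G X 𝓑) (hnd : blocks.Nodup) :
    IsStarData G X 𝓑 (matrixRel n (rawInput G X blocks).orientation)
      (fun v : Fin n => (rawInput G X blocks).height v)
      (fun v : Fin n => (rawInput G X blocks).lastNonneighbor v)
      (fun v : Fin n => (rawInput G X blocks).legOf v)
      (fun v : Fin n => (rawInput G X blocks).leftEnd v)
      fun v : Fin n => (rawInput G X blocks).rightEnd v := by
  classical
  have hcf := conflictRel_rawInput (G := G) hB
  obtain ⟨P, hP, hPX⟩ := hG.exists_isTransOrientation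
  obtain ⟨hT, hTX⟩ := isTransOrientation_orientation (I := rawInput G X blocks) (X := (X : Set (Fin n)))
    order_rawInput (fun u => inClique_rawInput.symm) (hcf ▸ hP)
    (fun h => by rw [hcf] at h ⊢; exact h.symm) hPX
  have hclique : ∀ {v : Fin n}, v ∈ X → (rawInput G X blocks).inClique v = true :=
    fun h => inClique_rawInput.2 h
  have hnot : ∀ {v : Fin n}, v ∉ X → (rawInput G X blocks).inClique v = false := fun h => by
    rw [← Bool.not_eq_true, inClique_rawInput]; exact h
  refine ⟨hcf ▸ hT, hTX, fun hx _ hn => le_lastNonneighbor hx hn,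
    fun hv => exists_lastNonneighbor_eq hG hv, fun {u v} hu hv => ?_,
    fun hx hv hxv hle => legOf_clique hB hG hnd hx hv hxv hle, fun {v} hv => ?_,
    fun {v} hv => ?_, fun {x} hx => ?_, fun {v u} hu hl hvu => ?_, fun v => ?_⟩
  · rw [legOf_eq_iff hB hnd hu, inBlock_rawInput, exists_part_iff hB]
    constructor
    · rintro ⟨hk, h⟩
      obtain ⟨_, h'⟩ := inBlock_rawInput.1 (inBlock_legOf (G := G) hB hv)
      exact ⟨_, hk, h, h'⟩
    · rintro ⟨k, hk, h1, h2⟩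
      have e := (legOf_eq_iff (G := G) hB hnd hv).2 (inBlock_rawInput.2 ⟨hk, h2⟩)
      rw [e]
      exact ⟨hk, h1⟩
  · rw [leftEnd, order_rawInput, vertices, order_rawInput, Fintype.card_fin]
    congr 1
    exact length_filter_range_eq_card _ _ fun u => Iff.rfl
  · rw [rightEnd, hnot hv, cond_false]
    exact le_max_left _ _
  · rw [rightEnd, hclique hx, cond_true, reach, order_rawInput, Fintype.card_fin]
    exact le_max_left _ _
  · refine le_trans ?_ (le_max_right _ _)
    refine le_maxOver (mem_vertices order_rawInput u) ?_
    rw [Bool.and_eq_true, adj_rawInput]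
    exact ⟨hl ▸ inBlock_legOf hB hu, hvu⟩
  · have hbase : (rawInput G X blocks).rightEnd v =
        (bif (rawInput G X blocks).inClique v then (rawInput G X blocks).reach v
          else (rawInput G X blocks).leftEnd v) →
        (v ∉ X ∧ (rawInput G X blocks).rightEnd v = (rawInput G X blocks).leftEnd v) ∨
        (v ∈ X ∧ (rawInput G X blocks).rightEnd v =
          (Fintype.card (Fin n) + 1) * (rawInput G X blocks).height v) := by
      intro h
      by_cases hv : v ∈ X
      · rw [hclique hv, cond_true, reach, order_rawInput] at h
        exact .inr ⟨hv, by rw [h, Fintype.card_fin]⟩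
      · rw [hnot hv, cond_false] at h
        exact .inl ⟨hv, h⟩
    rcases maxOver_eq_zero_or (rawInput G X blocks).vertices
      (fun u => (rawInput G X blocks).inBlock ((rawInput G X blocks).legOf v) u &&
        (rawInput G X blocks).adj v u) (rawInput G X blocks).leftEnd with h | ⟨u, hu, hp, h⟩
    · refine .inr (hbase ?_)
      rw [rightEnd, h]
      exact max_eq_left (Nat.zero_le _)
    · rcases max_choice (bif (rawInput G X blocks).inClique v then (rawInput G X blocks).reach v
          else (rawInput G X blocks).leftEnd v) (maxOver (rawInput G X blocks).vertices
          (fun u => (rawInput G X blocks).inBlock ((rawInput G X blocks).legOf v) u &&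
          (rawInput G X blocks).adj v u) (rawInput G X blocks).leftEnd) with h' | h'
      · exact .inr (hbase h')
      · obtain ⟨w, rfl⟩ := exists_of_mem_vertices hu
        rw [Bool.and_eq_true, adj_rawInput] at hp
        obtain ⟨hk, hw⟩ := inBlock_rawInput.1 hp.1
        have hwX := Finpartition.notMem_of_mem_compl_part
          ((mem_blocks hB).1 (List.getElem_mem hk)) hw
        exact .inl ⟨w, hwX, (legOf_eq_iff hB hnd hwX).2 hp.1, hp.2, h'.trans h⟩

end

/-- The star described by the output of the algorithm. -/
noncomputable def starDescription (G : SimpleGraph (Fin n)) (X : Finset (Fin n))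
    (blocks : List (Finset (Fin n))) : StarDescription n where
  legs := blocks.length + 1
  length _ := ((rawInput G X blocks).legLength : ℚ≥0)
  leg v := ⟨(rawInput G X blocks).legOf v, Nat.lt_succ_of_le (legOf_le v)⟩
  offset v := ((rawInput G X blocks).offsetOf v : ℚ≥0)
  radius v := ((rawInput G X blocks).radiusOf v : ℚ≥0)

theorem toData_natRational (k : ℕ) :
    toData (k.bits, Nat.bits 1) = encodeRational (k : ℚ≥0) := by
  rw [encodeRational, NNRat.num_natCast, NNRat.den_natCast]
  rfl

theorem map_range_eq_ofFn {β : Type*} (f : ℕ → β) (n : ℕ) :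
    (List.range n).map f = List.ofFn fun i : Fin n => f i := by
  rw [List.ofFn_eq_map, ← List.map_coe_finRange_eq_range, List.map_map]
  rfl

theorem toData_output :
    toData (rawInput G X blocks).output = (starDescription G X blocks).encode := by
  change Data.cons (encodeDataList (List.map toData (List.map _ (List.range _))))
    (encodeDataList (List.map toData (List.map _ (List.range _)))) = _
  rw [List.map_map, List.map_map, map_range_eq_ofFn, map_range_eq_ofFn, order_rawInput,
    blockCount_rawInput, StarDescription.encode]
  simp only [starDescription, ← toData_natRational]
  rfl

theorem exists_neSModel_starDescription (hG : IsGoodPartition G X 𝓑) (hnd : blocks.Nodup)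
    (hB : blocks.toFinset = 𝓑.parts) :
    ∃ M : NeSModel G (Fin ((starDescription G X blocks).legs + 1)), M.tree.IsStar ∧
      (starDescription G X blocks).Describes M := by
  have hrep := (isStarData_rawInput hB hG hnd).representsOnStar
    (o := fun v : Fin n => (rawInput G X blocks).offsetOf v)
    (w := fun v : Fin n => (rawInput G X blocks).radiusOf v) hG
    (fun v hv => by
      simp [offsetOf, radiusOf, inClique_rawInput.2 hv, reach, order_rawInput])
    (fun v hv => by
      have : (rawInput G X blocks).inClique v = false := by
        rw [← Bool.not_eq_true, inClique_rawInput]; exact hv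
      simp [offsetOf, radiusOf, this])
  obtain ⟨M, h1, h2, h3, h4, h5, h6⟩ := exists_neSModel (G := G)
    (starDescription G X blocks).length
    (fun _ => by simp [starDescription, legLength])
    (starDescription G X blocks).leg (starDescription G X blocks).offset
    (starDescription G X blocks).radius (fun v => by
      simp only [starDescription, Nat.cast_le, legLength]
      exact (le_maxOver (p := fun _ => true) (mem_vertices order_rawInput v) rfl).trans
        (Nat.le_succ _)) (by
      intro u v huv
      rw [hrep u v huv]
      simp [EmbeddedTree.starDist, starDescription])
  exact ⟨M, h1, ⟨h2, h3, h4, h5, h6⟩⟩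

end RawInput

end

theorem mainTheorem2 :
    (∀ (V : Type*) [Fintype V] [DecidableEq V] (G : SimpleGraph V),
      HasGoodPartition G ↔ HasStarNeSModel G) ∧
    (∃ (p : Prog) (q : Polynomial ℕ),
      ∀ (n : ℕ) (G : SimpleGraph (Fin n)) (X : Finset (Fin n)) (𝓑 : Finpartition Xᶜ),
        IsGoodPartition G X 𝓑 →
        ∀ blocks : List (Finset (Fin n)), blocks.Nodup → blocks.toFinset = 𝓑.parts →
          ∃ (D : StarDescription n) (t : ℕ),
            Prog.Runs p (encodeInput G X blocks) D.encode t ∧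
            t ≤ q.eval (encodeInput G X blocks).size ∧
            ∃ M : NeSModel G (Fin (D.legs + 1)), M.tree.IsStar ∧ D.Describes M) := by
  refine ⟨fun V _ _ G => hasGoodPartition_iff_hasStarNeSModel G, ?_⟩
  obtain ⟨p, q, h⟩ := PolyTime.output
  refine ⟨p, q, fun n G X 𝓑 hG blocks hnd hB => ?_⟩
  obtain ⟨t, hrun, ht⟩ := h (rawInput G X blocks)
  rw [toData_rawInput, RawInput.toData_output] at hrun
  rw [encSize, toData_rawInput] at ht
  exact ⟨_, t, hrun, ht, RawInput.exists_neSModel_starDescription hG hnd hB⟩
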